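/- Let $d\in\mathbf N$, $s>1$ and $t>0$. Notation. $\Sigma_t^s(\mathbf R^d)$ is the (Beurling type) Gelfand–Shilov space of all $f\in C^\infty(\mathbf R^d)$ such that $\sup_{\alpha,\beta,x} |x^\alpha\partial^\beta f(x)|/(h^{|\alpha+\beta|}\alpha!^t\beta!^s)<\infty$ for every $h>0$, with the topology given by these norms, and $(\Sigma_t^s)'(\mathbf R^d)$ is its topological dual. $G_c^s(\mathbf R^d)$ is the space of compactly supported $f\in C^\infty(\mathbf R^d)$ such that $\sup_{\alpha,x}|\partial^\alpha f(x)|/(h^{|\alpha|}\alpha!^s)<\infty$ for every $h>0$; $\mathscr D_s'(\mathbf R^d)$ is its topological dual (the linear functionals that are continuous on the test functions supported in any fixed compact set), and $\mathscr E_s'(\mathbf R^d)\subseteq \mathscr D_s'(\mathbf R^d)$ is the subspace of ultradistributions of compact support. Thus $\mathscr E_s'\subseteq(\Sigma_t^s)'\subseteq\mathscr D_s'$. The Fourier transform is $\widehat f(\xi)=(2\pi)^{-d/2}\int f(x)e^{-i\langle x,\xi\rangle}\,dx$, extended to $(\Sigma_t^s)'(\mathbf R^d)$ by duality. For $v \in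 \mathscr D_s'(\mathbf R^d)$ and $\varphi\in G_c^s(\mathbf R^d)$, $\widehat{\varphi v}(\xi)=(2\pi)^{-d/2}\langle v,\varphi e^{-i\langle\cdot,\xi\rangle}\rangle$. A conic set is one that is invariant under multiplication by positive scalars. * For $u\in(\Sigma_t^s)'(\mathbf R^d)$ and a window $\psi\in\Sigma_t^s(\mathbf R^d)\setminus 0$ put $V_\psi u(x,\xi)=(2\pi)^{-d/2}\langle u, e^{-i\langle\cdot,\xi\rangle}\,\overline{\psi(\cdot-x)}\rangle$. A point $(x_0,\xi_0)\in \mathbf R^{2d}\setminus 0$ is not in $\mathrm{WF}^{t,s}(u)\subseteq\mathbf R^{2d}\setminus0$ if there is an open set $U\subseteq\mathbf R^{2d}\setminus 0$ containing $(x_0,\xi_0)$ such that $\sup_{\lambda>0,\,(x,\xi)\in U}e^{r\lambda}|V_\psi u(\lambda^tx,\lambda^s\xi)|<\infty$ for all $r>0$. * For $v\in\mathscr D_s'(\mathbf R^d)$, a point $(x_0,\xi_0)\in\mathbf R^d\times(\mathbf R^d\setminus0)$ is not in the Gevrey wave front set $\mathrm{WF}_s(v)\subseteq\mathbf R^d\times(\mathbf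 R^d\setminus0)$ if there are $\varphi\in G_c^s(\mathbf R^d)$ with $\varphi(x_0)=1$ and an open conic set $\Gamma\subseteq\mathbf R^d\setminus0$ containing $\xi_0$ such that $\sup_{\xi\in\Gamma}e^{r|\xi|^{1/s}}|\widehat{\varphi v}(\xi)|<\infty$ for all $r>0$. * For $u\in\mathscr E_s'(\mathbf R^d)+\Sigma_t^s(\mathbf R^d)$, whose Fourier transform is a continuous function, a point $\eta\in\mathbf R^d\setminus0$ is not in $V_s(u)\subseteq\mathbf R^d\setminus0$ if there is an open conic set $\Gamma\subseteq\mathbf R^d\setminus0$ containing $\eta$ such that $\sup_{\xi\in\Gamma}e^{r|\xi|^{1/s}}|\widehat u(\xi)|<\infty$ for all $r>0$. Statement. Let $u\in\mathscr E_s'(\mathbf R^d)+\Sigma_t^s(\mathbf R^d)$ and let $\pi_2(x,\xi)=\xi$. Then, for every choice of the window $\psi\in\Sigma_t^s(\mathbf R^d)\setminus0$ in the definition of $\mathrm{WF}^{t,s}(u)$, $$\mathrm{WF}^{t,s}(u)\subseteq\{0\}\times\pi_2\,\mathrm{WF}_s(u).$$ If moreover $t\geqslant s$, then $$\mathrm{WF}^{t,s}(u)=\{0\}\times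 V_s(u).$$ -/

import Mathlib

open scoped Nat ContDiff ComplexConjugate

noncomputable section

namespace GelfandShilov

/-- The Euclidean space `ℝᵈ`. -/
abbrev Rd (d : ℕ) : Type := EuclideanSpace ℝ (Fin d)

/-- `‖f‖ ≤ M` for the Gelfand-Shilov norm with parameter `h`:
`sup |x|ᵏ |Dⁿ f(x)| / (hᵏ⁺ⁿ k!ᵗ n!ˢ) ≤ M`, with `Dⁿ f(x)` the `n`-th Fréchet derivative.
As `|α|! ≤ d^|α| α!` and `α! ≤ |α|!`, the coordinate norms
`sup |x^α D^β f(x)| / (h^|α+β| α!ᵗ β!ˢ)` define the same space and the same topology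
when `h` ranges over all positive numbers. -/
def NormLE {d : ℕ} (t s h M : ℝ) (f : Rd d → ℂ) : Prop :=
  ∀ (k n : ℕ) (x : Rd d),
    ‖x‖ ^ k * ‖iteratedFDeriv ℝ n f x‖ ≤ M * (h ^ (k + n) * ((k ! : ℝ) ^ t * (n ! : ℝ) ^ s))

/-- `‖f‖ ≤ M` for the Gevrey norm with parameter `h`: `sup |Dⁿ f(x)| / (hⁿ n!ˢ) ≤ M`. -/
def GevreyNormLE {d : ℕ} (s h M : ℝ) (f : Rd d → ℂ) : Prop :=
  ∀ (n : ℕ) (x : Rd d), ‖iteratedFDeriv ℝ n f x‖ ≤ M * (h ^ n * (n ! : ℝ) ^ s)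

section Helpers

variable {d : ℕ} {s t h M N : ℝ} {f g : Rd d → ℂ}

lemma NormLE.nonneg (hf : NormLE t s h M f) : 0 ≤ M := by
  have := hf 0 0 0
  simp at this
  exact (norm_nonneg _).trans this

lemma GevreyNormLE.nonneg (hf : GevreyNormLE s h M f) : 0 ≤ M := by
  have := hf 0 0
  simp at this
  exact (norm_nonneg _).trans this

lemma NormLE.add (hfc : ContDiff ℝ ∞ f) (hgc : ContDiff ℝ ∞ g)
    (hf : NormLE t s h M f) (hg : NormLE t s h N g) : NormLE t s h (M + N) (f + g) := by
  intro k n x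
  have e : iteratedFDeriv ℝ n (f + g) x = iteratedFDeriv ℝ n f x + iteratedFDeriv ℝ n g x :=
    iteratedFDeriv_add_apply ((hfc.of_le (mod_cast le_top)).contDiffAt)
      ((hgc.of_le (mod_cast le_top)).contDiffAt)
  rw [e]
  have h1 := hf k n x
  have h2 := hg k n x
  have h3 := mul_le_mul_of_nonneg_left
    (norm_add_le (iteratedFDeriv ℝ n f x) (iteratedFDeriv ℝ n g x))
    (pow_nonneg (norm_nonneg x) k)
  linarith

lemma GevreyNormLE.add (hfc : ContDiff ℝ ∞ f) (hgc : ContDiff ℝ ∞ g)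
    (hf : GevreyNormLE s h M f) (hg : GevreyNormLE s h N g) :
    GevreyNormLE s h (M + N) (f + g) := by
  intro n x
  have e : iteratedFDeriv ℝ n (f + g) x = iteratedFDeriv ℝ n f x + iteratedFDeriv ℝ n g x :=
    iteratedFDeriv_add_apply ((hfc.of_le (mod_cast le_top)).contDiffAt)
      ((hgc.of_le (mod_cast le_top)).contDiffAt)
  rw [e]
  have h1 := hf n x
  have h2 := hg n x
  have h3 := norm_add_le (iteratedFDeriv ℝ n f x) (iteratedFDeriv ℝ n g x)
  linarith

lemma NormLE.smul (c : ℂ) (hfc : ContDiff ℝ ∞ f) (hf : NormLE t s h M f) :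
    NormLE t s h (‖c‖ * M) (c • f) := by
  intro k n x
  have e : iteratedFDeriv ℝ n (c • f) x = c • iteratedFDeriv ℝ n f x :=
    iteratedFDeriv_const_smul_apply ((hfc.of_le (mod_cast le_top)).contDiffAt)
  rw [e, norm_smul]
  have h1 := mul_le_mul_of_nonneg_left (hf k n x) (norm_nonneg c)
  linarith

lemma GevreyNormLE.smul (c : ℂ) (hfc : ContDiff ℝ ∞ f) (hf : GevreyNormLE s h M f) :
    GevreyNormLE s h (‖c‖ * M) (c • f) := by
  intro n x
  have e : iteratedFDeriv ℝ n (c • f) x = c • iteratedFDeriv ℝ n f x :=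
    iteratedFDeriv_const_smul_apply ((hfc.of_le (mod_cast le_top)).contDiffAt)
  rw [e, norm_smul]
  have h1 := mul_le_mul_of_nonneg_left (hf n x) (norm_nonneg c)
  linarith

lemma iteratedFDeriv_zero_fun' (n : ℕ) (x : Rd d) :
    iteratedFDeriv ℝ n (0 : Rd d → ℂ) x = 0 := by
  have : (0 : Rd d → ℂ) = fun _ => 0 := rfl
  rw [this, iteratedFDeriv_fun_zero]
  rfl

/-- Powers are dominated by `hᵏ k!ᵗ`, for every `h, t > 0`. -/
lemma exists_pow_le {a : ℝ} (ha : 0 ≤ a) (hh : 0 < h) (ht : 0 < t) :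
    ∃ C : ℝ, 0 ≤ C ∧ ∀ k : ℕ, a ^ k ≤ C * (h ^ k * (k ! : ℝ) ^ t) := by
  set b : ℝ := (a / h) ^ (t⁻¹) with hb
  have hb0 : 0 ≤ b := Real.rpow_nonneg (div_nonneg ha hh.le) _
  refine ⟨Real.exp b ^ t, by positivity, fun k => ?_⟩
  have h1 : b ^ k ≤ (k ! : ℝ) * Real.exp b := by
    have := Real.pow_div_factorial_le_exp b hb0 k
    rwa [div_le_iff₀ (by positivity), mul_comm] at this
  have h2 : (b ^ k) ^ t = (a / h) ^ k := by
    rw [← Real.rpow_natCast, ← Real.rpow_mul hb0, mul_comm, Real.rpow_mul hb0, hb,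
      ← Real.rpow_mul (div_nonneg ha hh.le), inv_mul_cancel₀ ht.ne', Real.rpow_one,
      Real.rpow_natCast]
  have h3 : (a / h) ^ k ≤ ((k ! : ℝ) * Real.exp b) ^ t := by
    rw [← h2]
    exact Real.rpow_le_rpow (by positivity) h1 ht.le
  rw [Real.mul_rpow (by positivity) (by positivity), div_pow, div_le_iff₀ (by positivity)] at h3
  linarith

/-- The character `x ↦ e^{-i⟨x, ξ⟩}`. -/
def char (ξ : Rd d) (x : Rd d) : ℂ := Complex.exp (-Complex.I * (inner ℝ x ξ : ℝ))

lemma char_eq (ξ : Rd d) :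
    char ξ = (fun y : ℝ => Complex.exp (-Complex.I * (y : ℂ))) ∘ (innerSL ℝ ξ) := by
  funext x
  simp [char, real_inner_comm]

lemma contDiff_cexp_aux : ContDiff ℝ ∞ (fun y : ℝ => Complex.exp (-Complex.I * (y : ℂ))) :=
  (contDiff_const.mul Complex.ofRealCLM.contDiff).cexp

lemma contDiff_char (ξ : Rd d) : ContDiff ℝ ∞ (char ξ) := by
  rw [char_eq]
  exact contDiff_cexp_aux.comp (innerSL ℝ ξ).contDiff

lemma iteratedDeriv_cexp_aux (n : ℕ) :
    iteratedDeriv n (fun y : ℝ => Complex.exp (-Complex.I * (y : ℂ))) =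
      fun y : ℝ => (-Complex.I) ^ n * Complex.exp (-Complex.I * (y : ℂ)) := by
  induction n with
  | zero => simp
  | succ n ih =>
    rw [iteratedDeriv_succ, ih]
    funext y
    have h1 : HasDerivAt (fun y : ℝ => Complex.exp (-Complex.I * (y : ℂ)))
        (Complex.exp (-Complex.I * (y : ℂ)) * (-Complex.I * 1)) y :=
      ((Complex.ofRealCLM.hasDerivAt (x := y)).const_mul (-Complex.I)).cexp
    rw [(h1.const_mul ((-Complex.I) ^ n)).deriv]
    ring

lemma norm_iteratedFDeriv_char_le (ξ x : Rd d) (n : ℕ) :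
    ‖iteratedFDeriv ℝ n (char ξ) x‖ ≤ ‖ξ‖ ^ n := by
  rw [char_eq, ContinuousLinearMap.iteratedFDeriv_comp_right _ contDiff_cexp_aux x
    (i := n) (mod_cast le_top)]
  refine (ContinuousMultilinearMap.norm_compContinuousLinearMap_le _ _).trans ?_
  rw [norm_iteratedFDeriv_eq_norm_iteratedDeriv, iteratedDeriv_cexp_aux]
  have : ‖Complex.exp (-Complex.I * ((innerSL ℝ ξ x : ℝ) : ℂ))‖ = 1 := by
    rw [Complex.norm_exp]; simp
  rw [norm_mul, this]
  simp [innerSL_apply_norm]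

/-- Multiplication by a character, at one point: the bounds survive with `2h` in place of `h`. -/
lemma char_mul_bound (hs : 0 < s) (hh : 0 < h) (ξ : Rd d) :
    ∃ C : ℝ, 0 ≤ C ∧ ∀ (f : Rd d → ℂ), ContDiff ℝ ∞ f → ∀ (a A : ℝ) (x : Rd d), 0 ≤ a → 0 ≤ A →
      (∀ n : ℕ, a * ‖iteratedFDeriv ℝ n f x‖ ≤ A * (h ^ n * (n ! : ℝ) ^ s)) →
      ∀ n : ℕ, a * ‖iteratedFDeriv ℝ n (fun y => char ξ y * f y) x‖ ≤
        C * A * ((2 * h) ^ n * (n ! : ℝ) ^ s) := by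
  obtain ⟨C, hC, hCb⟩ := exists_pow_le (norm_nonneg ξ) hh hs
  refine ⟨C, hC, fun f hfc a A x ha hA hb n => ?_⟩
  have h1 := norm_iteratedFDeriv_mul_le (N := ∞) (contDiff_char ξ) hfc x (n := n)
    (mod_cast le_top)
  have h2 : ∀ i ∈ Finset.range (n + 1),
      a * ((n.choose i : ℝ) * ‖iteratedFDeriv ℝ i (char ξ) x‖ *
        ‖iteratedFDeriv ℝ (n - i) f x‖) ≤ (n.choose i : ℝ) * (C * A * (h ^ n * (n ! : ℝ) ^ s)) := by
    intro i hi
    have hin : i ≤ n := Nat.lt_succ_iff.mp (Finset.mem_range.mp hi)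
    have e1 : ‖iteratedFDeriv ℝ i (char ξ) x‖ ≤ C * (h ^ i * (i ! : ℝ) ^ s) :=
      (norm_iteratedFDeriv_char_le ξ x i).trans (hCb i)
    have e2 := hb (n - i)
    have e3 : ((i ! : ℝ) ^ s) * (((n - i)! : ℕ) : ℝ) ^ s ≤ (n ! : ℝ) ^ s := by
      rw [← Real.mul_rpow (by positivity) (by positivity)]
      refine Real.rpow_le_rpow (by positivity) ?_ hs.le
      exact_mod_cast Nat.le_of_dvd (Nat.factorial_pos n)
        (Nat.factorial_mul_factorial_dvd_factorial hin)
    have e4 : h ^ i * h ^ (n - i) = h ^ n := by rw [← pow_add, Nat.add_sub_cancel' hin]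
    have e5 := mul_le_mul e1 e2 (by positivity) (by positivity)
    have e6 : C * (h ^ i * (i ! : ℝ) ^ s) * (A * (h ^ (n - i) * (((n - i)! : ℕ) : ℝ) ^ s)) =
        C * A * h ^ n * (((i ! : ℝ) ^ s) * (((n - i)! : ℕ) : ℝ) ^ s) := by
      rw [← e4]; ring
    have e7 : C * A * h ^ n * (((i ! : ℝ) ^ s) * (((n - i)! : ℕ) : ℝ) ^ s) ≤
        C * A * h ^ n * (n ! : ℝ) ^ s := mul_le_mul_of_nonneg_left e3 (by positivity)
    have e8 : ‖iteratedFDeriv ℝ i (char ξ) x‖ * (a * ‖iteratedFDeriv ℝ (n - i) f x‖) ≤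
        C * A * (h ^ n * (n ! : ℝ) ^ s) := by
      rw [e6] at e5; linarith
    have e9 := mul_le_mul_of_nonneg_left e8 (Nat.cast_nonneg (α := ℝ) (n.choose i))
    linarith
  have h3 : ∑ i ∈ Finset.range (n + 1), (n.choose i : ℝ) = 2 ^ n := by
    exact_mod_cast Nat.sum_range_choose n
  calc a * ‖iteratedFDeriv ℝ n (fun y => char ξ y * f y) x‖
      ≤ a * ∑ i ∈ Finset.range (n + 1), (n.choose i : ℝ) * ‖iteratedFDeriv ℝ i (char ξ) x‖ *
        ‖iteratedFDeriv ℝ (n - i) f x‖ := mul_le_mul_of_nonneg_left h1 ha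
    _ ≤ ∑ i ∈ Finset.range (n + 1), (n.choose i : ℝ) * (C * A * (h ^ n * (n ! : ℝ) ^ s)) := by
        rw [Finset.mul_sum]; exact Finset.sum_le_sum h2
    _ = C * A * ((2 * h) ^ n * (n ! : ℝ) ^ s) := by
        rw [← Finset.sum_mul, h3, mul_pow]; ring

lemma NormLE.translate (ht : 0 < t) (hh : 0 < h) (y : Rd d) :
    ∃ C : ℝ, ∀ (f : Rd d → ℂ) (M : ℝ), NormLE t s h M f →
      NormLE t s (2 * h) (C * M) (fun z => f (z - y)) := by
  obtain ⟨C, hC, hCb⟩ := exists_pow_le (norm_nonneg y) hh ht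
  refine ⟨1 + C, fun f M hf k n x => ?_⟩
  have hM := hf.nonneg
  rw [iteratedFDeriv_comp_sub]
  set D := ‖iteratedFDeriv ℝ n f (x - y)‖ with hD
  have hD0 : 0 ≤ D := norm_nonneg _
  have h1 : ‖x‖ ^ k ≤ 2 ^ k * (‖x - y‖ ^ k + ‖y‖ ^ k) := by
    have e1 : ‖x‖ ≤ ‖x - y‖ + ‖y‖ := by
      simpa using norm_add_le (x - y) y
    refine (pow_le_pow_left₀ (norm_nonneg x) e1 k).trans ?_
    refine (add_pow_le (norm_nonneg _) (norm_nonneg _) k).trans ?_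
    refine mul_le_mul_of_nonneg_right ?_ (by positivity)
    exact pow_le_pow_right₀ one_le_two (Nat.sub_le k 1)
  have h2 := hf k n (x - y)
  have h3 := hf 0 n (x - y)
  rw [← hD] at h2 h3
  simp only [pow_zero, one_mul, zero_add, Nat.factorial_zero, Nat.cast_one, Real.one_rpow] at h3
  have h4 := mul_le_mul (hCb k) h3 hD0 (by positivity)
  have h5 : ‖x‖ ^ k * D ≤ 2 ^ k * ((1 + C) * M * (h ^ (k + n) * ((k ! : ℝ) ^ t * (n ! : ℝ) ^ s))) := by
    have := mul_le_mul_of_nonneg_right h1 hD0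
    refine this.trans ?_
    rw [mul_assoc]
    refine mul_le_mul_of_nonneg_left ?_ (by positivity)
    rw [pow_add] at h2 ⊢
    linarith
  refine h5.trans ?_
  have h6 : (2 : ℝ) ^ k ≤ 2 ^ (k + n) := pow_le_pow_right₀ one_le_two (Nat.le_add_right k n)
  have h7 := mul_le_mul_of_nonneg_right h6
    (show 0 ≤ (1 + C) * M * (h ^ (k + n) * ((k ! : ℝ) ^ t * (n ! : ℝ) ^ s)) by positivity)
  refine h7.trans (le_of_eq ?_)
  rw [mul_pow]
  ring

lemma norm_iteratedFDeriv_conj (f : Rd d → ℂ) (n : ℕ) (x : Rd d) :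
    ‖iteratedFDeriv ℝ n (fun y => conj (f y)) x‖ = ‖iteratedFDeriv ℝ n f x‖ :=
  LinearIsometryEquiv.norm_iteratedFDeriv_comp_left Complex.conjLIE f x n

lemma contDiff_conj (hf : ContDiff ℝ ∞ f) : ContDiff ℝ ∞ (fun y => conj (f y)) :=
  Complex.conjCLE.contDiff.comp hf

end Helpers

/-! ### Test functions -/

/-- The Beurling type Gelfand-Shilov space `Σ_t^s(ℝᵈ)`: the smooth functions all of whose
norms, for all `h > 0`, are finite. -/
def Sig (d : ℕ) (t s : ℝ) : Submodule ℂ (Rd d → ℂ) where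
  carrier := {f | ContDiff ℝ ∞ f ∧ ∀ h : ℝ, 0 < h → ∃ M : ℝ, NormLE t s h M f}
  add_mem' := by
    rintro f g ⟨hf, hf'⟩ ⟨hg, hg'⟩
    refine ⟨hf.add hg, fun h hh => ?_⟩
    obtain ⟨M, hM⟩ := hf' h hh
    obtain ⟨N, hN⟩ := hg' h hh
    exact ⟨M + N, hM.add hf hg hN⟩
  zero_mem' := by
    refine ⟨contDiff_const, fun h hh => ⟨0, fun k n x => ?_⟩⟩
    rw [iteratedFDeriv_zero_fun']
    simp
  smul_mem' := by
    rintro c f ⟨hf, hf'⟩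
    refine ⟨contDiff_const.smul hf, fun h hh => ?_⟩
    obtain ⟨M, hM⟩ := hf' h hh
    exact ⟨‖c‖ * M, hM.smul c hf⟩

/-- The space `G_c^s(ℝᵈ)` of compactly supported Gevrey functions of order `s`, of Beurling type:
for every `h > 0` there is `C` with `|Dⁿ f| ≤ C hⁿ n!ˢ`. As `f` has compact support, asking for
this on each compact set and asking for it on `ℝᵈ` is the same. -/
def GevreyC (d : ℕ) (s : ℝ) : Submodule ℂ (Rd d → ℂ) where
  carrier := {f | ContDiff ℝ ∞ f ∧ HasCompactSupport f ∧
    ∀ h : ℝ, 0 < h → ∃ M : ℝ, GevreyNormLE s h M f}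
  add_mem' := by
    rintro f g ⟨hf, hfc, hf'⟩ ⟨hg, hgc, hg'⟩
    refine ⟨hf.add hg, hfc.add hgc, fun h hh => ?_⟩
    obtain ⟨M, hM⟩ := hf' h hh
    obtain ⟨N, hN⟩ := hg' h hh
    exact ⟨M + N, hM.add hf hg hN⟩
  zero_mem' := by
    refine ⟨contDiff_const, HasCompactSupport.zero, fun h hh => ⟨0, fun n x => ?_⟩⟩
    rw [iteratedFDeriv_zero_fun']
    simp
  smul_mem' := by
    rintro c f ⟨hf, hfc, hf'⟩
    refine ⟨contDiff_const.smul hf, hfc.smul_left (f := fun _ => c), fun h hh => ?_⟩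
    obtain ⟨M, hM⟩ := hf' h hh
    exact ⟨‖c‖ * M, hM.smul c hf⟩

section Operations

variable {d : ℕ} {s t : ℝ}

/-- `y ↦ e^{-i⟨y, ξ⟩} ϕ(y)` as an element of `G_c^s`. -/
def GevreyC.mulChar (hs : 0 < s) (ϕ : GevreyC d s) (ξ : Rd d) : GevreyC d s :=
  ⟨fun y => char ξ y * ϕ.1 y, by
    refine ⟨(contDiff_char ξ).mul ϕ.2.1, ϕ.2.2.1.mul_left, fun h hh => ?_⟩
    obtain ⟨C, hC, hCb⟩ := char_mul_bound (h := h / 2) hs (by positivity) ξ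
    obtain ⟨M, hM⟩ := ϕ.2.2.2 (h / 2) (by positivity)
    refine ⟨C * M, fun n x => ?_⟩
    have := hCb ϕ.1 ϕ.2.1 1 M x zero_le_one hM.nonneg (fun n => by simpa using hM n x) n
    rw [one_mul, mul_div_cancel₀ h two_ne_zero] at this
    exact this⟩

/-- `y ↦ e^{-i⟨y, ξ⟩} ψ(y)` as an element of `Σ_t^s`. -/
def Sig.mulChar (hs : 0 < s) (ψ : Sig d t s) (ξ : Rd d) : Sig d t s :=
  ⟨fun y => char ξ y * ψ.1 y, by
    refine ⟨(contDiff_char ξ).mul ψ.2.1, fun h hh => ?_⟩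
    obtain ⟨C, hC, hCb⟩ := char_mul_bound (h := h / 2) hs (by positivity) ξ
    obtain ⟨M, hM⟩ := ψ.2.2 (h / 2) (by positivity)
    have hM0 := hM.nonneg
    refine ⟨C * M, fun k n x => ?_⟩
    have := hCb ψ.1 ψ.2.1 (‖x‖ ^ k) (M * ((h / 2) ^ k * (k ! : ℝ) ^ t)) x (by positivity)
      (by positivity) (fun n => (hM k n x).trans (le_of_eq (by rw [pow_add]; ring))) n
    rw [mul_div_cancel₀ h two_ne_zero] at this
    refine this.trans ?_
    have e : (h / 2) ^ k ≤ h ^ k := pow_le_pow_left₀ (by positivity) (by linarith) k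
    have e2 := mul_le_mul_of_nonneg_right e
      (show 0 ≤ C * M * (k ! : ℝ) ^ t * (h ^ n * (n ! : ℝ) ^ s) by positivity)
    rw [pow_add]
    linarith⟩

/-- The translate `y ↦ ψ(y - x)` as an element of `Σ_t^s`. -/
def Sig.translate (ht : 0 < t) (ψ : Sig d t s) (x : Rd d) : Sig d t s :=
  ⟨fun y => ψ.1 (y - x), by
    refine ⟨ψ.2.1.comp (contDiff_id.sub contDiff_const), fun h hh => ?_⟩
    obtain ⟨C, hC⟩ := NormLE.translate (s := s) (h := h / 2) ht (by positivity) x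
    obtain ⟨M, hM⟩ := ψ.2.2 (h / 2) (by positivity)
    have := hC ψ.1 M hM
    rw [mul_div_cancel₀ h two_ne_zero] at this
    exact ⟨C * M, this⟩⟩

/-- The complex conjugate as an element of `Σ_t^s`. -/
def Sig.conj (ψ : Sig d t s) : Sig d t s :=
  ⟨fun y => (starRingEnd ℂ) (ψ.1 y), by
    refine ⟨contDiff_conj ψ.2.1, fun h hh => ?_⟩
    obtain ⟨M, hM⟩ := ψ.2.2 h hh
    exact ⟨M, fun k n x => by rw [norm_iteratedFDeriv_conj]; exact hM k n x⟩⟩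

/-- On functions supported in a fixed compact set the Gevrey norms dominate the
Gelfand-Shilov norms. -/
lemma exists_normLE_of_gevreyNormLE (ht : 0 < t) {h : ℝ} (hh : 0 < h) {K : Set (Rd d)}
    (hK : IsCompact K) :
    ∃ C : ℝ, 0 ≤ C ∧ ∀ (f : Rd d → ℂ) (M : ℝ), tsupport f ⊆ K → GevreyNormLE s h M f →
      NormLE t s h (C * M) f := by
  obtain ⟨R, hR⟩ := hK.isBounded.exists_norm_le
  obtain ⟨C, hC, hCb⟩ := exists_pow_le (abs_nonneg R) hh ht
  refine ⟨C, hC, fun f M hfK hf k n x => ?_⟩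
  have hM := hf.nonneg
  by_cases hx : x ∈ K
  · have h1 : ‖x‖ ^ k ≤ C * (h ^ k * (k ! : ℝ) ^ t) :=
      (pow_le_pow_left₀ (norm_nonneg x) ((hR x hx).trans (le_abs_self R)) k).trans (hCb k)
    have h2 := mul_le_mul h1 (hf n x) (norm_nonneg _) (by positivity)
    refine h2.trans (le_of_eq ?_)
    rw [pow_add]; ring
  · have h1 : iteratedFDeriv ℝ n f x = 0 := by
      by_contra hne
      exact hx (hfK (support_iteratedFDeriv_subset n (Function.mem_support.mpr hne)))
    rw [h1, norm_zero, mul_zero]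
    positivity

lemma gevreyC_le_sig (ht : 0 < t) : GevreyC d s ≤ Sig d t s := by
  rintro f ⟨hf, hfc, hb⟩
  refine ⟨hf, fun h hh => ?_⟩
  obtain ⟨M, hM⟩ := hb h hh
  obtain ⟨C, -, hC⟩ := exists_normLE_of_gevreyNormLE (s := s) ht hh hfc
  exact ⟨C * M, hC f M subset_rfl hM⟩

end Operations

/-! ### Ultradistributions

Ultradistributions act linearly, `⟨u, ϕ⟩`; the action that is conjugate linear in the test
function is `(u, ϕ) = ⟨u, conj ϕ⟩`. -/

/-- The space `(Σ_t^s)'(ℝᵈ)`: linear functionals on `Σ_t^s` that are continuous, i.e. bounded by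
a multiple of the norm with parameter `h` for some `h > 0` (these norms define the topology and
increase as `h` decreases). -/
structure SigDual (d : ℕ) (t s : ℝ) where
  toLin : Sig d t s →ₗ[ℂ] ℂ
  bounded : ∃ h : ℝ, 0 < h ∧ ∃ C : ℝ, ∀ (f : Sig d t s) (M : ℝ),
    NormLE t s h M f.1 → ‖toLin f‖ ≤ C * M

/-- The space `D_s'(ℝᵈ)` of Gevrey ultradistributions of order `s`: linear functionals on `G_c^s`
whose restrictions to the test functions supported in `K` are continuous, for all compact `K`. -/
structure GevreyDual (d : ℕ) (s : ℝ) where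
  toLin : GevreyC d s →ₗ[ℂ] ℂ
  bounded : ∀ K : Set (Rd d), IsCompact K → ∃ h : ℝ, 0 < h ∧ ∃ C : ℝ,
    ∀ (f : GevreyC d s) (M : ℝ), tsupport f.1 ⊆ K → GevreyNormLE s h M f.1 → ‖toLin f‖ ≤ C * M

section Dual

variable {d : ℕ} {s t : ℝ}

/-- The embedding `(Σ_t^s)' ⊆ D_s'`: restriction to `G_c^s ⊆ Σ_t^s`. -/
def SigDual.toGevreyDual (ht : 0 < t) (u : SigDual d t s) : GevreyDual d s where
  toLin := u.toLin ∘ₗ Submodule.inclusion (gevreyC_le_sig ht)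
  bounded := by
    intro K hK
    obtain ⟨h, hh, C, hC⟩ := u.bounded
    obtain ⟨C', -, hC'⟩ := exists_normLE_of_gevreyNormLE (s := s) ht hh hK
    refine ⟨h, hh, C * C', fun f M hfK hf => ?_⟩
    have := hC (Submodule.inclusion (gevreyC_le_sig ht) f) (C' * M) (hC' f.1 M hfK hf)
    rw [mul_assoc]
    exact this

/-- `v ∈ D_s'` has compact support, i.e. `v ∈ E_s'`: it vanishes on the complement of some
compact set. -/
def GevreyDual.CompactlySupported (v : GevreyDual d s) : Prop :=
  ∃ K : Set (Rd d), IsCompact K ∧ ∀ ϕ : GevreyC d s, tsupport ϕ.1 ⊆ Kᶜ → v.toLin ϕ = 0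

/-- `u ∈ E_s' + Σ_t^s`, as subspaces of `D_s'`: `u = v + w` with `v ∈ E_s'` and `w ∈ Σ_t^s`,
where `w` acts by integration. -/
def SigDual.MemCompactAddSig (ht : 0 < t) (u : SigDual d t s) : Prop :=
  ∃ v : GevreyDual d s, v.CompactlySupported ∧ ∃ w : Sig d t s, ∀ ϕ : GevreyC d s,
    (u.toGevreyDual ht).toLin ϕ = v.toLin ϕ + ∫ x, w.1 x * ϕ.1 x

/-- The normalizing factor `(2π)^{-d/2}`. -/
def fourierConst (d : ℕ) : ℂ := (((2 * Real.pi) ^ (-(d : ℝ) / 2) : ℝ) : ℂ)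

/-- The inverse Fourier transform `(2π)^{-d/2} ∫ f(x) e^{i⟨x, ξ⟩} dx`. -/
def fourierInv (f : Rd d → ℂ) (ξ : Rd d) : ℂ :=
  fourierConst d * ∫ x, f x * Complex.exp (Complex.I * (inner ℝ x ξ : ℝ))

/-- The Fourier transform of `u ∈ (Σ_t^s)'`, defined by `⟨û, χ⟩ = ⟨u, χ̂⟩`, is the continuous
function `g`. Here `χ̂ = ϕ` runs through `Σ_t^s`, so that `χ` is the inverse Fourier transform
of `ϕ`. -/
def SigDual.HasFourierTransform (u : SigDual d t s) (g : Rd d → ℂ) : Prop :=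
  Continuous g ∧ ∀ ϕ : Sig d t s,
    MeasureTheory.Integrable (fun ξ => g ξ * fourierInv ϕ.1 ξ) ∧
      u.toLin ϕ = ∫ ξ, g ξ * fourierInv ϕ.1 ξ

/-- The short-time Fourier transform
`V_ψ u(x, ξ) = (2π)^{-d/2} (u, M_ξ T_x ψ) = (2π)^{-d/2} ⟨u, e^{-i⟨·, ξ⟩} conj ψ(· - x)⟩`. -/
def SigDual.stft (ht : 0 < t) (hs : 0 < s) (u : SigDual d t s) (ψ : Sig d t s)
    (x ξ : Rd d) : ℂ :=
  fourierConst d * u.toLin (Sig.mulChar hs (Sig.translate ht (Sig.conj ψ) x) ξ)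

/-- The Fourier transform of the compactly supported ultradistribution `ϕ v`,
`(ϕ v)^(ξ) = (2π)^{-d/2} ⟨v, ϕ e^{-i⟨·, ξ⟩}⟩`, for `v ∈ D_s'` and `ϕ ∈ G_c^s`. -/
def GevreyDual.localFourier (hs : 0 < s) (v : GevreyDual d s) (ϕ : GevreyC d s)
    (ξ : Rd d) : ℂ :=
  fourierConst d * v.toLin (GevreyC.mulChar hs ϕ ξ)

/-- Open conic subsets of `ℝᵈ \ 0`. -/
def IsOpenConic (Γ : Set (Rd d)) : Prop :=
  IsOpen Γ ∧ (0 : Rd d) ∉ Γ ∧ ∀ ξ ∈ Γ, ∀ a : ℝ, 0 < a → a • ξ ∈ Γ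

/-- `sup_{ξ ∈ Γ} e^{r |ξ|^{1/s}} |g(ξ)| < ∞` for all `r > 0`. -/
def DecaysOn (s : ℝ) (g : Rd d → ℂ) (Γ : Set (Rd d)) : Prop :=
  ∀ r : ℝ, 0 < r → ∃ C : ℝ, ∀ ξ ∈ Γ, Real.exp (r * ‖ξ‖ ^ (1 / s)) * ‖g ξ‖ ≤ C

/-- The Gevrey wave front set `WF_s(v) ⊆ ℝᵈ × (ℝᵈ \ 0)` of `v ∈ D_s'`. -/
def GevreyDual.waveFront (hs : 0 < s) (v : GevreyDual d s) : Set (Rd d × Rd d) :=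
  {p | p.2 ≠ 0 ∧ ¬ ∃ ϕ : GevreyC d s, ϕ.1 p.1 = 1 ∧
    ∃ Γ : Set (Rd d), IsOpenConic Γ ∧ p.2 ∈ Γ ∧ DecaysOn s (v.localFourier hs ϕ) Γ}

/-- The set `V_s(u) ⊆ ℝᵈ \ 0` of directions in which `û` does not decay. -/
def SigDual.singularDirections (u : SigDual d t s) : Set (Rd d) :=
  {η | η ≠ 0 ∧ ¬ ∃ g : Rd d → ℂ, u.HasFourierTransform g ∧
    ∃ Γ : Set (Rd d), IsOpenConic Γ ∧ η ∈ Γ ∧ DecaysOn s g Γ}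

/-- The `t,s`-Gelfand-Shilov wave front set `WF^{t,s}(u) ⊆ T*ℝᵈ \ 0`, computed with the
window `ψ`. -/
def SigDual.waveFront (ht : 0 < t) (hs : 0 < s) (ψ : Sig d t s) (u : SigDual d t s) :
    Set (Rd d × Rd d) :=
  {p | p ≠ 0 ∧ ¬ ∃ U : Set (Rd d × Rd d), IsOpen U ∧ (0 : Rd d × Rd d) ∉ U ∧ p ∈ U ∧
    ∀ r : ℝ, 0 < r → ∃ C : ℝ, ∀ l : ℝ, 0 < l → ∀ z ∈ U,
      Real.exp (r * l) * ‖u.stft ht hs ψ (l ^ t • z.1) (l ^ s • z.2)‖ ≤ C}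

end Dual

end GelfandShilov

end

/-!
Write `u = v + w` with `v` of compact support and `w ∈ Σ_t^s`. Pairing `v` with characters shows
that `û` is a function with `|û(ξ)| ≤ C exp (r₀ |ξ|^(1/s))`, and localization gives
`|V_ψ u(x, ξ)| ≤ C exp (r₀ |ξ|^(1/s) - r |x|^(1/t))` for every `r`. At `(l^t x, l^s ξ)` both
exponents are linear in `l`, so `x ≠ 0` is never in the wave front set.

Up to a character, `V_ψ u(·, ξ)` is the inverse Fourier transform of `û` times a translate by `ξ`
of the transform `Ψ` of the conjugate window, and `Ψ` decays faster than `exp (-r |·|^(1/s))` for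
every `r`. Integrating `û(η) Ψ(η - ξ)` over `η` carries decay of `û` on a cone over to `V_ψ u`;
inverting the transform in `x` gives `û(η) Ψ(η - ξ)` back as an integral of `V_ψ u(·, ξ)`, which
carries decay the other way, as `Ψ` has a nonzero value. This identifies the fibre over `x = 0` with
`V_s(u)`.

If no point over `η₀` lies in `WF_s(u)`, finitely many cutoffs `ϕ` with `ϕ u` decaying near
the direction `η₀` cover the support of `v`. Since `s > 1`, Gevrey functions that are bounded below
have Gevrey inverses, so `v = ∑ θ ϕ v` with Gevrey `θ`. Multiplying `ϕ v` by `θ` convolves its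
transform with a rapidly decreasing function, which preserves decay on slightly smaller cones.
-/

open MeasureTheory FourierTransform

noncomputable section

namespace GelfandShilov

/-! ### Factorials against stretched exponentials -/

section StretchedExponentials

variable {a b h p r s C : ℝ}

lemma add_rpow_le_two_rpow_mul (ha : 0 ≤ a) (hb : 0 ≤ b) (hp : 0 ≤ p) :
    (a + b) ^ p ≤ 2 ^ p * (a ^ p + b ^ p) := by
  have hmax : (max a b) ^ p ≤ a ^ p + b ^ p := by
    rcases max_choice a b with h | h <;> rw [h] <;>
      linarith [Real.rpow_nonneg ha p, Real.rpow_nonneg hb p]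
  calc (a + b) ^ p ≤ (2 * max a b) ^ p := by
        gcongr
        linarith [le_max_left a b, le_max_right a b]
    _ = 2 ^ p * (max a b) ^ p := Real.mul_rpow zero_le_two (by positivity)
    _ ≤ 2 ^ p * (a ^ p + b ^ p) := by gcongr

lemma pow_le_factorial_rpow_mul_exp (hs : 0 < s) (hh : 0 < h) (ha : 0 ≤ a) (n : ℕ) :
    a ^ n ≤ h ^ n * (n ! : ℝ) ^ s * Real.exp (s * (1 / h) ^ (1 / s) * a ^ (1 / s)) := by
  set b : ℝ := (a / h) ^ (1 / s) with hb
  have hb0 : 0 ≤ b := by positivity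
  have hpow : b ^ n ≤ n ! * Real.exp b := by
    have := Real.pow_div_factorial_le_exp b hb0 n
    rwa [div_le_iff₀' (by positivity)] at this
  have hbs : b ^ s = a / h := by
    rw [hb, one_div, Real.rpow_inv_rpow (by positivity) hs.ne']
  have hexp : Real.exp b ^ s = Real.exp (s * (1 / h) ^ (1 / s) * a ^ (1 / s)) := by
    rw [← Real.exp_mul, hb, div_eq_mul_one_div, Real.mul_rpow ha (by positivity)]
    ring_nf
  calc a ^ n = h ^ n * (b ^ s) ^ n := by rw [hbs, ← mul_pow, mul_div_cancel₀ a hh.ne']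
    _ = h ^ n * (b ^ n) ^ s := by rw [Real.rpow_pow_comm hb0]
    _ ≤ h ^ n * (n ! * Real.exp b) ^ s := by gcongr
    _ = _ := by rw [Real.mul_rpow (by positivity) (by positivity), hexp, ← mul_assoc]

lemma mul_exp_half_le {y : ℝ} (H : ∀ n : ℕ, b * (y ^ n / n !) ≤ C) :
    b * Real.exp (y / 2) ≤ C * 2 := by
  have hexp := (NormedSpace.expSeries_div_hasSum_exp (𝔸 := ℝ) (y / 2)).mul_left b
  rw [← Real.exp_eq_exp_ℝ] at hexp
  refine hasSum_le (fun n => ?_) hexp (hasSum_geometric_two.mul_left C)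
  calc b * ((y / 2) ^ n / n !) = b * (y ^ n / n !) * (1 / 2) ^ n := by
        rw [div_pow, one_div_pow]; ring
    _ ≤ C * (1 / 2) ^ n := by gcongr; exact H n

lemma exists_le_exp_neg_of_moments (hs : 0 < s) (hr : 0 < r) :
    ∃ h : ℝ, 0 < h ∧ ∀ a b C : ℝ, 0 ≤ a → 0 ≤ b → 0 ≤ C →
      (∀ n : ℕ, a ^ n * b ≤ C * (h ^ n * (n ! : ℝ) ^ s)) →
      b ≤ 2 ^ s * C * Real.exp (-(r * a ^ (1 / s))) := by
  set q : ℝ := s / (2 * r) with hq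
  have hq0 : 0 < q := by positivity
  refine ⟨q ^ s, by positivity, fun a b C ha hb hC H => ?_⟩
  set y : ℝ := a ^ s⁻¹ / q with hy
  have hmoment : ∀ n : ℕ, b ^ s⁻¹ * (y ^ n / n !) ≤ C ^ s⁻¹ := by
    intro n
    have hroot := Real.rpow_le_rpow (by positivity) (H n) (inv_nonneg.mpr hs.le)
    rw [Real.mul_rpow (by positivity) hb, Real.mul_rpow hC (by positivity),
      Real.mul_rpow (by positivity) (by positivity), ← Real.rpow_pow_comm ha,
      ← Real.rpow_pow_comm (by positivity), Real.rpow_rpow_inv hq0.le hs.ne',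
      Real.rpow_rpow_inv (by positivity) hs.ne'] at hroot
    rw [hy, div_pow, div_div, mul_div_assoc', div_le_iff₀ (by positivity)]
    linarith
  have hroot : b ^ s⁻¹ ≤ C ^ s⁻¹ * 2 * Real.exp (-(y / 2)) := by
    rw [Real.exp_neg, ← div_eq_mul_inv, le_div_iff₀ (Real.exp_pos _)]
    exact mul_exp_half_le hmoment
  calc b = (b ^ s⁻¹) ^ s := (Real.rpow_inv_rpow hb hs.ne').symm
    _ ≤ (C ^ s⁻¹ * 2 * Real.exp (-(y / 2))) ^ s := by gcongr
    _ = 2 ^ s * C * Real.exp (-(y / 2) * s) := by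
        rw [Real.mul_rpow (by positivity) (by positivity),
          Real.mul_rpow (by positivity) zero_le_two, Real.rpow_inv_rpow hC hs.ne', Real.exp_mul]
        ring
    _ = 2 ^ s * C * Real.exp (-(r * a ^ (1 / s))) := by
        congr 2
        rw [hy, hq, one_div]
        field_simp

lemma exists_one_add_pow_le_exp (hs : 0 < s) (hr : 0 < r) (n : ℕ) :
    ∃ C : ℝ, 0 < C ∧ ∀ a : ℝ, 0 ≤ a → (1 + a) ^ n ≤ C * Real.exp (r * a ^ (1 / s)) := by
  set h : ℝ := (s / r) ^ s with hh
  have h0 : 0 < h := by positivity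
  have hrate : s * (1 / h) ^ (1 / s) = r := by
    rw [one_div, one_div, hh, ← Real.inv_rpow (by positivity),
      Real.rpow_rpow_inv (by positivity) hs.ne']
    field_simp
  refine ⟨2 ^ (n - 1) * (1 + h ^ n * (n ! : ℝ) ^ s), by positivity, fun a ha => ?_⟩
  have hpow := pow_le_factorial_rpow_mul_exp hs h0 ha n
  rw [hrate] at hpow
  calc (1 + a) ^ n ≤ 2 ^ (n - 1) * (1 ^ n + a ^ n) := add_pow_le zero_le_one ha n
    _ ≤ 2 ^ (n - 1) * (Real.exp (r * a ^ (1 / s)) +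
          h ^ n * (n ! : ℝ) ^ s * Real.exp (r * a ^ (1 / s))) := by
        gcongr
        rw [one_pow]
        exact Real.one_le_exp (by positivity)
    _ = _ := by ring

end StretchedExponentials

lemma factorial_rpow_mul_factorial_rpow_le {s : ℝ} (hs : 0 ≤ s) {i n : ℕ} (hin : i ≤ n) :
    (i ! : ℝ) ^ s * ((n - i)! : ℝ) ^ s ≤ (n ! : ℝ) ^ s := by
  rw [← Real.mul_rpow (by positivity) (by positivity)]
  gcongr
  exact_mod_cast Nat.le_of_dvd (Nat.factorial_pos n)
    (Nat.factorial_mul_factorial_dvd_factorial hin)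

/-! ### Functions with Gevrey bounds -/

section Leibniz

variable {E A : Type*} [NormedAddCommGroup E] [NormedSpace ℝ E]

lemma weighted_gevrey_mul_le [NormedRing A] [NormedAlgebra ℝ A] {s h M N p : ℝ} {f g : E → A}
    (hs : 0 ≤ s) (hh : 0 ≤ h) (hf : ContDiff ℝ ∞ f) (hg : ContDiff ℝ ∞ g) (hp : 0 ≤ p) (x : E)
    (hM : ∀ n : ℕ, ‖iteratedFDeriv ℝ n f x‖ ≤ M * (h ^ n * (n ! : ℝ) ^ s))
    (hN : ∀ n : ℕ, p * ‖iteratedFDeriv ℝ n g x‖ ≤ N * (h ^ n * (n ! : ℝ) ^ s)) (n : ℕ) :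
    p * ‖iteratedFDeriv ℝ n (fun y => f y * g y) x‖ ≤
      M * N * ((2 * h) ^ n * (n ! : ℝ) ^ s) := by
  have hM0 : 0 ≤ M := by simpa using (norm_nonneg _).trans (hM 0)
  have hN0 : 0 ≤ N := by simpa using (mul_nonneg hp (norm_nonneg _)).trans (hN 0)
  have hterm : ∀ i ∈ Finset.range (n + 1),
      p * ((n.choose i : ℝ) * ‖iteratedFDeriv ℝ i f x‖ * ‖iteratedFDeriv ℝ (n - i) g x‖) ≤
        (n.choose i : ℝ) * (M * N * (h ^ n * (n ! : ℝ) ^ s)) := by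
    intro i hi
    have hin : i ≤ n := Nat.lt_succ_iff.mp (Finset.mem_range.mp hi)
    calc p * ((n.choose i : ℝ) * ‖iteratedFDeriv ℝ i f x‖ * ‖iteratedFDeriv ℝ (n - i) g x‖)
        = n.choose i * (‖iteratedFDeriv ℝ i f x‖ * (p * ‖iteratedFDeriv ℝ (n - i) g x‖)) := by ring
      _ ≤ n.choose i * ((M * (h ^ i * (i ! : ℝ) ^ s)) *
            (N * (h ^ (n - i) * ((n - i)! : ℝ) ^ s))) := by
          gcongr ?_ * (?_ * ?_)
          exacts [hM i, hN (n - i)]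
      _ = n.choose i * (M * N * (h ^ n * ((i ! : ℝ) ^ s * ((n - i)! : ℝ) ^ s))) := by
          rw [← pow_mul_pow_sub h hin]; ring
      _ ≤ _ := by gcongr; exact factorial_rpow_mul_factorial_rpow_le hs hin
  calc p * ‖iteratedFDeriv ℝ n (fun y => f y * g y) x‖
      ≤ p * ∑ i ∈ Finset.range (n + 1), (n.choose i : ℝ) * ‖iteratedFDeriv ℝ i f x‖ *
        ‖iteratedFDeriv ℝ (n - i) g x‖ := by
        gcongr
        exact norm_iteratedFDeriv_mul_le hf hg x (mod_cast le_top)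
    _ ≤ ∑ i ∈ Finset.range (n + 1), (n.choose i : ℝ) * (M * N * (h ^ n * (n ! : ℝ) ^ s)) := by
        rw [Finset.mul_sum]; exact Finset.sum_le_sum hterm
    _ = M * N * ((2 * h) ^ n * (n ! : ℝ) ^ s) := by
        rw [← Finset.sum_mul, ← Nat.cast_sum, Nat.sum_range_choose, mul_pow]; push_cast; ring

lemma gevrey_mul_le [NormedRing A] [NormedAlgebra ℝ A] {s h M N : ℝ} {f g : E → A}
    (hs : 0 ≤ s) (hh : 0 ≤ h) (hf : ContDiff ℝ ∞ f) (hg : ContDiff ℝ ∞ g) (x : E)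
    (hM : ∀ n : ℕ, ‖iteratedFDeriv ℝ n f x‖ ≤ M * (h ^ n * (n ! : ℝ) ^ s))
    (hN : ∀ n : ℕ, ‖iteratedFDeriv ℝ n g x‖ ≤ N * (h ^ n * (n ! : ℝ) ^ s)) (n : ℕ) :
    ‖iteratedFDeriv ℝ n (fun y => f y * g y) x‖ ≤ M * N * ((2 * h) ^ n * (n ! : ℝ) ^ s) := by
  simpa only [one_mul] using
    weighted_gevrey_mul_le hs hh hf hg zero_le_one x hM (by simpa only [one_mul] using hN) n

lemma norm_mul_norm_iteratedFDeriv_inv_le [NormedField A] [NormedAlgebra ℝ A] {f : E → A}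
    (hf : ContDiff ℝ ∞ f) (hf0 : ∀ y, f y ≠ 0) {n : ℕ} (hn : n ≠ 0) (x : E) :
    ‖f x‖ * ‖iteratedFDeriv ℝ n (fun y => (f y)⁻¹) x‖ ≤
      ∑ k ∈ Finset.range n, (n.choose (k + 1) : ℝ) * ‖iteratedFDeriv ℝ (k + 1) f x‖ *
        ‖iteratedFDeriv ℝ (n - (k + 1)) (fun y => (f y)⁻¹) x‖ := by
  set g : E → A := fun y => (f y)⁻¹ with hg_def
  have hg : ContDiff ℝ ∞ g := hf.inv hf0
  have hn_le : (n : ℕ∞ω) ≤ ∞ := mod_cast le_top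
  -- `(f - f x) / f = 1 - f x • (1 / f)`, and the left factor vanishes at `x`.
  have hproduct : iteratedFDeriv ℝ n (fun y => (f y - f x) * g y) x =
      -(f x • iteratedFDeriv ℝ n g x) := by
    have heq : (fun y => (f y - f x) * g y) = (fun _ => (1 : A)) - f x • g := by
      funext y
      simp only [Pi.sub_apply, Pi.smul_apply, smul_eq_mul, hg_def, sub_mul,
        mul_inv_cancel₀ (hf0 y)]
    have hsmul : ContDiff ℝ n (f x • g) := (contDiff_const.smul hg).of_le hn_le
    rw [heq, iteratedFDeriv_sub_apply contDiff_const.contDiffAt hsmul.contDiffAt,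
      iteratedFDeriv_const_smul_apply (hg.of_le hn_le).contDiffAt,
      iteratedFDeriv_const_of_ne hn, Pi.zero_apply, zero_sub]
  have hshift : ∀ k : ℕ, iteratedFDeriv ℝ (k + 1) (fun y => f y - f x) x =
      iteratedFDeriv ℝ (k + 1) f x := fun k => by
    rw [fun_iteratedFDeriv_sub_apply (hf.of_le (mod_cast le_top)).contDiffAt
      contDiff_const.contDiffAt, iteratedFDeriv_const_of_ne k.succ_ne_zero, Pi.zero_apply, sub_zero]
  have hleibniz := norm_iteratedFDeriv_mul_le (hf.sub contDiff_const) hg x (n := n) hn_le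
    (f := fun y => f y - f x)
  rw [hproduct, norm_neg, norm_smul, Finset.sum_range_succ'] at hleibniz
  simpa only [hshift, Nat.choose_zero_right, norm_iteratedFDeriv_zero, sub_self, norm_zero,
    mul_zero, zero_mul, add_zero] using hleibniz

end Leibniz

section Combinatorics

lemma choose_mul_factorial_rpow {s : ℝ} {k n : ℕ} (hkn : k ≤ n) :
    (n.choose k : ℝ) * ((k ! : ℝ) ^ s * ((n - k)! : ℝ) ^ s) =
      (n.choose k : ℝ) ^ (1 - s) * (n ! : ℝ) ^ s := by
  have hpos : (0 : ℝ) < n.choose k := by exact_mod_cast Nat.choose_pos hkn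
  have hfact : (n ! : ℝ) = n.choose k * (k ! * (n - k)!) := by
    exact_mod_cast (by rw [← Nat.choose_mul_factorial_mul_factorial hkn, mul_assoc])
  rw [hfact, Real.mul_rpow hpos.le (by positivity), Real.mul_rpow (by positivity) (by positivity),
    Real.rpow_sub hpos, Real.rpow_one]
  field_simp

lemma le_choose {n k : ℕ} (hk : 0 < k) (hkn : k < n) : n ≤ n.choose k := by
  induction n generalizing k with
  | zero => omega
  | succ n ih =>
    obtain ⟨k, rfl⟩ := Nat.exists_eq_add_of_le' hk
    rw [Nat.choose_succ_succ]
    rcases Nat.lt_or_ge (k + 1) n with h | h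
    · have := ih k.succ_pos h
      have : 0 < n.choose k := Nat.choose_pos (by omega)
      omega
    · obtain rfl : n = k + 1 := by omega
      simp

lemma sum_half_pow_mul_choose_rpow_le {s : ℝ} (hs : 1 ≤ s) {n : ℕ} (hn : n ≠ 0) :
    ∑ k ∈ Finset.range n, (1 / 2 : ℝ) ^ (k + 1) * (n.choose (k + 1) : ℝ) ^ (1 - s) ≤
      (n : ℝ) ^ (1 - s) + (1 / 2) ^ n := by
  obtain ⟨m, rfl⟩ := Nat.exists_eq_succ_of_ne_zero hn
  have hgeom : ∑ k ∈ Finset.range m, (1 / 2 : ℝ) ^ (k + 1) ≤ 1 := by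
    simp_rw [pow_succ, ← Finset.sum_mul]
    linarith [sum_geometric_two_le m]
  have hterm : ∀ k ∈ Finset.range m,
      (1 / 2 : ℝ) ^ (k + 1) * ((m + 1).choose (k + 1) : ℝ) ^ (1 - s) ≤
        (1 / 2 : ℝ) ^ (k + 1) * ((m + 1 : ℕ) : ℝ) ^ (1 - s) := by
    intro k hk
    have hle : m + 1 ≤ (m + 1).choose (k + 1) :=
      le_choose k.succ_pos (Nat.succ_lt_succ (Finset.mem_range.mp hk))
    gcongr ?_ * ?_
    exact Real.rpow_le_rpow_of_nonpos (by positivity) (mod_cast hle) (by linarith)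
  rw [Finset.sum_range_succ, Nat.choose_self, Nat.cast_one, Real.one_rpow, mul_one]
  gcongr
  refine (Finset.sum_le_sum hterm).trans ?_
  rw [← Finset.sum_mul]
  exact mul_le_of_le_one_left (by positivity) hgeom

lemma exists_forall_le_of_recursive_bound {ι : Type*} {a : ι → ℕ → ℝ} {ε : ℕ → ℝ}
    (hε : Filter.Tendsto ε Filter.atTop (nhds 0)) (h0 : ∃ A, ∀ x, a x 0 ≤ A)
    (hrec : ∀ n A, n ≠ 0 → 0 ≤ A → (∀ x, ∀ m < n, a x m ≤ A) → ∀ x, a x n ≤ ε n * A) :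
    ∃ A, ∀ x n, a x n ≤ A := by
  have hinit : ∀ n, ∃ A, 0 ≤ A ∧ ∀ x, ∀ m < n, a x m ≤ A := by
    intro n
    induction n with
    | zero => exact ⟨0, le_rfl, fun _ m hm => absurd hm (Nat.not_lt_zero m)⟩
    | succ n ih =>
      obtain ⟨A, hA0, hA⟩ := ih
      obtain ⟨B, hB⟩ : ∃ B, ∀ x, a x n ≤ B := by
        rcases eq_or_ne n 0 with rfl | hn
        · exact h0
        · exact ⟨_, hrec n A hn hA0 hA⟩
      refine ⟨max A B, le_max_of_le_left hA0, fun x m hm => ?_⟩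
      rcases Nat.lt_succ_iff_lt_or_eq.mp hm with hmn | rfl
      · exact le_max_of_le_left (hA x m hmn)
      · exact le_max_of_le_right (hB x)
  obtain ⟨N, hN⟩ := Filter.eventually_atTop.mp (hε.eventually_le_const zero_lt_one)
  obtain ⟨A, hA0, hA⟩ := hinit (N + 1)
  refine ⟨A, fun x n => ?_⟩
  induction n using Nat.strong_induction_on generalizing x with
  | _ n ih =>
    rcases Nat.lt_or_ge n (N + 1) with hn | hn
    · exact hA x n hn
    · exact (hrec n A (by omega) hA0 (fun y m hm => ih m hm y) x).trans
        (mul_le_of_le_one_left hA0 (hN n (by omega)))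

end Combinatorics

/-- The algebra of smooth functions with global Gevrey bounds `|Dⁿ f| ≤ M hⁿ n!ˢ` for every `h > 0`,
without any decay at infinity: the multipliers of `GevreyC d s`. -/
def Gev (d : ℕ) (s : ℝ) : Submodule ℂ (Rd d → ℂ) where
  carrier := {f | ContDiff ℝ ∞ f ∧ ∀ h : ℝ, 0 < h → ∃ M : ℝ, GevreyNormLE s h M f}
  add_mem' := by
    rintro f g ⟨hf, hf'⟩ ⟨hg, hg'⟩
    refine ⟨hf.add hg, fun h hh => ?_⟩
    obtain ⟨M, hM⟩ := hf' h hh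
    obtain ⟨N, hN⟩ := hg' h hh
    exact ⟨M + N, hM.add hf hg hN⟩
  zero_mem' :=
    ⟨contDiff_const, fun h _ => ⟨0, fun n x => by simp [iteratedFDeriv_zero_fun']⟩⟩
  smul_mem' := by
    rintro c f ⟨hf, hf'⟩
    refine ⟨contDiff_const.smul hf, fun h hh => ?_⟩
    obtain ⟨M, hM⟩ := hf' h hh
    exact ⟨‖c‖ * M, hM.smul c hf⟩

section Gev

variable {d : ℕ} {s t : ℝ} {f g : Rd d → ℂ}

lemma GevreyC.mem_gev (ϕ : GevreyC d s) : ϕ.1 ∈ Gev d s := ⟨ϕ.2.1, ϕ.2.2.2⟩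

lemma Sig.mem_gev (ϕ : Sig d t s) : ϕ.1 ∈ Gev d s := by
  refine ⟨ϕ.2.1, fun h hh => ?_⟩
  obtain ⟨M, hM⟩ := ϕ.2.2 h hh
  exact ⟨M, fun n x => by simpa using hM 0 n x⟩

lemma mul_mem_gev (hs : 0 ≤ s) (hf : f ∈ Gev d s) (hg : g ∈ Gev d s) :
    (fun x => f x * g x) ∈ Gev d s := by
  refine ⟨hf.1.mul hg.1, fun h hh => ?_⟩
  obtain ⟨M, hM⟩ := hf.2 (h / 2) (by positivity)
  obtain ⟨N, hN⟩ := hg.2 (h / 2) (by positivity)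
  refine ⟨M * N, fun n x => ?_⟩
  simpa only [mul_div_cancel₀ h two_ne_zero] using
    gevrey_mul_le hs (by positivity) hf.1 hg.1 x (fun n => hM n x) (fun n => hN n x) n

lemma conj_mem_gev (hf : f ∈ Gev d s) : (fun x => conj (f x)) ∈ Gev d s := by
  refine ⟨contDiff_conj hf.1, fun h hh => ?_⟩
  obtain ⟨M, hM⟩ := hf.2 h hh
  exact ⟨M, fun n x => by rw [norm_iteratedFDeriv_conj]; exact hM n x⟩

lemma char_mem_gev (hs : 0 < s) (ξ : Rd d) : char ξ ∈ Gev d s := by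
  refine ⟨contDiff_char ξ, fun h hh => ?_⟩
  obtain ⟨C, -, hC⟩ := exists_pow_le (norm_nonneg ξ) hh hs
  exact ⟨C, fun n x => (norm_iteratedFDeriv_char_le ξ x n).trans (hC n)⟩

lemma const_mem_gev (c : ℂ) : (fun _ => c) ∈ Gev d s := by
  refine ⟨contDiff_const, fun h hh => ⟨‖c‖, fun n x => ?_⟩⟩
  rcases eq_or_ne n 0 with rfl | hn
  · simp
  · rw [iteratedFDeriv_const_of_ne hn, Pi.zero_apply, norm_zero]
    positivity

lemma mul_mem_gevreyC (hs : 0 ≤ s) (hf : f ∈ Gev d s) (ϕ : GevreyC d s) :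
    (fun x => f x * ϕ.1 x) ∈ GevreyC d s :=
  ⟨hf.1.mul ϕ.2.1, ϕ.2.2.1.mul_left, (mul_mem_gev hs hf (GevreyC.mem_gev ϕ)).2⟩

lemma norm_iteratedFDeriv_inv_le (hs : 1 ≤ s) {h c M A : ℝ} (hh : 0 < h) (hc : 0 < c)
    (hf : ContDiff ℝ ∞ f) (hcf : ∀ x, c ≤ ‖f x‖) (hM : GevreyNormLE s h M f) {n : ℕ} (hn : n ≠ 0)
    (x : Rd d) (hA : ∀ m < n, ‖iteratedFDeriv ℝ m (fun y => (f y)⁻¹) x‖ ≤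
      A * ((2 * h) ^ m * (m ! : ℝ) ^ s)) :
    ‖iteratedFDeriv ℝ n (fun y => (f y)⁻¹) x‖ ≤
      c⁻¹ * M * ((n : ℝ) ^ (1 - s) + (1 / 2) ^ n) * A * ((2 * h) ^ n * (n ! : ℝ) ^ s) := by
  have hM0 := hM.nonneg
  have hA0 : 0 ≤ A := by simpa using (norm_nonneg _).trans (hA 0 (Nat.pos_of_ne_zero hn))
  set G : Rd d → ℂ := fun y => (f y)⁻¹
  set W : ℝ := A * ((2 * h) ^ n * (n ! : ℝ) ^ s) with hW
  have hterm : ∀ k ∈ Finset.range n, (n.choose (k + 1) : ℝ) * ‖iteratedFDeriv ℝ (k + 1) f x‖ *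
      ‖iteratedFDeriv ℝ (n - (k + 1)) G x‖ ≤
        M * W * ((1 / 2) ^ (k + 1) * (n.choose (k + 1) : ℝ) ^ (1 - s)) := by
    intro k hk
    have hkn : k + 1 ≤ n := Finset.mem_range.mp hk
    have hhalf : h ^ (k + 1) = (1 / 2) ^ (k + 1) * (2 * h) ^ (k + 1) := by
      rw [← mul_pow]; congr 1; ring
    calc (n.choose (k + 1) : ℝ) * ‖iteratedFDeriv ℝ (k + 1) f x‖ *
          ‖iteratedFDeriv ℝ (n - (k + 1)) G x‖
        ≤ n.choose (k + 1) * (M * (h ^ (k + 1) * ((k + 1)! : ℝ) ^ s)) *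
          (A * ((2 * h) ^ (n - (k + 1)) * ((n - (k + 1))! : ℝ) ^ s)) := by
          gcongr ?_ * ?_ * ?_
          exacts [hM (k + 1) x, hA (n - (k + 1)) (by omega)]
      _ = M * A * h ^ (k + 1) * (2 * h) ^ (n - (k + 1)) * (n.choose (k + 1) *
          (((k + 1)! : ℝ) ^ s * ((n - (k + 1))! : ℝ) ^ s)) := by ring
      _ = _ := by
          rw [choose_mul_factorial_rpow hkn, hhalf, hW, ← pow_mul_pow_sub (2 * h) hkn]
          ring
  have hne : ∀ y, f y ≠ 0 := fun y => norm_pos_iff.mp (hc.trans_le (hcf y))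
  have hrec : c * ‖iteratedFDeriv ℝ n G x‖ ≤ M * W * ((n : ℝ) ^ (1 - s) + (1 / 2) ^ n) :=
    calc c * ‖iteratedFDeriv ℝ n G x‖ ≤ ‖f x‖ * ‖iteratedFDeriv ℝ n G x‖ := by
          gcongr; exact hcf x
      _ ≤ ∑ k ∈ Finset.range n, M * W * ((1 / 2) ^ (k + 1) * (n.choose (k + 1) : ℝ) ^ (1 - s)) :=
          (norm_mul_norm_iteratedFDeriv_inv_le hf hne hn x).trans (Finset.sum_le_sum hterm)
      _ ≤ _ := by
          rw [← Finset.mul_sum]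
          gcongr
          exact sum_half_pow_mul_choose_rpow_le hs hn
  calc ‖iteratedFDeriv ℝ n G x‖ ≤ c⁻¹ * (M * W * ((n : ℝ) ^ (1 - s) + (1 / 2) ^ n)) := by
        rwa [← div_eq_inv_mul, le_div_iff₀' hc]
    _ = _ := by ring

lemma inv_mem_gev (hs : 1 < s) {c : ℝ} (hc : 0 < c) (hf : f ∈ Gev d s) (hcf : ∀ x, c ≤ ‖f x‖) :
    (fun x => (f x)⁻¹) ∈ Gev d s := by
  refine ⟨hf.1.inv fun y => norm_pos_iff.mp (hc.trans_le (hcf y)), fun H hH => ?_⟩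
  obtain ⟨M, hM⟩ := hf.2 (H / 2) (by positivity)
  have hpos : ∀ n : ℕ, 0 < H ^ n * (n ! : ℝ) ^ s := fun n => by positivity
  have hε : Filter.Tendsto (fun n : ℕ => c⁻¹ * M * ((n : ℝ) ^ (1 - s) + (1 / 2) ^ n))
      Filter.atTop (nhds 0) := by
    have hrpow : Filter.Tendsto (fun n : ℕ => (n : ℝ) ^ (1 - s)) Filter.atTop (nhds 0) := by
      simpa only [Function.comp_def, neg_sub] using
        (tendsto_rpow_neg_atTop (sub_pos.mpr hs)).comp (tendsto_natCast_atTop_atTop (R := ℝ))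
    have hgeom : Filter.Tendsto (fun n : ℕ => (1 / 2 : ℝ) ^ n) Filter.atTop (nhds 0) :=
      tendsto_pow_atTop_nhds_zero_of_lt_one (by norm_num) (by norm_num)
    simpa only [add_zero, mul_zero] using (hrpow.add hgeom).const_mul (c⁻¹ * M)
  obtain ⟨A, hA⟩ := exists_forall_le_of_recursive_bound
    (a := fun x n => ‖iteratedFDeriv ℝ n (fun y => (f y)⁻¹) x‖ / (H ^ n * (n ! : ℝ) ^ s)) hε
    ⟨c⁻¹, fun x => by simpa using inv_anti₀ hc (hcf x)⟩ fun n A hn _ hlt x => by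
      have hbound := norm_iteratedFDeriv_inv_le hs.le (by positivity) hc hf.1 hcf hM hn x (A := A)
      rw [mul_div_cancel₀ H two_ne_zero] at hbound
      rw [div_le_iff₀ (hpos n)]
      exact hbound fun m hm => (div_le_iff₀ (hpos m)).mp (hlt x m hm)
  exact ⟨A, fun n x => (div_le_iff₀ (hpos n)).mp (hA x n)⟩

end Gev

/-! ### Gevrey cutoff functions -/

section Glue

variable {a : ℕ}

/-- The function `z ↦ exp (-1 / zᵃ)`, whose restriction to `z > 0`, extended by zero, is Gevrey of
order `1 + 1 / a`. -/
def expNegInvPow (a : ℕ) (z : ℂ) : ℂ := Complex.exp (-(z ^ a)⁻¹)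

lemma analyticAt_expNegInvPow {z : ℂ} (hz : z ≠ 0) : AnalyticAt ℂ (expNegInvPow a) z :=
  ((analyticAt_id.pow a).inv (pow_ne_zero a hz)).neg.cexp

lemma exists_norm_expNegInvPow_le_on_sphere (a : ℕ) :
    ∃ ε : ℝ, 0 < ε ∧ ε < 1 ∧ ∀ x : ℝ, 0 < x → ∀ z ∈ Metric.sphere (x : ℂ) (ε * x),
      ‖expNegInvPow a z‖ ≤ Real.exp (-((x ^ a)⁻¹ / 2)) := by
  have hcont : ContinuousAt (fun w : ℂ => (((1 + w) ^ a)⁻¹).re) 0 :=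
    Complex.continuous_re.continuousAt.comp (ContinuousAt.inv₀ (by fun_prop) (by simp))
  have hnear : ∀ᶠ w : ℂ in nhds 0, 1 / 2 < (((1 + w) ^ a)⁻¹).re :=
    hcont.eventually (lt_mem_nhds (by norm_num))
  obtain ⟨δ, hδ, hball⟩ := Metric.eventually_nhds_iff.mp hnear
  have hεδ : min (δ / 2) (1 / 2) < δ := (min_le_left _ _).trans_lt (half_lt_self hδ)
  refine ⟨min (δ / 2) (1 / 2), by positivity, (min_le_right _ _).trans_lt (by norm_num),
    fun x hx z hz => ?_⟩
  set w : ℂ := (z - x) / x with hw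
  have hxC : (x : ℂ) ≠ 0 := Complex.ofReal_ne_zero.mpr hx.ne'
  have hzw : (z ^ a)⁻¹ = ((x ^ a)⁻¹ : ℝ) * ((1 + w) ^ a)⁻¹ := by
    have : z = x * (1 + w) := by rw [hw]; field_simp; ring
    rw [this, mul_pow, mul_inv, Complex.ofReal_inv, Complex.ofReal_pow]
  have hw_norm : ‖w‖ < δ := by
    rwa [hw, norm_div, mem_sphere_iff_norm.mp hz, Complex.norm_real, Real.norm_of_nonneg hx.le,
      mul_div_cancel_right₀ _ hx.ne']
  have hre := hball (y := w) (by rwa [dist_zero_right])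
  rw [expNegInvPow, Complex.norm_exp, hzw, Complex.neg_re, Complex.re_ofReal_mul,
    div_eq_mul_one_div]
  gcongr

lemma exists_norm_iteratedDeriv_expNegInvPow_le (a : ℕ) :
    ∃ K : ℝ, 0 < K ∧ ∀ (n : ℕ) (x : ℝ), 0 < x →
      ‖iteratedDeriv n (expNegInvPow a) x‖ ≤
        n ! * (K / x) ^ n * Real.exp (-((x ^ a)⁻¹ / 2)) := by
  obtain ⟨ε, hε0, hε1, hbound⟩ := exists_norm_expNegInvPow_le_on_sphere a
  refine ⟨1 / ε, by positivity, fun n x hx => ?_⟩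
  have hR : 0 < ε * x := by positivity
  have hne : ∀ z ∈ Metric.closedBall (x : ℂ) (ε * x), z ≠ 0 := by
    rintro z hz rfl
    rw [mem_closedBall_iff_norm, zero_sub, norm_neg, Complex.norm_real,
      Real.norm_of_nonneg hx.le] at hz
    nlinarith
  have hdiff : DiffContOnCl ℂ (expNegInvPow a) (Metric.ball (x : ℂ) (ε * x)) := by
    refine DifferentiableOn.diffContOnCl fun z hz => ?_
    rw [closure_ball _ hR.ne'] at hz
    exact (analyticAt_expNegInvPow (hne z hz)).differentiableAt.differentiableWithinAt
  refine (Complex.norm_iteratedDeriv_le_of_forall_mem_sphere_norm_le n hR hdiff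
    (hbound x hx)).trans_eq ?_
  rw [div_div, one_div, inv_pow]
  ring

lemma inv_pow_mul_exp_le (ha : 0 < a) (n : ℕ) {x : ℝ} (hx : 0 < x) :
    (1 / x) ^ n * Real.exp (-((x ^ a)⁻¹ / 2)) ≤ 2 ^ n * (n ! : ℝ) ^ (1 / (a : ℝ)) := by
  set y : ℝ := (x ^ a)⁻¹ with hy
  have hy0 : 0 < y := by positivity
  have hpow : ((1 / x) ^ n * Real.exp (-(y / 2))) ^ a ≤ 2 ^ n * n ! :=
    calc ((1 / x) ^ n * Real.exp (-(y / 2))) ^ a = y ^ n * Real.exp (-(y / 2)) ^ a := by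
          rw [mul_pow, hy, ← pow_mul, mul_comm n, pow_mul, one_div, inv_pow]
      _ ≤ y ^ n * Real.exp (-(y / 2)) := by
          gcongr
          exact pow_le_of_le_one (Real.exp_pos _).le
            (Real.exp_le_one_iff.mpr (by linarith)) ha.ne'
      _ = 2 ^ n * (y / 2) ^ n * Real.exp (-(y / 2)) := by
          rw [← mul_pow, mul_div_cancel₀ y two_ne_zero]
      _ ≤ 2 ^ n * (n ! * Real.exp (y / 2)) * Real.exp (-(y / 2)) := by
          gcongr
          exact (div_le_iff₀' (by positivity)).mp
            (Real.pow_div_factorial_le_exp (y / 2) (by positivity) n)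
      _ = 2 ^ n * n ! := by
          rw [mul_assoc, mul_assoc, ← Real.exp_add, add_neg_cancel, Real.exp_zero, mul_one]
  have hroot := Real.rpow_le_rpow (by positivity) hpow (inv_nonneg.mpr (Nat.cast_nonneg a))
  rw [Real.pow_rpow_inv_natCast (by positivity) ha.ne', Real.mul_rpow (by positivity)
    (by positivity)] at hroot
  rw [one_div (a : ℝ)]
  refine hroot.trans ?_
  gcongr
  exact Real.rpow_le_self_of_one_le (one_le_pow₀ one_le_two)
    (inv_le_one_of_one_le₀ (mod_cast ha))

/-- The `n`-th derivative of `exp (-1 / xᵃ)` on `x > 0`, extended by zero to `x ≤ 0`. -/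
def glueDeriv (a n : ℕ) (x : ℝ) : ℂ := if 0 < x then iteratedDeriv n (expNegInvPow a) x else 0

lemma glueDeriv_of_pos {n : ℕ} {x : ℝ} (hx : 0 < x) :
    glueDeriv a n x = iteratedDeriv n (expNegInvPow a) x :=
  if_pos hx

lemma glueDeriv_of_nonpos {n : ℕ} {x : ℝ} (hx : x ≤ 0) : glueDeriv a n x = 0 :=
  if_neg hx.not_gt

lemma exists_norm_glueDeriv_le_sq (ha : 0 < a) (n : ℕ) :
    ∃ C : ℝ, ∀ y, ‖glueDeriv a n y‖ ≤ C * ‖y ^ 2‖ := by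
  obtain ⟨K, hK, hbound⟩ := exists_norm_iteratedDeriv_expNegInvPow_le a
  refine ⟨n ! * K ^ n * (2 ^ (n + 2) * ((n + 2)! : ℝ) ^ (1 / (a : ℝ))), fun y => ?_⟩
  rcases le_or_gt y 0 with hy | hy
  · rw [glueDeriv_of_nonpos hy, norm_zero]
    positivity
  · rw [glueDeriv_of_pos hy, Real.norm_of_nonneg (by positivity)]
    calc ‖iteratedDeriv n (expNegInvPow a) y‖
        ≤ n ! * (K / y) ^ n * Real.exp (-((y ^ a)⁻¹ / 2)) := hbound n y hy
      _ = n ! * K ^ n * ((1 / y) ^ (n + 2) * Real.exp (-((y ^ a)⁻¹ / 2))) * y ^ 2 := by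
          rw [div_pow, one_div, inv_pow, pow_add]
          field_simp
      _ ≤ _ := by gcongr ?_ * ?_ * y ^ 2; exact inv_pow_mul_exp_le ha (n + 2) hy

lemma hasDerivAt_glueDeriv (ha : 0 < a) (n : ℕ) (x : ℝ) :
    HasDerivAt (glueDeriv a n) (glueDeriv a (n + 1) x) x := by
  rcases lt_trichotomy x 0 with hx | rfl | hx
  · rw [glueDeriv_of_nonpos hx.le]
    refine (hasDerivAt_const x (0 : ℂ)).congr_of_eventuallyEq ?_
    filter_upwards [gt_mem_nhds hx] with y hy
    exact glueDeriv_of_nonpos hy.le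
  · obtain ⟨C, hC⟩ := exists_norm_glueDeriv_le_sq ha n
    rw [hasDerivAt_iff_isLittleO, glueDeriv_of_nonpos le_rfl, glueDeriv_of_nonpos le_rfl]
    simp only [sub_zero, smul_zero]
    exact (Asymptotics.IsBigO.of_bound C (Filter.Eventually.of_forall hC)).trans_isLittleO
      (Asymptotics.isLittleO_pow_id one_lt_two)
  · have hderiv : HasDerivAt (iteratedDeriv n (expNegInvPow a))
        (iteratedDeriv (n + 1) (expNegInvPow a) x) (x : ℂ) := by
      rw [iteratedDeriv_succ, hasDerivAt_deriv_iff, iteratedDeriv_eq_iterate]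
      exact ((analyticAt_expNegInvPow
        (Complex.ofReal_ne_zero.mpr hx.ne')).iterated_deriv n).differentiableAt
    rw [glueDeriv_of_pos hx]
    refine hderiv.comp_ofReal.congr_of_eventuallyEq ?_
    filter_upwards [lt_mem_nhds hx] with y hy
    exact glueDeriv_of_pos hy

lemma iteratedDeriv_glueDeriv (ha : 0 < a) (n : ℕ) :
    iteratedDeriv n (glueDeriv a 0) = glueDeriv a n := by
  induction n with
  | zero => exact iteratedDeriv_zero
  | succ n ih => rw [iteratedDeriv_succ, ih, funext fun x => (hasDerivAt_glueDeriv ha n x).deriv]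

lemma contDiff_glueDeriv (ha : 0 < a) : ContDiff ℝ ∞ (glueDeriv a 0) := by
  refine contDiff_of_differentiable_iteratedDeriv fun m _ => ?_
  rw [iteratedDeriv_glueDeriv ha]
  exact fun x => (hasDerivAt_glueDeriv ha m x).differentiableAt

lemma exists_norm_iteratedDeriv_glueDeriv_le {s h : ℝ} (ha : 0 < a) (has : 1 + 1 / (a : ℝ) < s)
    (hh : 0 < h) : ∃ M : ℝ, ∀ (n : ℕ) (x : ℝ),
      ‖iteratedDeriv n (glueDeriv a 0) x‖ ≤ M * (h ^ n * (n ! : ℝ) ^ s) := by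
  obtain ⟨K, hK, hbound⟩ := exists_norm_iteratedDeriv_expNegInvPow_le a
  obtain ⟨M, hM0, hM⟩ := exists_pow_le (a := 2 * K) (t := s - (1 + 1 / (a : ℝ))) (by positivity) hh
    (by linarith)
  refine ⟨M, fun n x => ?_⟩
  rw [iteratedDeriv_glueDeriv ha]
  rcases le_or_gt x 0 with hx | hx
  · rw [glueDeriv_of_nonpos hx, norm_zero]
    positivity
  · have hn : (0 : ℝ) < n ! := by positivity
    rw [glueDeriv_of_pos hx]
    calc ‖iteratedDeriv n (expNegInvPow a) x‖
        ≤ n ! * (K / x) ^ n * Real.exp (-((x ^ a)⁻¹ / 2)) := hbound n x hx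
      _ = n ! * K ^ n * ((1 / x) ^ n * Real.exp (-((x ^ a)⁻¹ / 2))) := by
        rw [div_pow, div_pow]; ring
      _ ≤ n ! * K ^ n * (2 ^ n * (n ! : ℝ) ^ (1 / (a : ℝ))) := by
        gcongr ?_ * ?_; exact inv_pow_mul_exp_le ha n hx
      _ = (2 * K) ^ n * (n ! : ℝ) ^ (1 + 1 / (a : ℝ)) := by
        rw [Real.rpow_add hn, Real.rpow_one, mul_pow]; ring
      _ ≤ M * (h ^ n * (n ! : ℝ) ^ (s - (1 + 1 / (a : ℝ)))) * (n ! : ℝ) ^ (1 + 1 / (a : ℝ)) := by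
        gcongr; exact hM n
      _ = M * (h ^ n * (n ! : ℝ) ^ s) := by
        rw [mul_assoc, mul_assoc, ← Real.rpow_add hn, sub_add_cancel]

lemma glueDeriv_zero_re (a : ℕ) (x : ℝ) :
    (glueDeriv a 0 x).re = if 0 < x then Real.exp (-(x ^ a)⁻¹) else 0 := by
  have hre : Complex.exp (-((x : ℂ) ^ a)⁻¹) = (Real.exp (-(x ^ a)⁻¹) : ℝ) := by push_cast; rfl
  unfold glueDeriv
  split_ifs
  · rw [iteratedDeriv_zero, expNegInvPow, hre, Complex.ofReal_re]
  · rfl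

lemma exp_neg_le_norm_glueDeriv_add {x y : ℝ} (hxy : x + y = 1) :
    Real.exp (-2 ^ a) ≤ ‖glueDeriv a 0 x + glueDeriv a 0 y‖ := by
  have hnonneg : ∀ z : ℝ, 0 ≤ (glueDeriv a 0 z).re := fun z => by
    rw [glueDeriv_zero_re]
    split_ifs <;> positivity
  have hhalf : ∀ z : ℝ, 1 / 2 ≤ z → Real.exp (-2 ^ a) ≤ (glueDeriv a 0 z).re := fun z hz => by
    have hz0 : 0 < z := by linarith
    rw [glueDeriv_zero_re, if_pos hz0, ← inv_pow]
    gcongr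
    rw [inv_le_comm₀ hz0 two_pos, ← one_div]
    exact hz
  refine le_trans ?_ (Complex.re_le_norm _)
  rw [Complex.add_re]
  rcases le_total x y with h | h
  · linarith [hhalf y (by linarith), hnonneg x]
  · linarith [hhalf x (by linarith), hnonneg y]

end Glue

lemma norm_iteratedFDeriv_comp_clm_le {E F G : Type*} [NormedAddCommGroup E] [NormedSpace ℝ E]
    [NormedAddCommGroup F] [NormedSpace ℝ F] [NormedAddCommGroup G] [NormedSpace ℝ G] {f : F → G}
    (hf : ContDiff ℝ ∞ f) {l : E →L[ℝ] F} (hl : ‖l‖ ≤ 1) (n : ℕ) (x : E) :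
    ‖iteratedFDeriv ℝ n (f ∘ l) x‖ ≤ ‖iteratedFDeriv ℝ n f (l x)‖ := by
  rw [l.iteratedFDeriv_comp_right hf x (i := n) (mod_cast le_top)]
  exact (ContinuousMultilinearMap.norm_compContinuousLinearMap_le _ _).trans
    (mul_le_of_le_one_right (norm_nonneg _)
      (Finset.prod_le_one (fun _ _ => norm_nonneg _) fun _ _ => hl))

section Cutoff

variable {d : ℕ} {s : ℝ}

lemma glueDeriv_comp_mem_gev {a : ℕ} (ha : 0 < a) (has : 1 + 1 / (a : ℝ) < s)
    {l : Rd d →L[ℝ] ℝ} (hl : ‖l‖ ≤ 1) (b : ℝ) : (fun x => glueDeriv a 0 (b + l x)) ∈ Gev d s := by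
  have hshift : ContDiff ℝ ∞ (fun y => glueDeriv a 0 (b + y)) :=
    (contDiff_glueDeriv ha).comp (contDiff_const.add contDiff_id)
  refine ⟨hshift.comp l.contDiff, fun h hh => ?_⟩
  obtain ⟨M, hM⟩ := exists_norm_iteratedDeriv_glueDeriv_le ha has hh
  refine ⟨M, fun n x => (norm_iteratedFDeriv_comp_clm_le hshift hl n x).trans ?_⟩
  rw [iteratedFDeriv_comp_add_left, norm_iteratedFDeriv_eq_norm_iteratedDeriv]
  exact hM n _

lemma exists_step_mem_gev (hs : 1 < s) {l : Rd d →L[ℝ] ℝ} (hl : ‖l‖ ≤ 1) :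
    ∃ f ∈ Gev d s, (∀ x, l x ≤ 1 → f x = 1) ∧ ∀ x, 2 ≤ l x → f x = 0 := by
  obtain ⟨a, ha⟩ := exists_nat_gt (1 / (s - 1))
  have hs1 : 0 < s - 1 := sub_pos.mpr hs
  have haR : (0 : ℝ) < a := (one_div_pos.mpr hs1).trans ha
  have has : 1 + 1 / (a : ℝ) < s := by linarith [(one_div_lt haR hs1).mpr ha]
  have ha0 : 0 < a := by exact_mod_cast haR
  set f : Rd d → ℂ := fun x => glueDeriv a 0 (2 + (-l) x)
  set g : Rd d → ℂ := fun x => glueDeriv a 0 (-1 + l x)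
  have hf : f ∈ Gev d s := glueDeriv_comp_mem_gev ha0 has (by rwa [norm_neg]) 2
  have hg : g ∈ Gev d s := glueDeriv_comp_mem_gev ha0 has hl (-1)
  have hlow : ∀ x, Real.exp (-2 ^ a) ≤ ‖(f + g) x‖ := fun x =>
    exp_neg_le_norm_glueDeriv_add (by rw [neg_apply]; ring)
  refine ⟨fun x => f x * ((f + g) x)⁻¹, mul_mem_gev (zero_le_one.trans hs.le) hf
    (inv_mem_gev hs (Real.exp_pos _) ((Gev d s).add_mem hf hg) hlow), fun x hx => ?_,
    fun x hx => ?_⟩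
  · have hgx : g x = 0 := glueDeriv_of_nonpos (by linarith)
    have hfgx : (f + g) x = f x := by rw [Pi.add_apply, hgx, add_zero]
    beta_reduce
    rw [hfgx, mul_inv_cancel₀]
    exact norm_pos_iff.mp ((Real.exp_pos _).trans_le (hfgx ▸ hlow x))
  · have hfx : f x = 0 := glueDeriv_of_nonpos (by rw [neg_apply]; linarith)
    beta_reduce
    rw [hfx, zero_mul]

lemma prod_mem_gev (hs : 0 ≤ s) {ι : Type*} (S : Finset ι) {f : ι → Rd d → ℂ}
    (hf : ∀ i, f i ∈ Gev d s) : ∏ i ∈ S, f i ∈ Gev d s :=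
  Finset.prod_induction f (· ∈ Gev d s) (fun _ _ => mul_mem_gev hs) (const_mem_gev 1)
    fun i _ => hf i

lemma exists_eq_one_on_unit_ball (d : ℕ) (hs : 1 < s) :
    ∃ χ : GevreyC d s, ∀ x : Rd d, ‖x‖ ≤ 1 → χ.1 x = 1 := by
  have hs0 : 0 ≤ s := zero_le_one.trans hs.le
  have hproj : ∀ i : Fin d, ‖(EuclideanSpace.proj i : Rd d →L[ℝ] ℝ)‖ ≤ 1 := fun i =>
    ContinuousLinearMap.opNorm_le_bound _ zero_le_one fun x => by
      rw [one_mul]; exact PiLp.norm_apply_le x i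
  choose f hf hf1 hf0 using fun i => exists_step_mem_gev hs (hproj i)
  choose g hg hg1 hg0 using fun i => exists_step_mem_gev hs ((norm_neg _).trans_le (hproj i))
  have hmem := prod_mem_gev hs0 Finset.univ fun i => mul_mem_gev hs0 (hf i) (hg i)
  refine ⟨⟨_, hmem.1, ?_, hmem.2⟩, fun x hx => ?_⟩
  · refine HasCompactSupport.intro (isCompact_closedBall (0 : Rd d) (Real.sqrt (d * 2 ^ 2)))
      fun x hx => ?_
    contrapose! hx
    have hcoord : ∀ i, ‖x i‖ ≤ 2 := fun i => by
      rw [Finset.prod_apply] at hx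
      have hfactor := Finset.prod_ne_zero_iff.mp hx i (Finset.mem_univ i)
      contrapose! hfactor
      rcases lt_abs.mp (Real.norm_eq_abs (x i) ▸ hfactor) with h | h
      · rw [hf0 i x h.le, zero_mul]
      · rw [hg0 i x h.le, mul_zero]
    rw [mem_closedBall_zero_iff, EuclideanSpace.norm_eq]
    gcongr
    calc ∑ i, ‖x i‖ ^ 2 ≤ ∑ _i : Fin d, (2 : ℝ) ^ 2 := by gcongr; exact hcoord _
      _ = d * 2 ^ 2 := by simp
  · change (∏ i, fun x => f i x * g i x) x = 1
    rw [Finset.prod_apply]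
    refine Finset.prod_eq_one fun i _ => ?_
    have hxi := abs_le.mp ((PiLp.norm_apply_le x i).trans hx)
    rw [hf1 i x hxi.2, hg1 i x (neg_le.mp hxi.1), one_mul]

lemma GevreyNormLE.dilate {f : Rd d → ℂ} (hf : ContDiff ℝ ∞ f) {h M R : ℝ} (hR : 1 ≤ R)
    (hM : GevreyNormLE s h M f) : GevreyNormLE s h M (fun x => f (R⁻¹ • x)) := by
  have hcontraction : ‖R⁻¹ • ContinuousLinearMap.id ℝ (Rd d)‖ ≤ 1 := by
    rw [norm_smul, norm_inv, Real.norm_of_nonneg (zero_le_one.trans hR)]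
    exact mul_le_one₀ (inv_le_one_of_one_le₀ hR) (norm_nonneg _) ContinuousLinearMap.norm_id_le
  exact fun n x => (norm_iteratedFDeriv_comp_clm_le hf hcontraction n x).trans (hM n _)

/-- The dilate `x ↦ χ(x / R)`, with `R ≥ 1` so that the Gevrey bounds of `χ` are kept. -/
def GevreyC.dilate (χ : GevreyC d s) {R : ℝ} (hR : 1 ≤ R) : GevreyC d s :=
  ⟨fun x => χ.1 (R⁻¹ • x), χ.2.1.comp (contDiff_const_smul R⁻¹),
    χ.2.2.1.comp_smul (inv_ne_zero (by linarith)), fun h hh => by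
      obtain ⟨M, hM⟩ := χ.2.2.2 h hh
      exact ⟨M, hM.dilate χ.2.1 hR⟩⟩

end Cutoff

/-! ### Rapid decay -/

section Decay

variable {d : ℕ} {s t : ℝ} {F A : Type*} [NormedAddCommGroup F] [NormedRing A]

/-- `g` decays faster than every stretched exponential of order `1/s`: the global form of
`DecaysOn s g`. -/
def RapidDecay (s : ℝ) (g : Rd d → F) : Prop :=
  ∀ r : ℝ, 0 < r → ∃ C : ℝ, 0 ≤ C ∧ ∀ ξ, ‖g ξ‖ ≤ C * Real.exp (-(r * ‖ξ‖ ^ (1 / s)))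

/-- `g` grows at most like a stretched exponential of order `1/s`, as the Fourier transform of a
compactly supported ultradistribution does. -/
def ModerateGrowth (s : ℝ) (g : Rd d → F) : Prop :=
  ∃ r : ℝ, 0 < r ∧ ∃ C : ℝ, 0 ≤ C ∧ ∀ ξ, ‖g ξ‖ ≤ C * Real.exp (r * ‖ξ‖ ^ (1 / s))

lemma integrable_exp_neg_norm_rpow {r : ℝ} (hs : 0 < s) (hr : 0 < r) :
    Integrable (fun x : Rd d => Real.exp (-(r * ‖x‖ ^ (1 / s)))) := by
  obtain ⟨C, -, hC⟩ := exists_one_add_pow_le_exp hs hr (d + 1)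
  have hint : Integrable (fun x : Rd d => C * (1 + ‖x‖) ^ (-((d + 1 : ℕ) : ℝ))) :=
    (integrable_one_add_norm (by simp)).const_mul C
  have hcont : Continuous fun x : Rd d => ‖x‖ ^ (1 / s) :=
    continuous_norm.rpow_const fun _ => Or.inr (by positivity)
  refine hint.mono' (Continuous.aestronglyMeasurable (by fun_prop)) (.of_forall fun x => ?_)
  have h1 : 0 < 1 + ‖x‖ := by positivity
  rw [Real.norm_of_nonneg (Real.exp_pos _).le, Real.rpow_neg h1.le, Real.rpow_natCast,
    Real.exp_neg, ← div_eq_mul_inv, le_div_iff₀ (by positivity), inv_mul_le_iff₀ (Real.exp_pos _),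
    mul_comm]
  exact hC _ (norm_nonneg _)

lemma RapidDecay.norm {g : Rd d → F} (hg : RapidDecay s g) : RapidDecay s (fun ξ => ‖g ξ‖) :=
  fun r hr => (hg r hr).imp fun _ hC => hC.imp_right fun hC ξ => (norm_norm (g ξ)).trans_le (hC ξ)

lemma RapidDecay.comp_neg {g : Rd d → F} (hg : RapidDecay s g) :
    RapidDecay s (fun ξ => g (-ξ)) := fun r hr =>
  (hg r hr).imp fun C hC => hC.imp_right fun hC ξ => by simpa only [norm_neg] using hC (-ξ)

lemma RapidDecay.integrable (hs : 0 < s) {g : Rd d → F} (hg : RapidDecay s g)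
    (hc : Continuous g) : Integrable g := by
  obtain ⟨C, -, hC⟩ := hg 1 one_pos
  exact ((integrable_exp_neg_norm_rpow hs one_pos).const_mul C).mono' hc.aestronglyMeasurable
    (.of_forall hC)

lemma RapidDecay.moderateGrowth {g : Rd d → F} (hg : RapidDecay s g) : ModerateGrowth s g := by
  obtain ⟨C, hC0, hC⟩ := hg 1 one_pos
  refine ⟨1, one_pos, C, hC0, fun ξ => (hC ξ).trans ?_⟩
  gcongr
  exact neg_le_self (by positivity)

lemma ModerateGrowth.mul_rapidDecay {f g : Rd d → A} (hf : ModerateGrowth s f)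
    (hg : RapidDecay s g) : RapidDecay s (fun ξ => f ξ * g ξ) := by
  obtain ⟨r₀, hr₀, C, hC0, hC⟩ := hf
  intro r hr
  obtain ⟨D, hD0, hD⟩ := hg (r + r₀) (by positivity)
  refine ⟨C * D, by positivity, fun ξ => ?_⟩
  calc ‖f ξ * g ξ‖ ≤ ‖f ξ‖ * ‖g ξ‖ := norm_mul_le _ _
    _ ≤ C * Real.exp (r₀ * ‖ξ‖ ^ (1 / s)) * (D * Real.exp (-((r + r₀) * ‖ξ‖ ^ (1 / s)))) := by
        gcongr
        exacts [hC ξ, hD ξ]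
    _ = C * D * (Real.exp (r₀ * ‖ξ‖ ^ (1 / s)) * Real.exp (-((r + r₀) * ‖ξ‖ ^ (1 / s)))) := by
        ring
    _ = C * D * Real.exp (-(r * ‖ξ‖ ^ (1 / s))) := by
        rw [← Real.exp_add]
        ring_nf

lemma ModerateGrowth.add {f g : Rd d → F} (hf : ModerateGrowth s f) (hg : ModerateGrowth s g) :
    ModerateGrowth s (fun ξ => f ξ + g ξ) := by
  obtain ⟨r, hr, C, hC0, hC⟩ := hf
  obtain ⟨q, hq, D, hD0, hD⟩ := hg
  refine ⟨r + q, by positivity, C + D, by positivity, fun ξ => ?_⟩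
  rw [add_mul]
  refine (norm_add_le _ _).trans (add_le_add ((hC ξ).trans ?_) ((hD ξ).trans ?_)) <;> gcongr <;>
    linarith

lemma ModerateGrowth.const_mul {f : Rd d → A} (c : A) (hf : ModerateGrowth s f) :
    ModerateGrowth s (fun ξ => c * f ξ) := by
  obtain ⟨r, hr, C, hC0, hC⟩ := hf
  refine ⟨r, hr, ‖c‖ * C, by positivity, fun ξ => (norm_mul_le _ _).trans ?_⟩
  rw [mul_assoc]
  exact mul_le_mul_of_nonneg_left (hC ξ) (norm_nonneg c)

lemma RapidDecay.const_mul {f : Rd d → A} (c : A) (hf : RapidDecay s f) :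
    RapidDecay s (fun ξ => c * f ξ) := fun r hr => by
  obtain ⟨C, hC0, hC⟩ := hf r hr
  refine ⟨‖c‖ * C, by positivity, fun ξ => (norm_mul_le _ _).trans ?_⟩
  rw [mul_assoc]
  exact mul_le_mul_of_nonneg_left (hC ξ) (norm_nonneg c)

lemma moderateGrowth_exp {r : ℝ} (hr : 0 < r) :
    ModerateGrowth s (fun ξ : Rd d => Real.exp (r * ‖ξ‖ ^ (1 / s))) :=
  ⟨r, hr, 1, zero_le_one, fun ξ => by rw [Real.norm_of_nonneg (Real.exp_pos _).le, one_mul]⟩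

lemma moderateGrowth_norm_pow (hs : 0 < s) (k : ℕ) :
    ModerateGrowth s (fun ξ : Rd d => ‖ξ‖ ^ k) := by
  obtain ⟨C, hC0, hC⟩ := exists_one_add_pow_le_exp hs one_pos k
  refine ⟨1, one_pos, C, hC0.le, fun ξ => ?_⟩
  rw [Real.norm_of_nonneg (by positivity)]
  exact (pow_le_pow_left₀ (norm_nonneg ξ) (by linarith) k).trans (hC _ (norm_nonneg ξ))

lemma RapidDecay.integrable_norm_pow_mul (hs : 0 < s) {g : Rd d → F} (hg : RapidDecay s g)
    (hc : Continuous g) (k : ℕ) : Integrable fun ξ => ‖ξ‖ ^ k * ‖g ξ‖ :=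
  ((moderateGrowth_norm_pow hs k).mul_rapidDecay hg.norm).integrable hs (by fun_prop)

lemma Sig.exists_norm_iteratedFDeriv_le (ht : 0 < t) (f : Sig d t s) {r h : ℝ} (hr : 0 < r)
    (hh : 0 < h) : ∃ C : ℝ, 0 ≤ C ∧ ∀ (n : ℕ) (x : Rd d), ‖iteratedFDeriv ℝ n f.1 x‖ ≤
      C * Real.exp (-(r * ‖x‖ ^ (1 / t))) * (h ^ n * (n ! : ℝ) ^ s) := by
  obtain ⟨k, hk0, hk⟩ := exists_le_exp_neg_of_moments ht hr
  obtain ⟨M, hM⟩ := f.2.2 (min k h) (by positivity)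
  have hM0 := hM.nonneg
  refine ⟨2 ^ t * M, by positivity, fun n x => ?_⟩
  have hmoment : ∀ m : ℕ, ‖x‖ ^ m * ‖iteratedFDeriv ℝ n f.1 x‖ ≤
      M * (h ^ n * (n ! : ℝ) ^ s) * (k ^ m * (m ! : ℝ) ^ t) := fun m =>
    calc ‖x‖ ^ m * ‖iteratedFDeriv ℝ n f.1 x‖
        ≤ M * (min k h ^ (m + n) * ((m ! : ℝ) ^ t * (n ! : ℝ) ^ s)) := hM m n x
      _ ≤ M * ((k ^ m * h ^ n) * ((m ! : ℝ) ^ t * (n ! : ℝ) ^ s)) := by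
          rw [pow_add]
          gcongr
          exacts [min_le_left _ _, min_le_right _ _]
      _ = _ := by ring
  calc ‖iteratedFDeriv ℝ n f.1 x‖
      ≤ 2 ^ t * (M * (h ^ n * (n ! : ℝ) ^ s)) * Real.exp (-(r * ‖x‖ ^ (1 / t))) :=
        hk _ _ _ (norm_nonneg _) (norm_nonneg _) (by positivity) hmoment
    _ = _ := by ring

lemma Sig.rapidDecay_iteratedFDeriv (ht : 0 < t) (f : Sig d t s) (n : ℕ) :
    RapidDecay t (iteratedFDeriv ℝ n f.1) := fun r hr => by
  obtain ⟨C, hC0, hC⟩ := Sig.exists_norm_iteratedFDeriv_le ht f hr one_pos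
  exact ⟨C * (1 ^ n * (n ! : ℝ) ^ s), by positivity, fun x => (hC n x).trans (by linarith)⟩

lemma Sig.rapidDecay (ht : 0 < t) (f : Sig d t s) : RapidDecay t f.1 := fun r hr => by
  simpa only [norm_iteratedFDeriv_zero] using Sig.rapidDecay_iteratedFDeriv ht f 0 r hr

lemma Sig.integrable (ht : 0 < t) (f : Sig d t s) : Integrable f.1 :=
  (Sig.rapidDecay ht f).integrable ht f.2.1.continuous

lemma Sig.integrable_mul (ht : 0 < t) (w f : Sig d t s) : Integrable (fun x => w.1 x * f.1 x) :=
  ((Sig.rapidDecay ht w).moderateGrowth.mul_rapidDecay (Sig.rapidDecay ht f)).integrable ht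
    (w.2.1.continuous.mul f.2.1.continuous)

end Decay

/-! ### Compactly supported ultradistributions -/

section CompactSupport

variable {d : ℕ} {s t : ℝ}

/-- The space `E_s'(ℝᵈ)` of compactly supported ultradistributions, realized as the functionals on
`Gev d s` that are bounded by the derivatives on some compact set. -/
structure GevDual (d : ℕ) (s : ℝ) where
  toLin : Gev d s →ₗ[ℂ] ℂ
  bounded : ∃ K : Set (Rd d), IsCompact K ∧ ∃ h : ℝ, 0 < h ∧ ∃ C : ℝ, 0 ≤ C ∧
    ∀ (f : Gev d s) (M : ℝ), 0 ≤ M →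
      (∀ (n : ℕ), ∀ x ∈ K, ‖iteratedFDeriv ℝ n f.1 x‖ ≤ M * (h ^ n * (n ! : ℝ) ^ s)) →
        ‖toLin f‖ ≤ C * M

lemma iteratedFDeriv_eq_zero_of_notMem_tsupport {E F : Type*} [NormedAddCommGroup E]
    [NormedSpace ℝ E] [NormedAddCommGroup F] [NormedSpace ℝ F] {f : E → F} {x : E}
    (hx : x ∉ tsupport f) (n : ℕ) : iteratedFDeriv ℝ n f x = 0 := by
  by_contra hne
  exact hx (support_iteratedFDeriv_subset n (Function.mem_support.mpr hne))

/-- The functional `f ↦ ⟨v, f χ⟩`, that is, the ultradistribution `χ v`. -/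
def GevreyDual.cutoff (hs : 0 ≤ s) (v : GevreyDual d s) (χ : GevreyC d s) : GevDual d s where
  toLin := v.toLin ∘ₗ
    { toFun := fun f => ⟨fun x => f.1 x * χ.1 x, mul_mem_gevreyC hs f.2 χ⟩
      map_add' := fun f g => Subtype.ext (funext fun x => add_mul (f.1 x) (g.1 x) (χ.1 x))
      map_smul' := fun c f => Subtype.ext (funext fun x => mul_assoc c (f.1 x) (χ.1 x)) }
  bounded := by
    obtain ⟨h, hh, C, hC⟩ := v.bounded (tsupport χ.1) χ.2.2.1
    obtain ⟨N, hN⟩ := χ.2.2.2 (h / 2) (by positivity)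
    have hN0 := hN.nonneg
    refine ⟨tsupport χ.1, χ.2.2.1, h / 2, by positivity, |C| * N, by positivity,
      fun f M hM0 hM => ?_⟩
    have hsub : tsupport (fun x => f.1 x * χ.1 x) ⊆ tsupport χ.1 := tsupport_mul_subset_right
    have hprod : GevreyNormLE s h (M * N) (fun x => f.1 x * χ.1 x) := fun n x => by
      by_cases hx : x ∈ tsupport χ.1
      · simpa only [mul_div_cancel₀ h two_ne_zero] using
          gevrey_mul_le hs (by positivity) f.2.1 χ.2.1 x (fun n => hM n x hx) (fun n => hN n x) n
      · rw [iteratedFDeriv_eq_zero_of_notMem_tsupport (fun hx' => hx (hsub hx')), norm_zero]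
        positivity
    calc ‖v.toLin ⟨fun x => f.1 x * χ.1 x, mul_mem_gevreyC hs f.2 χ⟩‖
        ≤ C * (M * N) := hC _ _ hsub hprod
      _ ≤ |C| * (M * N) := by gcongr; exact le_abs_self C
      _ = |C| * N * M := by ring

lemma GevreyDual.cutoff_apply (hs : 0 ≤ s) (v : GevreyDual d s) (χ : GevreyC d s) (f : Gev d s) :
    (v.cutoff hs χ).toLin f = v.toLin ⟨fun x => f.1 x * χ.1 x, mul_mem_gevreyC hs f.2 χ⟩ := rfl

lemma GevreyDual.cutoff_congr (hs : 0 ≤ s) {v : GevreyDual d s} {K O : Set (Rd d)}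
    (hv : ∀ ϕ : GevreyC d s, tsupport ϕ.1 ⊆ Kᶜ → v.toLin ϕ = 0) (hO : IsOpen O) (hKO : K ⊆ O)
    {χ ρ : GevreyC d s} (hχρ : Set.EqOn χ.1 ρ.1 O) (f : Gev d s) :
    (v.cutoff hs χ).toLin f = (v.cutoff hs ρ).toLin f := by
  rw [cutoff_apply, cutoff_apply, ← sub_eq_zero, ← map_sub]
  refine hv _ ((closure_minimal ?_ hO.isClosed_compl).trans (Set.compl_subset_compl.mpr hKO))
  intro x hx hxO
  refine hx ?_
  change f.1 x * χ.1 x - f.1 x * ρ.1 x = 0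
  rw [hχρ hxO, sub_self]

/-- `u = v + w` with `v ∈ E_s'` and `w ∈ Σ_t^s`, as functionals on all of `Σ_t^s`. -/
def SigDual.HasDecomposition (u : SigDual d t s) (v : GevDual d s) (w : Sig d t s) : Prop :=
  ∀ f : Sig d t s, u.toLin f = v.toLin ⟨f.1, Sig.mem_gev f⟩ + ∫ x, w.1 x * f.1 x

lemma GevreyC.dilate_eq_one {χ : GevreyC d s} (hχ : ∀ x : Rd d, ‖x‖ ≤ 1 → χ.1 x = 1) {R : ℝ}
    (hR : 1 ≤ R) {x : Rd d} (hx : ‖x‖ ≤ R) : (GevreyC.dilate χ hR).1 x = 1 := by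
  have hR0 : 0 < R := by linarith
  refine hχ _ ?_
  rwa [norm_smul, norm_inv, Real.norm_of_nonneg hR0.le, inv_mul_le_iff₀ hR0, mul_one]

lemma succ_factorial_rpow_le (ht : 0 ≤ t) (k : ℕ) :
    ((k + 1)! : ℝ) ^ t ≤ (2 ^ t) ^ k * (k ! : ℝ) ^ t := by
  have hk : ((k + 1 : ℕ) : ℝ) ≤ 2 ^ k := mod_cast Nat.lt_two_pow_self
  calc ((k + 1)! : ℝ) ^ t = ((k + 1 : ℕ) : ℝ) ^ t * (k ! : ℝ) ^ t := by
        rw [Nat.factorial_succ, Nat.cast_mul, Real.mul_rpow (by positivity) (by positivity)]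
    _ ≤ (2 ^ k) ^ t * (k ! : ℝ) ^ t := by gcongr
    _ = (2 ^ t) ^ k * (k ! : ℝ) ^ t := by rw [Real.rpow_pow_comm zero_le_two]

lemma NormLE.norm_pow_mul_le_div (ht : 0 ≤ t) {f : Rd d → ℂ} {h N R : ℝ} (hh : 0 < h)
    (hN : NormLE t s (h / 2 ^ t) N f) (hR : 0 < R) {x : Rd d} (hx : R ≤ ‖x‖) (k n : ℕ) :
    ‖x‖ ^ k * ‖iteratedFDeriv ℝ n f x‖ ≤
      N * h / R * (h ^ k * (k ! : ℝ) ^ t) * (h ^ n * (n ! : ℝ) ^ s) := by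
  have hN0 := hN.nonneg
  have h2t : (1 : ℝ) ≤ 2 ^ t := Real.one_le_rpow one_le_two ht
  have hq : h / 2 ^ t ≤ h := div_le_self hh.le h2t
  have hscale : (h / 2 ^ t) ^ k * (2 ^ t) ^ k = h ^ k := by
    rw [← mul_pow, div_mul_cancel₀ _ (by positivity)]
  have hfar : ‖x‖ ^ k * ‖iteratedFDeriv ℝ n f x‖ * R ≤
      ‖x‖ ^ (k + 1) * ‖iteratedFDeriv ℝ n f x‖ := by
    rw [pow_succ, mul_right_comm]
    gcongr
  have hbound : N * ((h / 2 ^ t) ^ (k + 1 + n) * (((k + 1)! : ℝ) ^ t * (n ! : ℝ) ^ s)) ≤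
      N * h * (h ^ k * (k ! : ℝ) ^ t) * (h ^ n * (n ! : ℝ) ^ s) :=
    calc N * ((h / 2 ^ t) ^ (k + 1 + n) * (((k + 1)! : ℝ) ^ t * (n ! : ℝ) ^ s))
        = N * (h / 2 ^ t) * (h / 2 ^ t) ^ k *
            ((h / 2 ^ t) ^ n * (((k + 1)! : ℝ) ^ t * (n ! : ℝ) ^ s)) := by
          rw [pow_add, pow_add, pow_one]
          ring
      _ ≤ N * h * (h / 2 ^ t) ^ k *
            (h ^ n * ((2 ^ t) ^ k * (k ! : ℝ) ^ t * (n ! : ℝ) ^ s)) := by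
          gcongr
          exact succ_factorial_rpow_le ht k
      _ = N * h * ((h / 2 ^ t) ^ k * (2 ^ t) ^ k * (k ! : ℝ) ^ t) *
            (h ^ n * (n ! : ℝ) ^ s) := by ring
      _ = _ := by rw [hscale]
  calc ‖x‖ ^ k * ‖iteratedFDeriv ℝ n f x‖
      ≤ N * h * (h ^ k * (k ! : ℝ) ^ t) * (h ^ n * (n ! : ℝ) ^ s) / R := by
        rw [le_div_iff₀ hR]
        exact hfar.trans ((hN (k + 1) n x).trans hbound)
    _ = _ := by ring

lemma exists_normLE_tail (hs : 0 ≤ s) (ht : 0 ≤ t) {χ : GevreyC d s}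
    (hχ : ∀ x : Rd d, ‖x‖ ≤ 1 → χ.1 x = 1) (f : Sig d t s) {h : ℝ} (hh : 0 < h) :
    ∃ D : ℝ, 0 ≤ D ∧ ∀ (R : ℝ) (hR : 1 ≤ R),
      NormLE t s h (D / R) (fun x => (1 - (GevreyC.dilate χ hR).1 x) * f.1 x) := by
  have hmem : (fun x => 1 - χ.1 x) ∈ Gev d s :=
    (Gev d s).sub_mem (const_mem_gev 1) (GevreyC.mem_gev χ)
  obtain ⟨M, hM⟩ := hmem.2 (h / 2) (by positivity)
  obtain ⟨N, hN⟩ := f.2.2 (h / 2 / 2 ^ t) (by positivity)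
  have hM0 := hM.nonneg
  have hN0 := hN.nonneg
  refine ⟨M * (N * (h / 2)), by positivity, fun R hR k n x => ?_⟩
  have hR0 : 0 < R := by linarith
  rcases lt_or_ge ‖x‖ R with hx | hx
  · have hzero : (fun x => (1 - (GevreyC.dilate χ hR).1 x) * f.1 x) =ᶠ[nhds x] fun _ => 0 := by
      filter_upwards [(isOpen_lt continuous_norm continuous_const).mem_nhds hx] with y hy
      rw [GevreyC.dilate_eq_one hχ hR (le_of_lt hy), sub_self, zero_mul]
    rw [(hzero.iteratedFDeriv ℝ n).eq_of_nhds, iteratedFDeriv_fun_zero]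
    simp only [Pi.zero_apply, norm_zero, mul_zero]
    positivity
  · have hleibniz := weighted_gevrey_mul_le hs (by positivity)
      (hmem.1.comp (contDiff_const_smul R⁻¹)) f.2.1 (by positivity) x
      (fun n => hM.dilate hmem.1 hR n x) (hN.norm_pow_mul_le_div ht (half_pos hh) hR0 hx k) n
    rw [mul_div_cancel₀ h two_ne_zero] at hleibniz
    calc _ ≤ M * (N * (h / 2) / R * ((h / 2) ^ k * (k ! : ℝ) ^ t)) * (h ^ n * (n ! : ℝ) ^ s) :=
          hleibniz
      _ ≤ M * (N * (h / 2) / R * (h ^ k * (k ! : ℝ) ^ t)) * (h ^ n * (n ! : ℝ) ^ s) := by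
          gcongr
          linarith
      _ = _ := by rw [pow_add]; ring

/-- The truncation `f χ(· / (n + 1))` of a Gelfand-Shilov function. -/
def Sig.truncate (hs : 0 ≤ s) (f : Sig d t s) (χ : GevreyC d s) (n : ℕ) : GevreyC d s :=
  ⟨fun x => f.1 x * (GevreyC.dilate χ (show 1 ≤ (n : ℝ) + 1 by simp)).1 x,
    mul_mem_gevreyC hs (Sig.mem_gev f) _⟩

lemma SigDual.tendsto_apply_truncate (hs : 0 ≤ s) (ht : 0 < t) (u : SigDual d t s)
    {χ : GevreyC d s} (hχ : ∀ x : Rd d, ‖x‖ ≤ 1 → χ.1 x = 1) (f : Sig d t s) :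
    Filter.Tendsto (fun n => (u.toGevreyDual ht).toLin (Sig.truncate hs f χ n)) Filter.atTop
      (nhds (u.toLin f)) := by
  obtain ⟨h, hh, C, hC⟩ := u.bounded
  obtain ⟨D, -, hD⟩ := exists_normLE_tail hs ht.le hχ f hh
  refine tendsto_iff_norm_sub_tendsto_zero.mpr (squeeze_zero (fun _ => norm_nonneg _) (fun n => ?_)
    ((tendsto_one_div_add_atTop_nhds_zero_nat (𝕜 := ℝ)).const_mul (C * D) |>.trans_eq (by simp)))
  have htail : (f - Submodule.inclusion (gevreyC_le_sig ht) (Sig.truncate hs f χ n)).1 =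
      fun x => (1 - (GevreyC.dilate χ (show 1 ≤ (n : ℝ) + 1 by simp)).1 x) * f.1 x := by
    funext x
    change f.1 x - f.1 x * _ = _
    ring
  rw [norm_sub_rev]
  change ‖u.toLin f - u.toLin _‖ ≤ _
  rw [← map_sub]
  refine (hC _ _ (by rw [htail]; exact hD _ _)).trans_eq ?_
  ring

/-- The functional `f ↦ ∫ w f`. -/
def Sig.toSigDual (ht : 0 < t) (w : Sig d t s) : SigDual d t s where
  toLin :=
    { toFun := fun f => ∫ x, w.1 x * f.1 x
      map_add' := fun f g => by
        rw [← integral_add (Sig.integrable_mul ht w f) (Sig.integrable_mul ht w g)]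
        exact integral_congr_ae (.of_forall fun x => mul_add (w.1 x) (f.1 x) (g.1 x))
      map_smul' := fun c f => by
        rw [RingHom.id_apply, smul_eq_mul, ← integral_const_mul]
        exact integral_congr_ae (.of_forall fun x => mul_left_comm (w.1 x) c (f.1 x)) }
  bounded := by
    refine ⟨1, one_pos, ∫ x, ‖w.1 x‖, fun f M hM => ?_⟩
    rw [← integral_mul_const]
    refine norm_integral_le_of_norm_le ((Sig.integrable ht w).norm.mul_const _)
      (.of_forall fun x => ?_)
    rw [norm_mul]
    gcongr
    simpa using hM 0 0 x

lemma SigDual.MemCompactAddSig.exists_hasDecomposition (hs : 1 < s) {ht : 0 < t}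
    {u : SigDual d t s} (hu : u.MemCompactAddSig ht) :
    ∃ (v : GevDual d s) (w : Sig d t s), u.HasDecomposition v w := by
  obtain ⟨v, ⟨K, hK, hv⟩, w, hw⟩ := hu
  have hs0 := (zero_lt_one.trans hs).le
  obtain ⟨χ, hχ⟩ := exists_eq_one_on_unit_ball d hs
  obtain ⟨R, hR⟩ := hK.isBounded.subset_ball 0
  have hKB : K ⊆ Metric.ball (0 : Rd d) (max 1 R) :=
    hR.trans (Metric.ball_subset_ball (le_max_right _ _))
  set ρ : GevreyC d s := GevreyC.dilate χ (le_max_left 1 R)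
  refine ⟨v.cutoff hs0 ρ, w, fun f => ?_⟩
  refine tendsto_nhds_unique (u.tendsto_apply_truncate hs0 ht hχ f) (Filter.Tendsto.congr' ?_
    (tendsto_const_nhds.add ((Sig.toSigDual ht w).tendsto_apply_truncate hs0 ht hχ f)))
  filter_upwards [Filter.eventually_ge_atTop ⌈max 1 R⌉₊] with n hn
  have hRn : max 1 R ≤ (n : ℝ) + 1 := by linarith [Nat.ceil_le.mp hn]
  have hagree : Set.EqOn ρ.1 (GevreyC.dilate χ (show 1 ≤ (n : ℝ) + 1 by simp)).1
      (Metric.ball 0 (max 1 R)) := fun x hx => by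
    rw [mem_ball_zero_iff] at hx
    rw [GevreyC.dilate_eq_one hχ _ hx.le, GevreyC.dilate_eq_one hχ _ (hx.le.trans hRn)]
  rw [hw, GevreyDual.cutoff_congr hs0 hv Metric.isOpen_ball hKB hagree]
  rfl

end CompactSupport

section Fubini

variable {E : Type*} [AddCommGroup E] [Module ℂ E]

lemma exists_strongDual_comp_eq {F : Type*} [NormedAddCommGroup F] [NormedSpace ℂ F]
    (W : E →ₗ[ℂ] F) (L : E →ₗ[ℂ] ℂ) (C : ℝ) (hL : ∀ f, ‖L f‖ ≤ C * ‖W f‖) :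
    ∃ T : StrongDual ℂ F, ∀ f, T (W f) = L f := by
  obtain ⟨g, hg⟩ := W.rangeRestrict.exists_rightInverse_of_surjective
    (LinearMap.range_rangeRestrict W)
  have hWg : ∀ p : LinearMap.range W, W (g p) = p := fun p =>
    congrArg Subtype.val (LinearMap.congr_fun hg p)
  let T₀ : StrongDual ℂ (LinearMap.range W) := (L ∘ₗ g).mkContinuous C fun p => by
    have hLg := hL (g p)
    rwa [hWg] at hLg
  obtain ⟨T, hT, -⟩ := exists_extension_norm_eq (LinearMap.range W) T₀
  refine ⟨T, fun f => ?_⟩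
  set p : LinearMap.range W := ⟨W f, LinearMap.mem_range_self W f⟩
  have hp : L (g p - f) = 0 := by
    have := hL (g p - f)
    rwa [map_sub W, hWg, sub_self, norm_zero, mul_zero, norm_le_zero_iff] at this
  calc T (W f) = T₀ p := hT p
    _ = L f := by rw [map_sub, sub_eq_zero] at hp; exact hp

/-- The functional factors through the bounded functions on the index set `ι`, where Bochner
integrals commute with continuous functionals. -/
lemma map_integral_of_bounded {X ι : Type*} [TopologicalSpace X] [SecondCountableTopology X]
    [MeasurableSpace X] [OpensMeasurableSpace X] (μ : Measure X) (l : ι → E →ₗ[ℂ] ℂ)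
    (hE : ∀ f, ∃ M, ∀ i, ‖l i f‖ ≤ M) (L : E →ₗ[ℂ] ℂ) (C : ℝ)
    (hL : ∀ f M, 0 ≤ M → (∀ i, ‖l i f‖ ≤ M) → ‖L f‖ ≤ C * M) {a : X → ℂ} (ha : Continuous a)
    {F : X → E} (hF : ∀ x₀, ∀ ε > 0, ∀ᶠ x in nhds x₀, ∀ i, ‖l i (F x - F x₀)‖ ≤ ε)
    {b : X → ℝ} (hb0 : ∀ x, 0 ≤ b x) (hb : ∀ x i, ‖l i (F x)‖ ≤ b x)
    (hab : Integrable (fun x => ‖a x‖ * b x) μ) {f₀ : E}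
    (hf₀ : ∀ i, l i f₀ = ∫ x, a x * l i (F x) ∂μ) :
    L f₀ = ∫ x, a x * L (F x) ∂μ := by
  let _ : TopologicalSpace ι := ⊥
  have _ : DiscreteTopology ι := ⟨rfl⟩
  choose B hB using hE
  let W : E →ₗ[ℂ] BoundedContinuousFunction ι ℂ :=
    { toFun := fun f => BoundedContinuousFunction.ofNormedAddCommGroupDiscrete
        (fun i => l i f) (B f) (hB f)
      map_add' := fun f g => by ext i; simp
      map_smul' := fun c f => by ext i; simp }
  have hW : ∀ {f M}, 0 ≤ M → (∀ i, ‖l i f‖ ≤ M) → ‖W f‖ ≤ M := fun hM hf =>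
    (BoundedContinuousFunction.norm_le hM).mpr hf
  obtain ⟨T, hT⟩ := exists_strongDual_comp_eq W L C fun f =>
    hL f ‖W f‖ (norm_nonneg _) (W f).norm_coe_le_norm
  have hcont : Continuous fun x => W (F x) := by
    refine continuous_iff_continuousAt.mpr fun x₀ => Metric.tendsto_nhds.mpr fun ε hε => ?_
    filter_upwards [hF x₀ (ε / 2) (by positivity)] with x hx
    rw [dist_eq_norm, ← map_sub]
    exact (hW (by positivity) hx).trans_lt (half_lt_self hε)
  have hint : Integrable (fun x => a x • W (F x)) μ := by
    refine hab.mono' (ha.smul hcont).aestronglyMeasurable (.of_forall fun x => ?_)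
    rw [norm_smul]
    gcongr
    exact hW (hb0 x) (hb x)
  have hid : W f₀ = ∫ x, a x • W (F x) ∂μ := by
    ext i
    exact (hf₀ i).trans ((BoundedContinuousFunction.evalCLM ℂ i).integral_comp_comm hint)
  calc L f₀ = T (∫ x, a x • W (F x) ∂μ) := by rw [← hT, hid]
    _ = ∫ x, T (a x • W (F x)) ∂μ := (T.integral_comp_comm hint).symm
    _ = ∫ x, a x * L (F x) ∂μ := by simp only [map_smul, hT, smul_eq_mul]

end Fubini

/-! ### Characters and Fourier inversion -/

section Fourier

variable {d : ℕ} {s t : ℝ}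

lemma norm_char (ξ x : Rd d) : ‖char ξ x‖ = 1 := by
  rw [char, Complex.norm_exp]
  simp

lemma char_comm (ξ x : Rd d) : char ξ x = char x ξ := by
  rw [char, char, real_inner_comm]

lemma char_add (ξ η x : Rd d) : char (ξ + η) x = char ξ x * char η x := by
  rw [char, char, char, ← Complex.exp_add, inner_add_right, Complex.ofReal_add, mul_add]

lemma char_neg_left (ξ x : Rd d) : char (-ξ) x = char ξ (-x) := by
  rw [char, char, inner_neg_left, inner_neg_right]

lemma char_neg_mul_char (ξ x : Rd d) : char (-ξ) x * char ξ x = 1 := by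
  rw [← char_add, neg_add_cancel]
  simp [char]

lemma continuous_char (ξ : Rd d) : Continuous (char ξ) := (contDiff_char ξ).continuous

lemma iteratedFDeriv_char_apply (ξ x : Rd d) (n : ℕ) (m : Fin n → Rd d) :
    iteratedFDeriv ℝ n (char ξ) x m =
      ((∏ i, inner ℝ ξ (m i) : ℝ) : ℂ) * ((-Complex.I) ^ n * char ξ x) := by
  rw [char_eq, ContinuousLinearMap.iteratedFDeriv_comp_right _ contDiff_cexp_aux x
    (i := n) (mod_cast le_top), ContinuousMultilinearMap.compContinuousLinearMap_apply,
    iteratedFDeriv_apply_eq_iteratedDeriv_mul_prod, iteratedDeriv_cexp_aux]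
  simp only [innerSL_apply_apply, Complex.real_smul, Function.comp_apply]

lemma fourierConst_ne_zero (d : ℕ) : fourierConst d ≠ 0 := by
  rw [fourierConst, Complex.ofReal_ne_zero]
  positivity

lemma fourierConst_mul_self (d : ℕ) :
    fourierConst d * (fourierConst d * ((2 * Real.pi) ^ d : ℝ)) = 1 := by
  have h2π : 0 < 2 * Real.pi := by positivity
  rw [fourierConst, ← Complex.ofReal_mul, ← Complex.ofReal_mul, Complex.ofReal_eq_one,
    ← Real.rpow_natCast, ← Real.rpow_add h2π, ← Real.rpow_add h2π]
  ring_nf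
  exact Real.rpow_zero _

lemma fourierInv_eq_char (f : Rd d → ℂ) (ξ : Rd d) :
    fourierInv f ξ = fourierConst d * ∫ x, f x * char (-ξ) x := by
  simp only [fourierInv, char, inner_neg_right, Complex.ofReal_neg, neg_mul_neg]

lemma integral_mul_char_eq_fourierInv (f : Rd d → ℂ) (ξ : Rd d) :
    ∫ x, f x * char ξ x = (fourierConst d)⁻¹ * fourierInv f (-ξ) := by
  rw [fourierInv_eq_char, neg_neg, inv_mul_cancel_left₀ (fourierConst_ne_zero d)]

lemma fourierInv_eq_fourierTransformInv (f : Rd d → ℂ) (ξ : Rd d) :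
    fourierInv f ξ = fourierConst d * 𝓕⁻ f ((2 * Real.pi)⁻¹ • ξ) := by
  rw [fourierInv, Real.fourierInv_eq']
  congr 2 with x
  rw [smul_eq_mul, mul_comm, inner_smul_right, ← mul_assoc, mul_inv_cancel₀ (by positivity),
    one_mul, mul_comm Complex.I]

lemma integral_comp_smul_mul_char (g : Rd d → ℂ) (x : Rd d) :
    ∫ ξ, g ((2 * Real.pi)⁻¹ • ξ) * char ξ x = ((2 * Real.pi) ^ d : ℝ) * 𝓕 g x := by
  have hchar : ∀ ξ : Rd d, char ξ x =
      Complex.exp (↑(-2 * Real.pi * inner ℝ ((2 * Real.pi)⁻¹ • ξ) x) * Complex.I) := fun ξ => by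
    rw [char_comm, char, inner_smul_left, RCLike.conj_to_real, neg_mul, neg_mul, neg_mul,
      mul_inv_cancel_left₀ (by positivity), Complex.ofReal_neg, neg_mul, mul_comm]
  simp only [hchar, mul_comm (g _)]
  rw [Measure.integral_comp_inv_smul_of_nonneg volume (fun w => Complex.exp
    (↑(-2 * Real.pi * inner ℝ w x) * Complex.I) * g w) (by positivity),
    finrank_euclideanSpace_fin, Complex.real_smul, Real.fourier_eq']
  simp only [smul_eq_mul]

lemma continuous_fourierInv {f : Rd d → ℂ} (hf : Integrable f) : Continuous (fourierInv f) := by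
  have hc : Continuous fun ξ : Rd d => ∫ x, f x * char (-ξ) x := by
    refine continuous_of_dominated (bound := fun x => ‖f x‖) (fun ξ => ?_) (fun ξ => ?_) hf.norm ?_
    · exact hf.aestronglyMeasurable.mul (continuous_char (-ξ)).aestronglyMeasurable
    · exact .of_forall fun x => by rw [norm_mul, norm_char, mul_one]
    · refine .of_forall fun x => continuous_const.mul ?_
      simp only [char_comm _ x]
      exact (continuous_char x).comp continuous_neg
  exact (hc.const_mul (fourierConst d)).congr fun ξ => (fourierInv_eq_char f ξ).symm

lemma eq_integral_fourierInv_mul_char {f : Rd d → ℂ} (hc : Continuous f) (hf : Integrable f)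
    (hf' : Integrable (fourierInv f)) (x : Rd d) :
    f x = fourierConst d * ∫ ξ, fourierInv f ξ * char ξ x := by
  have hFinv : Integrable (𝓕⁻ f) := by
    refine (integrable_comp_smul_iff volume _ (inv_ne_zero Real.two_pi_pos.ne')).mp
      ((hf'.const_mul (fourierConst d)⁻¹).congr (.of_forall fun ξ => ?_))
    simp only [fourierInv_eq_fourierTransformInv, inv_mul_cancel_left₀ (fourierConst_ne_zero d)]
  have hF : Integrable (𝓕 f) := hFinv.comp_neg.congr <| .of_forall fun w => by
    beta_reduce
    rw [Real.fourierInv_eq_fourier_neg, neg_neg]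
  calc f x = fourierConst d * (fourierConst d * (((2 * Real.pi) ^ d : ℝ) * 𝓕 (𝓕⁻ f) x)) := by
        rw [hf.fourier_fourierInv_eq hF hc.continuousAt, ← mul_assoc (fourierConst d) _ (f x),
          ← mul_assoc, fourierConst_mul_self, one_mul]
    _ = fourierConst d * ∫ ξ, fourierInv f ξ * char ξ x := by
        simp only [fourierInv_eq_fourierTransformInv, mul_assoc (fourierConst d)]
        rw [integral_const_mul, integral_comp_smul_mul_char]

/-- The pairing `⟨ξ, x⟩ / 2π`, for which Mathlib's Fourier integrals have the kernel `char ξ x`. -/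
def fourierPairing (d : ℕ) : Rd d →L[ℝ] Rd d →L[ℝ] ℝ := (2 * Real.pi)⁻¹ • innerSL ℝ

lemma fourierPairing_apply (ξ x : Rd d) :
    fourierPairing d ξ x = (2 * Real.pi)⁻¹ * inner ℝ ξ x := rfl

lemma fourierChar_neg_fourierPairing (ξ x : Rd d) :
    ((𝐞 (-fourierPairing d ξ x) : Circle) : ℂ) = char ξ x := by
  rw [Real.fourierChar_apply, fourierPairing_apply, char_comm, char, mul_neg,
    mul_inv_cancel_left₀ (by positivity), Complex.ofReal_neg, neg_mul, neg_mul, mul_comm]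

lemma fourierIntegral_fourierPairing (g : Rd d → ℂ) (x : Rd d) :
    VectorFourier.fourierIntegral 𝐞 volume (fourierPairing d).toLinearMap₁₂ g x =
      ∫ ξ, g ξ * char ξ x :=
  integral_congr_ae (.of_forall fun ξ => by
    beta_reduce
    rw [← fourierChar_neg_fourierPairing, mul_comm]
    rfl)

lemma norm_pow_mul_norm_integral_mul_char_le {f : Rd d → ℂ} {n : ℕ} (hf : ContDiff ℝ n f)
    (hint : ∀ k : ℕ, k ≤ n → Integrable (iteratedFDeriv ℝ k f)) (ξ : Rd d) :
    ‖ξ‖ ^ n * ‖∫ x, f x * char ξ x‖ ≤ ∫ x, ‖iteratedFDeriv ℝ n f x‖ := by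
  rcases eq_or_ne ξ 0 with rfl | hξ
  · rcases n.eq_zero_or_pos with rfl | hn
    · simpa [char] using norm_integral_le_integral_norm f
    · rw [norm_zero, zero_pow hn.ne', zero_mul]
      positivity
  set L := fourierPairing d
  set T := VectorFourier.fourierIntegral 𝐞 volume L.toLinearMap₁₂ f
  have hpow : ‖VectorFourier.fourierPowSMulRight (-L.flip) T ξ n‖ ≤
      ∫ x, ‖iteratedFDeriv ℝ n f x‖ := by
    rw [← congrFun (VectorFourier.fourierIntegral_iteratedFDeriv L (μ := volume) (N := n) hf
      (fun k hk => hint k (mod_cast hk)) le_rfl) ξ]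
    exact VectorFourier.norm_fourierIntegral_le_integral_norm 𝐞 volume L.toLinearMap₁₂ _ ξ
  have hdiag : ‖VectorFourier.fourierPowSMulRight (-L.flip) T ξ n fun _ => ξ‖ =
      ‖ξ‖ ^ n * ‖T ξ‖ * ‖ξ‖ ^ n := by
    rw [VectorFourier.fourierPowSMulRight_apply, norm_smul, norm_smul]
    simp only [norm_pow, norm_neg, norm_mul, norm_inv, abs_norm, Complex.norm_ofNat,
      Complex.norm_real, Real.norm_eq_abs, abs_of_pos Real.pi_pos,
      Complex.norm_I, mul_one, mul_pow, neg_apply, ContinuousLinearMap.flip_apply,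
      fourierPairing_apply, mul_inv_rev, inner_self_eq_norm_sq_to_K, Real.ringHom_apply,
      Finset.prod_const, Finset.card_univ, Fintype.card_fin, inv_pow, L]
    field_simp
    ring
  have hop := (VectorFourier.fourierPowSMulRight (-L.flip) T ξ n).le_of_opNorm_le hpow fun _ => ξ
  rw [hdiag, Finset.prod_const, Finset.card_univ, Fintype.card_fin] at hop
  have hT : T ξ = ∫ x, f x * char ξ x := by
    simpa only [char_comm ξ] using fourierIntegral_fourierPairing f ξ
  rw [← hT]
  exact le_of_mul_le_mul_right hop (by positivity)

lemma Sig.rapidDecay_fourierInv (hs : 0 < s) (ht : 0 < t) (f : Sig d t s) :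
    RapidDecay s (fourierInv f.1) := by
  intro r hr
  obtain ⟨h, hh, hdecay⟩ := exists_le_exp_neg_of_moments hs hr
  obtain ⟨C, hC0, hC⟩ := Sig.exists_norm_iteratedFDeriv_le ht f one_pos hh
  set I : ℝ := ∫ x : Rd d, Real.exp (-(1 * ‖x‖ ^ (1 / t)))
  have : 0 ≤ I := integral_nonneg fun x => (Real.exp_pos _).le
  have hint : ∀ n : ℕ, Integrable (iteratedFDeriv ℝ n f.1) := fun n =>
    (Sig.rapidDecay_iteratedFDeriv ht f n).integrable ht
      (f.2.1.continuous_iteratedFDeriv (mod_cast le_top))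
  have hderiv : ∀ n : ℕ, ∫ x, ‖iteratedFDeriv ℝ n f.1 x‖ ≤ C * I * (h ^ n * (n ! : ℝ) ^ s) := by
    intro n
    rw [← integral_const_mul, ← integral_mul_const]
    exact integral_mono (hint n).norm
      (((integrable_exp_neg_norm_rpow ht one_pos).const_mul C).mul_const _) (hC n)
  set D : ℝ := ‖fourierConst d‖ * (C * I)
  refine ⟨2 ^ s * D, by positivity, fun ξ =>
    hdecay ‖ξ‖ _ D (norm_nonneg ξ) (norm_nonneg _) (by positivity) fun n => ?_⟩
  have hmoment := (norm_pow_mul_norm_integral_mul_char_le (f.2.1.of_le (mod_cast le_top))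
    (fun k _ => hint k) (-ξ)).trans (hderiv n)
  rw [norm_neg] at hmoment
  rw [fourierInv_eq_char, norm_mul, mul_left_comm, mul_assoc]
  gcongr

lemma Sig.continuous_fourierInv (ht : 0 < t) (f : Sig d t s) : Continuous (fourierInv f.1) :=
  GelfandShilov.continuous_fourierInv (Sig.integrable ht f)

lemma Sig.integrable_fourierInv (hs : 0 < s) (ht : 0 < t) (f : Sig d t s) :
    Integrable (fourierInv f.1) :=
  (Sig.rapidDecay_fourierInv hs ht f).integrable hs (Sig.continuous_fourierInv ht f)

lemma Sig.eq_integral_fourierInv_mul_char (hs : 0 < s) (ht : 0 < t) (f : Sig d t s) (x : Rd d) :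
    f.1 x = fourierConst d * ∫ ξ, fourierInv f.1 ξ * char ξ x :=
  GelfandShilov.eq_integral_fourierInv_mul_char f.2.1.continuous (Sig.integrable ht f)
    (Sig.integrable_fourierInv hs ht f) x

lemma iteratedFDeriv_integral_mul_char {g : Rd d → ℂ} (hg : AEStronglyMeasurable g)
    (hmom : ∀ k : ℕ, Integrable fun ξ => ‖ξ‖ ^ k * ‖g ξ‖) (n : ℕ) (x : Rd d)
    (m : Fin n → Rd d) :
    iteratedFDeriv ℝ n (fun y => ∫ ξ, g ξ * char ξ y) x m =
      ∫ ξ, g ξ * iteratedFDeriv ℝ n (char ξ) x m := by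
  set L := fourierPairing d
  have hint : Integrable fun ξ => 𝐞 (-L ξ x) • VectorFourier.fourierPowSMulRight L g ξ n :=
    (VectorFourier.fourierIntegral_convergent_iff Real.continuous_fourierChar
      (by apply L.continuous₂ : Continuous fun p : Rd d × Rd d => L.toLinearMap₁₂ p.1 p.2) x).2
      (VectorFourier.integrable_fourierPowSMulRight L (hmom n) hg)
  calc iteratedFDeriv ℝ n (fun y => ∫ ξ, g ξ * char ξ y) x m
      = VectorFourier.fourierIntegral 𝐞 volume L.toLinearMap₁₂
          (fun ξ => VectorFourier.fourierPowSMulRight L g ξ n) x m := by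
        have hT : (fun y => ∫ ξ, g ξ * char ξ y) =
            VectorFourier.fourierIntegral 𝐞 volume L.toLinearMap₁₂ g :=
          funext fun y => (fourierIntegral_fourierPairing g y).symm
        rw [hT, VectorFourier.iteratedFDeriv_fourierIntegral L (N := ⊤) (fun k _ => hmom k) hg
          (mod_cast le_top)]
    _ = ∫ ξ, (𝐞 (-L ξ x) • VectorFourier.fourierPowSMulRight L g ξ n) m :=
        ((ContinuousMultilinearMap.apply ℝ (fun _ : Fin n => Rd d) ℂ m).integral_comp_comm
          hint).symm
    _ = ∫ ξ, g ξ * iteratedFDeriv ℝ n (char ξ) x m := by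
        refine integral_congr_ae (.of_forall fun ξ => ?_)
        have hconst : (-(2 * Real.pi * Complex.I) : ℂ) ^ n * ((2 * Real.pi : ℂ)⁻¹) ^ n =
            (-Complex.I) ^ n := by
          rw [← mul_pow, mul_comm, ← mul_neg, inv_mul_cancel_left₀]
          simp [Real.pi_ne_zero]
        beta_reduce
        rw [Circle.smul_def, smul_apply, VectorFourier.fourierPowSMulRight_apply,
          iteratedFDeriv_char_apply, fourierChar_neg_fourierPairing, ← hconst]
        simp only [L, smul_eq_mul, fourierPairing_apply, Finset.prod_mul_distrib,
          Finset.prod_const, Finset.card_univ, Fintype.card_fin, Complex.real_smul]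
        push_cast
        ring

end Fourier

/-! ### The Fourier transform of an ultradistribution -/

section Parseval

variable {d : ℕ} {s t : ℝ}

/-- The character `e^{-i⟨·, ξ⟩}` as an element of `Gev d s`. -/
def charGev (hs : 0 < s) (ξ : Rd d) : Gev d s := ⟨char ξ, char_mem_gev hs ξ⟩

lemma norm_iteratedFDeriv_char_sub_one_le {δ : Rd d} (hδ : ‖δ‖ ≤ 1) (y : Rd d) (n : ℕ) :
    ‖iteratedFDeriv ℝ n (fun y => char δ y - 1) y‖ ≤ (1 + ‖y‖) * ‖δ‖ := by
  rcases n.eq_zero_or_pos with rfl | hn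
  · calc ‖iteratedFDeriv ℝ 0 (fun y => char δ y - 1) y‖ = ‖char δ y - 1‖ :=
          norm_iteratedFDeriv_zero
      _ ≤ ‖inner ℝ y δ‖ := by
          simpa only [char, neg_mul, Complex.ofReal_neg, mul_neg, norm_neg] using
            Real.norm_exp_I_mul_ofReal_sub_one_le (x := -inner ℝ y δ)
      _ ≤ ‖y‖ * ‖δ‖ := norm_inner_le_norm y δ
      _ ≤ (1 + ‖y‖) * ‖δ‖ := by gcongr; linarith
  · have hsub : iteratedFDeriv ℝ n (fun y => char δ y - 1) y = iteratedFDeriv ℝ n (char δ) y := by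
      rw [fun_iteratedFDeriv_sub_apply ((contDiff_char δ).of_le (mod_cast le_top)).contDiffAt
        contDiff_const.contDiffAt, iteratedFDeriv_const_of_ne hn.ne', Pi.zero_apply, sub_zero]
    calc ‖iteratedFDeriv ℝ n (fun y => char δ y - 1) y‖ ≤ ‖δ‖ ^ n :=
          hsub ▸ norm_iteratedFDeriv_char_le δ y n
      _ ≤ ‖δ‖ := pow_le_of_le_one (norm_nonneg δ) hδ hn.ne'
      _ ≤ (1 + ‖y‖) * ‖δ‖ := le_mul_of_one_le_left (norm_nonneg δ) (by simp)

lemma exists_norm_iteratedFDeriv_char_sub_le (hs : 0 < s) {h : ℝ} (hh : 0 < h) (ξ₀ : Rd d) :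
    ∃ C : ℝ, 0 ≤ C ∧ ∀ ξ : Rd d, ‖ξ - ξ₀‖ ≤ 1 → ∀ (n : ℕ) (y : Rd d),
      ‖iteratedFDeriv ℝ n (char ξ - char ξ₀) y‖ ≤
        C * (1 + ‖y‖) * ‖ξ - ξ₀‖ * (h ^ n * (n ! : ℝ) ^ s) := by
  obtain ⟨C₁, hC₁, hpow⟩ := exists_pow_le (norm_nonneg ξ₀) (half_pos hh) hs
  obtain ⟨C₂, hC₂, hone⟩ := exists_pow_le zero_le_one (half_pos hh) hs
  refine ⟨C₁ * C₂, by positivity, fun ξ hξ n y => ?_⟩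
  set δ := ξ - ξ₀ with hδ
  have hfactor : char ξ - char ξ₀ = fun y => char ξ₀ y * (char δ y - 1) := by
    funext y
    rw [Pi.sub_apply, mul_sub, mul_one, ← char_add, hδ, add_sub_cancel]
  have hchar : ∀ n : ℕ, ‖iteratedFDeriv ℝ n (char ξ₀) y‖ ≤
      C₁ * ((h / 2) ^ n * (n ! : ℝ) ^ s) := fun n =>
    (norm_iteratedFDeriv_char_le ξ₀ y n).trans (hpow n)
  have hsub : ∀ n : ℕ, ‖iteratedFDeriv ℝ n (fun y => char δ y - 1) y‖ ≤
      C₂ * (1 + ‖y‖) * ‖δ‖ * ((h / 2) ^ n * (n ! : ℝ) ^ s) := fun n => by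
    calc ‖iteratedFDeriv ℝ n (fun y => char δ y - 1) y‖
        ≤ (1 + ‖y‖) * ‖δ‖ * 1 ^ n := by
          simpa only [one_pow, mul_one] using norm_iteratedFDeriv_char_sub_one_le hξ y n
      _ ≤ (1 + ‖y‖) * ‖δ‖ * (C₂ * ((h / 2) ^ n * (n ! : ℝ) ^ s)) := by
          gcongr
          exact hone n
      _ = C₂ * (1 + ‖y‖) * ‖δ‖ * ((h / 2) ^ n * (n ! : ℝ) ^ s) := by ring
  have hmul := gevrey_mul_le hs.le (half_pos hh).le (contDiff_char ξ₀)
    ((contDiff_char δ).sub contDiff_const) y hchar hsub n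
  rw [mul_div_cancel₀ h two_ne_zero] at hmul
  rw [hfactor]
  exact hmul.trans_eq (by ring)

lemma norm_iteratedFDeriv_char_le_exp (hs : 0 < s) {h : ℝ} (hh : 0 < h) (ξ x : Rd d) (n : ℕ) :
    ‖iteratedFDeriv ℝ n (char ξ) x‖ ≤
      Real.exp (s * (1 / h) ^ (1 / s) * ‖ξ‖ ^ (1 / s)) * (h ^ n * (n ! : ℝ) ^ s) :=
  (norm_iteratedFDeriv_char_le ξ x n).trans
    ((pow_le_factorial_rpow_mul_exp hs hh (norm_nonneg ξ) n).trans_eq (mul_comm _ _))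

lemma GevDual.moderateGrowth_apply_charGev (hs : 0 < s) (v : GevDual d s) :
    ModerateGrowth s (fun ξ => v.toLin (charGev hs ξ)) := by
  obtain ⟨K, -, h, hh, C, hC0, hC⟩ := v.bounded
  exact ⟨s * (1 / h) ^ (1 / s), by positivity, C, hC0, fun ξ =>
    hC _ _ (Real.exp_pos _).le fun n x _ => norm_iteratedFDeriv_char_le_exp hs hh ξ x n⟩

lemma GevDual.continuous_apply_charGev (hs : 0 < s) (v : GevDual d s) :
    Continuous (fun ξ => v.toLin (charGev hs ξ)) := by
  obtain ⟨K, hK, h, hh, C, _, hC⟩ := v.bounded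
  obtain ⟨R, hR0, hR⟩ := hK.isBounded.exists_pos_norm_le
  refine continuous_iff_continuousAt.mpr fun ξ₀ => ?_
  obtain ⟨A, hA0, hA⟩ := exists_norm_iteratedFDeriv_char_sub_le hs hh ξ₀
  refine tendsto_iff_norm_sub_tendsto_zero.mpr
    (squeeze_zero' (.of_forall fun _ => norm_nonneg _) ?_ (tendsto_norm_sub_self ξ₀
      |>.const_mul (C * (A * (1 + R))) |>.trans_eq (by simp)))
  filter_upwards [Metric.ball_mem_nhds ξ₀ one_pos] with ξ hξ
  rw [← map_sub, mul_assoc C]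
  refine hC _ _ (by positivity) fun n x hx => (hA ξ (mem_ball_iff_norm.mp hξ).le n x).trans ?_
  gcongr
  exact hR x hx

/-- The derivative of order `p.1` at `y` in the directions `p.2`, divided by
`h^n n!^s` and by the lengths of the directions. These functionals separate the points of
`Gev d s`, and all of them together compute the norms that bound a `GevDual`. Division by `0`
gives `0` if a direction vanishes. -/
def normalizedDeriv (s h : ℝ) (y : Rd d) (p : Σ n : ℕ, Fin n → Rd d) : Gev d s →ₗ[ℂ] ℂ where
  toFun f := (((h ^ p.1 * (p.1! : ℝ) ^ s) * ∏ i, ‖p.2 i‖)⁻¹ : ℝ) *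
    iteratedFDeriv ℝ p.1 f.1 y p.2
  map_add' f g := by
    have hadd : iteratedFDeriv ℝ p.1 (f + g).1 y =
        iteratedFDeriv ℝ p.1 f.1 y + iteratedFDeriv ℝ p.1 g.1 y :=
      iteratedFDeriv_add_apply ((f.2.1.of_le (mod_cast le_top)).contDiffAt)
        ((g.2.1.of_le (mod_cast le_top)).contDiffAt)
    rw [hadd, add_apply, mul_add]
  map_smul' c f := by
    have hsmul : iteratedFDeriv ℝ p.1 (c • f).1 y = c • iteratedFDeriv ℝ p.1 f.1 y :=
      iteratedFDeriv_const_smul_apply ((f.2.1.of_le (mod_cast le_top)).contDiffAt)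
    rw [hsmul, smul_apply, smul_eq_mul, RingHom.id_apply, smul_eq_mul, mul_left_comm]

lemma normalizedDeriv_apply (h : ℝ) (y : Rd d) (p : Σ n : ℕ, Fin n → Rd d) (f : Gev d s) :
    normalizedDeriv s h y p f = (((h ^ p.1 * (p.1! : ℝ) ^ s) * ∏ i, ‖p.2 i‖)⁻¹ : ℝ) *
      iteratedFDeriv ℝ p.1 f.1 y p.2 := rfl

lemma norm_normalizedDeriv_le {h : ℝ} (hh : 0 < h) {y : Rd d} {f : Gev d s} {M : ℝ} (hM : 0 ≤ M)
    {p : Σ n : ℕ, Fin n → Rd d}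
    (hf : ‖iteratedFDeriv ℝ p.1 f.1 y‖ ≤ M * (h ^ p.1 * (p.1! : ℝ) ^ s)) :
    ‖normalizedDeriv s h y p f‖ ≤ M := by
  rw [normalizedDeriv_apply, norm_mul, Complex.norm_real, norm_inv,
    Real.norm_of_nonneg (by positivity)]
  refine inv_mul_le_of_le_mul₀ (by positivity) hM ?_
  rw [mul_assoc, mul_left_comm, ← mul_assoc, mul_left_comm, ← mul_assoc]
  refine ((iteratedFDeriv ℝ p.1 f.1 y).le_of_opNorm_le hf p.2).trans_eq (by ring)

lemma norm_iteratedFDeriv_le_of_norm_normalizedDeriv_le {h : ℝ} (hh : 0 < h) {y : Rd d}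
    {f : Gev d s} {M : ℝ} (hM : 0 ≤ M) (n : ℕ)
    (hf : ∀ m : Fin n → Rd d, ‖normalizedDeriv s h y ⟨n, m⟩ f‖ ≤ M) :
    ‖iteratedFDeriv ℝ n f.1 y‖ ≤ M * (h ^ n * (n ! : ℝ) ^ s) := by
  refine ContinuousMultilinearMap.opNorm_le_bound (by positivity) fun m => ?_
  by_cases hm : ∃ i, m i = 0
  · obtain ⟨i, hi⟩ := hm
    rw [ContinuousMultilinearMap.map_coord_zero _ i hi, norm_zero]
    positivity
  · push Not at hm
    have hprod : 0 < ∏ i, ‖m i‖ := Finset.prod_pos fun i _ => norm_pos_iff.mpr (hm i)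
    have hfm := hf m
    rw [normalizedDeriv_apply, norm_mul, Complex.norm_real, norm_inv,
      Real.norm_of_nonneg (by positivity), inv_mul_le_iff₀ (by positivity)] at hfm
    exact hfm.trans_eq (by ring)

lemma eventually_norm_normalizedDeriv_charGev_sub_le (hs : 0 < s) {h ε R : ℝ} (hh : 0 < h)
    (hR : 0 ≤ R) (ξ₀ : Rd d) (hε : 0 < ε) :
    ∀ᶠ ξ in nhds ξ₀, ∀ y : Rd d, ‖y‖ ≤ R → ∀ p,
      ‖normalizedDeriv s h y p (charGev hs ξ - charGev hs ξ₀)‖ ≤ ε := by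
  obtain ⟨A, hA0, hA⟩ := exists_norm_iteratedFDeriv_char_sub_le hs hh ξ₀
  have hδ : 0 < min 1 (ε / (A * (1 + R) + 1)) := by positivity
  filter_upwards [Metric.ball_mem_nhds ξ₀ hδ] with ξ hξ y hy p
  rw [mem_ball_iff_norm, lt_min_iff, lt_div_iff₀ (by positivity)] at hξ
  refine norm_normalizedDeriv_le hh hε.le ((hA ξ hξ.1.le p.1 y).trans ?_)
  gcongr
  calc A * (1 + ‖y‖) * ‖ξ - ξ₀‖ ≤ A * (1 + R) * ‖ξ - ξ₀‖ := by gcongr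
    _ ≤ ε := by linarith [hξ.2, norm_nonneg (ξ - ξ₀)]

lemma normalizedDeriv_eq_integral (hs : 0 < s) {a : Rd d → ℂ} (hac : Continuous a)
    (ha : RapidDecay s a) {f : Gev d s} (hf : f.1 = fun y => ∫ ξ, a ξ * char ξ y) (h : ℝ)
    (y : Rd d) (p : Σ n : ℕ, Fin n → Rd d) :
    normalizedDeriv s h y p f = ∫ ξ, a ξ * normalizedDeriv s h y p (charGev hs ξ) := by
  rw [normalizedDeriv_apply, hf, iteratedFDeriv_integral_mul_char hac.aestronglyMeasurable
    (ha.integrable_norm_pow_mul hs hac), ← integral_const_mul]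
  exact integral_congr_ae (.of_forall fun ξ => mul_left_comm _ _ _)

lemma GevDual.apply_eq_integral_mul_apply_charGev (hs : 0 < s) (v : GevDual d s) {a : Rd d → ℂ}
    (hac : Continuous a) (ha : RapidDecay s a) {f : Gev d s}
    (hf : f.1 = fun y => ∫ ξ, a ξ * char ξ y) :
    v.toLin f = ∫ ξ, a ξ * v.toLin (charGev hs ξ) := by
  obtain ⟨K, hK, h, hh, C, -, hC⟩ := v.bounded
  obtain ⟨R, hR0, hR⟩ := hK.isBounded.exists_pos_norm_le
  have hseminorm : ∀ g : Gev d s, ∃ M, ∀ i : K × Σ n : ℕ, Fin n → Rd d,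
      ‖normalizedDeriv s h i.1 i.2 g‖ ≤ M := fun g => by
    obtain ⟨M, hM⟩ := g.2.2 h hh
    exact ⟨M, fun i => norm_normalizedDeriv_le hh hM.nonneg (hM _ _)⟩
  have hint : Integrable fun ξ : Rd d =>
      ‖a ξ‖ * Real.exp (s * (1 / h) ^ (1 / s) * ‖ξ‖ ^ (1 / s)) :=
    (((moderateGrowth_exp (by positivity)).mul_rapidDecay ha.norm).integrable hs
      (by fun_prop (disch := positivity))).congr (.of_forall fun ξ => mul_comm _ _)
  exact map_integral_of_bounded (E := Gev d s) (F := charGev hs) (f₀ := f) volume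
    (fun i : K × Σ n : ℕ, Fin n → Rd d => normalizedDeriv s h i.1 i.2) hseminorm v.toLin C
    (fun g M hM hg => hC g M hM fun n x hx =>
      norm_iteratedFDeriv_le_of_norm_normalizedDeriv_le hh hM n fun m => hg (⟨x, hx⟩, ⟨n, m⟩))
    hac (fun ξ₀ ε hε => (eventually_norm_normalizedDeriv_charGev_sub_le hs hh hR0.le ξ₀ hε).mono
      fun ξ hξ i => hξ i.1 (hR _ i.1.2) i.2)
    (fun ξ => (Real.exp_pos _).le)
    (fun ξ i => norm_normalizedDeriv_le hh (Real.exp_pos _).le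
      (norm_iteratedFDeriv_char_le_exp hs hh ξ _ _))
    hint fun i => normalizedDeriv_eq_integral hs hac ha hf h i.1 i.2

end Parseval

section FourierSum

variable {d : ℕ} {s t : ℝ}

lemma GevDual.apply_eq_integral_mul_fourierInv (hs : 0 < s) (ht : 0 < t) (v : GevDual d s)
    (f : Sig d t s) :
    v.toLin ⟨f.1, Sig.mem_gev f⟩ =
      ∫ η, fourierConst d * v.toLin (charGev hs η) * fourierInv f.1 η := by
  have hcont : Continuous fun η => fourierConst d * fourierInv f.1 η :=
    (Sig.continuous_fourierInv ht f).const_mul _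
  rw [v.apply_eq_integral_mul_apply_charGev hs hcont
    ((Sig.rapidDecay_fourierInv hs ht f).const_mul (fourierConst d))]
  · simp only [mul_right_comm]
  · funext y
    simp only [Sig.eq_integral_fourierInv_mul_char hs ht f y, mul_assoc, integral_const_mul]

lemma Sig.integral_mul_eq_integral_fourierInv_mul (hs : 0 < s) (ht : 0 < t) (w f : Sig d t s) :
    ∫ x, w.1 x * f.1 x = ∫ η, fourierInv w.1 (-η) * fourierInv f.1 η := by
  have hleft : ∀ x, w.1 x * f.1 x =
      ∫ η, fourierConst d * (w.1 x * fourierInv f.1 η * char η x) := fun x => by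
    rw [integral_const_mul, Sig.eq_integral_fourierInv_mul_char hs ht f x, mul_left_comm]
    simp only [mul_assoc, integral_const_mul]
  have hright : ∀ η, fourierInv w.1 (-η) * fourierInv f.1 η =
      ∫ x, fourierConst d * (w.1 x * fourierInv f.1 η * char η x) := fun η => by
    rw [integral_const_mul, fourierInv_eq_char, neg_neg, mul_assoc, ← integral_mul_const]
    simp only [mul_right_comm]
  have hint : Integrable (fun p : Rd d × Rd d => w.1 p.1 * fourierInv f.1 p.2)
      (volume.prod volume) :=
    (Sig.integrable ht w).mul_prod (Sig.integrable_fourierInv hs ht f)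
  have hchar : Continuous fun p : Rd d × Rd d => char p.2 p.1 := by
    unfold char
    fun_prop
  simp only [hleft, hright]
  exact integral_integral_swap ((hint.mul_bdd (c := 1) hchar.aestronglyMeasurable
    (.of_forall fun p => (norm_char _ _).le)).const_mul (fourierConst d))

/-- The Fourier transform of `v + w` for `v ∈ E_s'` and `w ∈ Σ_t^s`. -/
def fourierSum (hs : 0 < s) (v : GevDual d s) (w : Sig d t s) (η : Rd d) : ℂ :=
  fourierConst d * v.toLin (charGev hs η) + fourierInv w.1 (-η)

lemma moderateGrowth_fourierSum (hs : 0 < s) (ht : 0 < t) (v : GevDual d s) (w : Sig d t s) :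
    ModerateGrowth s (fourierSum hs v w) :=
  ((v.moderateGrowth_apply_charGev hs).const_mul _).add
    (Sig.rapidDecay_fourierInv hs ht w).comp_neg.moderateGrowth

lemma continuous_fourierSum (hs : 0 < s) (ht : 0 < t) (v : GevDual d s) (w : Sig d t s) :
    Continuous (fourierSum hs v w) :=
  ((v.continuous_apply_charGev hs).const_mul _).add
    ((Sig.continuous_fourierInv ht w).comp continuous_neg)

lemma SigDual.HasDecomposition.hasFourierTransform {u : SigDual d t s} {v : GevDual d s}
    {w : Sig d t s} (hu : u.HasDecomposition v w) (hs : 0 < s) (ht : 0 < t) :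
    u.HasFourierTransform (fourierSum hs v w) := by
  refine ⟨continuous_fourierSum hs ht v w, fun f => ?_⟩
  have hf := Sig.rapidDecay_fourierInv hs ht f
  have hfc := Sig.continuous_fourierInv ht f
  have hvf : Integrable fun η =>
      fourierConst d * v.toLin (charGev hs η) * fourierInv f.1 η :=
    (((v.moderateGrowth_apply_charGev hs).const_mul _).mul_rapidDecay hf).integrable hs
      (((v.continuous_apply_charGev hs).const_mul _).mul hfc)
  have hwf : Integrable fun η => fourierInv w.1 (-η) * fourierInv f.1 η :=
    ((Sig.rapidDecay_fourierInv hs ht w).comp_neg.moderateGrowth.mul_rapidDecay hf).integrable hs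
      (((Sig.continuous_fourierInv ht w).comp continuous_neg).mul hfc)
  simp only [fourierSum, add_mul]
  refine ⟨hvf.add hwf, ?_⟩
  rw [hu, integral_add hvf hwf, v.apply_eq_integral_mul_fourierInv hs ht,
    Sig.integral_mul_eq_integral_fourierInv_mul hs ht]

end FourierSum

/-! ### The short-time Fourier transform -/

section Stft

variable {d : ℕ} {s t : ℝ}

lemma fourierInv_char_mul (f : Rd d → ℂ) (ξ η : Rd d) :
    fourierInv (fun y => char ξ y * f y) η = fourierInv f (η - ξ) := by
  have hchar : ∀ y, char (-(η - ξ)) y = char ξ y * char (-η) y := fun y => by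
    rw [neg_sub, sub_eq_add_neg, char_add]
  simp only [fourierInv_eq_char, hchar, mul_left_comm, mul_assoc]

lemma fourierInv_comp_sub (f : Rd d → ℂ) (x η : Rd d) :
    fourierInv (fun y => f (y - x)) η = char (-η) x * fourierInv f η := by
  have hshift : ∀ y, char (-η) (y + x) = char (-η) x * char (-η) y := fun y => by
    rw [char_comm, char_add, char_comm y, char_comm x, mul_comm]
  rw [fourierInv_eq_char, fourierInv_eq_char,
    ← integral_add_right_eq_self (fun y => f (y - x) * char (-η) y) x]
  simp only [add_sub_cancel_right, hshift, mul_left_comm _ (char (-η) x), integral_const_mul]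

lemma eq_of_fourierInv_eq {f g : Rd d → ℂ} (hfc : Continuous f) (hgc : Continuous g)
    (hf : Integrable f) (hg : Integrable g) (hfg : fourierInv f = fourierInv g) : f = g := by
  have hzero : fourierInv (f - g) = 0 := by
    funext x
    have hchar : ∀ {h : Rd d → ℂ}, Integrable h → Integrable fun y => h y * char (-x) y :=
      fun hh => hh.mul_bdd (c := 1) (continuous_char _).aestronglyMeasurable
        (.of_forall fun y => (norm_char _ _).le)
    have hx := congrFun hfg x
    rw [fourierInv_eq_char, fourierInv_eq_char] at hx
    simp only [fourierInv_eq_char, Pi.sub_apply, sub_mul]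
    rw [integral_sub (hchar hf) (hchar hg), mul_sub, hx, sub_self, Pi.zero_apply]
  funext y
  have hy := eq_integral_fourierInv_mul_char (hfc.sub hgc) (hf.sub hg)
    (hzero ▸ integrable_zero _ _ _) y
  simp only [hzero, Pi.zero_apply, zero_mul, integral_zero, mul_zero] at hy
  exact sub_eq_zero.mp hy

lemma fourierInv_mulChar_translate (hs : 0 < s) (ht : 0 < t) (f : Sig d t s) (x ξ η : Rd d) :
    fourierInv (Sig.mulChar hs (Sig.translate ht f x) ξ).1 η =
      char (ξ - η) x * fourierInv f.1 (η - ξ) := by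
  rw [← neg_sub η ξ, ← fourierInv_comp_sub, ← fourierInv_char_mul]
  rfl

lemma exists_fourierInv_conj_ne_zero (hs : 0 < s) (ht : 0 < t) {ψ : Sig d t s} (hψ : ψ ≠ 0) :
    ∃ ζ, fourierInv (Sig.conj ψ).1 ζ ≠ 0 := by
  by_contra! hzero
  refine hψ (Subtype.ext (funext fun x => (map_eq_zero (starRingEnd ℂ)).mp ?_))
  change (Sig.conj ψ).1 x = 0
  simp only [Sig.eq_integral_fourierInv_mul_char hs ht, hzero, zero_mul, integral_zero, mul_zero]

namespace SigDual.HasFourierTransform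

variable {u : SigDual d t s} {g g' : Rd d → ℂ} {ψ : Sig d t s}

lemma integrable_mul_window (hs : 0 < s) (ht : 0 < t) (hg : u.HasFourierTransform g)
    (ψ : Sig d t s) (ξ : Rd d) :
    Integrable fun η => g η * fourierInv (Sig.conj ψ).1 (η - ξ) := by
  refine (hg.2 (Sig.mulChar hs (Sig.translate ht (Sig.conj ψ) 0) ξ)).1.congr
    (.of_forall fun η => ?_)
  simp only [fourierInv_mulChar_translate, char, inner_zero_left, Complex.ofReal_zero, mul_zero,
    Complex.exp_zero, one_mul]

lemma stft_eq (hs : 0 < s) (ht : 0 < t) (hg : u.HasFourierTransform g) (ψ : Sig d t s)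
    (x ξ : Rd d) :
    u.stft ht hs ψ x ξ =
      char ξ x * fourierInv (fun η => g η * fourierInv (Sig.conj ψ).1 (η - ξ)) x := by
  have hchar : ∀ η, char (ξ - η) x = char ξ x * char (-x) η := fun η => by
    rw [sub_eq_add_neg, char_add, char_comm (-x), char_neg_left]
  rw [stft, (hg.2 _).2, fourierInv_eq_char, mul_left_comm, ← integral_const_mul (char ξ x)]
  simp only [fourierInv_mulChar_translate, hchar]
  congr 2 with η
  ring

lemma norm_stft_le (hs : 0 < s) (ht : 0 < t) (hg : u.HasFourierTransform g) {G : Rd d → ℝ}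
    (hG : Integrable G) (x ξ : Rd d)
    (hle : ∀ η, ‖g η‖ * ‖fourierInv (Sig.conj ψ).1 (η - ξ)‖ ≤ G η) :
    ‖u.stft ht hs ψ x ξ‖ ≤ ‖fourierConst d‖ * ∫ η, G η := by
  rw [hg.stft_eq hs ht, fourierInv_eq_char, norm_mul, norm_char, one_mul, norm_mul]
  gcongr
  refine norm_integral_le_of_norm_le hG (.of_forall fun η => ?_)
  rw [norm_mul, norm_mul, norm_char, mul_one]
  exact hle η

lemma fourierInv_mul_window_eq (hs : 0 < s) (ht : 0 < t) (hg : u.HasFourierTransform g)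
    (ψ : Sig d t s) (x ξ : Rd d) :
    fourierInv (fun η => g η * fourierInv (Sig.conj ψ).1 (η - ξ)) x =
      char (-ξ) x * u.stft ht hs ψ x ξ := by
  rw [hg.stft_eq hs ht, ← mul_assoc, char_neg_mul_char, one_mul]

lemma continuous_mul_window (ht : 0 < t) (hg : u.HasFourierTransform g) (ψ : Sig d t s)
    (ξ : Rd d) : Continuous fun η => g η * fourierInv (Sig.conj ψ).1 (η - ξ) :=
  hg.1.mul ((Sig.continuous_fourierInv ht _).comp (continuous_sub_right ξ))

lemma mul_window_eq (hs : 0 < s) (ht : 0 < t) (hg : u.HasFourierTransform g) {ξ : Rd d}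
    (hint : Integrable fun x => u.stft ht hs ψ x ξ) (η : Rd d) :
    g η * fourierInv (Sig.conj ψ).1 (η - ξ) =
      fourierConst d * ∫ x, char (-ξ) x * u.stft ht hs ψ x ξ * char x η := by
  have hint' : Integrable (fourierInv fun η => g η * fourierInv (Sig.conj ψ).1 (η - ξ)) := by
    refine (hint.bdd_mul (c := 1) (continuous_char (-ξ)).aestronglyMeasurable
      (.of_forall fun x => (norm_char _ _).le)).congr (.of_forall fun x => ?_)
    exact (hg.fourierInv_mul_window_eq hs ht ψ x ξ).symm
  simpa only [hg.fourierInv_mul_window_eq hs ht] using eq_integral_fourierInv_mul_char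
    (hg.continuous_mul_window ht ψ ξ) (hg.integrable_mul_window hs ht ψ ξ) hint' η

lemma unique (hs : 0 < s) (ht : 0 < t) (hψ : ψ ≠ 0) (hg : u.HasFourierTransform g)
    (hg' : u.HasFourierTransform g') : g = g' := by
  obtain ⟨ζ, hζ⟩ := exists_fourierInv_conj_ne_zero hs ht hψ
  funext η
  have hwindow : (fun η' => g η' * fourierInv (Sig.conj ψ).1 (η' - (η - ζ))) =
      fun η' => g' η' * fourierInv (Sig.conj ψ).1 (η' - (η - ζ)) := by
    refine eq_of_fourierInv_eq (hg.continuous_mul_window ht ψ _)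
      (hg'.continuous_mul_window ht ψ _) (hg.integrable_mul_window hs ht ψ _)
      (hg'.integrable_mul_window hs ht ψ _) (funext fun x => ?_)
    rw [hg.fourierInv_mul_window_eq hs ht, hg'.fourierInv_mul_window_eq hs ht]
  have hη := congrFun hwindow η
  rw [sub_sub_cancel] at hη
  exact mul_right_cancel₀ hζ hη

end SigDual.HasFourierTransform

lemma mul_norm_rpow_le (ht : 0 < t) {r : ℝ} (hr : 0 < r) (x y : Rd d) :
    r * ‖x‖ ^ (1 / t) ≤
      r * 2 ^ (1 / t) * ‖y‖ ^ (1 / t) + r * 2 ^ (1 / t) * ‖y - x‖ ^ (1 / t) := by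
  have htri : ‖x‖ ≤ ‖y‖ + ‖y - x‖ := by simpa only [sub_sub_cancel] using norm_sub_le y (y - x)
  calc r * ‖x‖ ^ (1 / t) ≤ r * (‖y‖ + ‖y - x‖) ^ (1 / t) := by gcongr
    _ ≤ r * (2 ^ (1 / t) * (‖y‖ ^ (1 / t) + ‖y - x‖ ^ (1 / t))) := by
        gcongr
        exact add_rpow_le_two_rpow_mul (norm_nonneg y) (norm_nonneg _) (by positivity)
    _ = _ := by ring

lemma GevDual.exists_norm_apply_mulChar_translate_le (hs : 0 < s) (ht : 0 < t) (v : GevDual d s)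
    (f : Sig d t s) :
    ∃ r₀ : ℝ, 0 < r₀ ∧ ∀ r : ℝ, 0 < r → ∃ C : ℝ, 0 ≤ C ∧ ∀ x ξ : Rd d,
      ‖v.toLin ⟨(Sig.mulChar hs (Sig.translate ht f x) ξ).1, Sig.mem_gev _⟩‖ ≤
        C * Real.exp (r₀ * ‖ξ‖ ^ (1 / s)) * Real.exp (-(r * ‖x‖ ^ (1 / t))) := by
  obtain ⟨K, hK, h, hh, C, hC, hv⟩ := v.bounded
  obtain ⟨R, hR⟩ := hK.isBounded.exists_norm_le
  refine ⟨s * (1 / (h / 2)) ^ (1 / s), by positivity, fun r hr => ?_⟩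
  set q : ℝ := r * 2 ^ (1 / t)
  obtain ⟨D, hD, hf⟩ :=
    Sig.exists_norm_iteratedFDeriv_le ht f (show 0 < q by positivity) (half_pos hh)
  refine ⟨C * (D * Real.exp (q * |R| ^ (1 / t))), by positivity, fun x ξ => ?_⟩
  have htrans : ∀ y ∈ K, ∀ n : ℕ, ‖iteratedFDeriv ℝ n (fun y => f.1 (y - x)) y‖ ≤
      D * Real.exp (q * |R| ^ (1 / t)) * Real.exp (-(r * ‖x‖ ^ (1 / t))) *
        ((h / 2) ^ n * (n ! : ℝ) ^ s) := fun y hy n => by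
    have hy' : ‖y‖ ^ (1 / t) ≤ |R| ^ (1 / t) :=
      Real.rpow_le_rpow (norm_nonneg y) ((hR y hy).trans (le_abs_self R)) (by positivity)
    rw [iteratedFDeriv_comp_sub]
    refine (hf n (y - x)).trans ?_
    rw [mul_assoc D (Real.exp (q * |R| ^ (1 / t))), ← Real.exp_add]
    gcongr D * Real.exp ?_ * _
    linarith [mul_norm_rpow_le ht hr x y,
      mul_le_mul_of_nonneg_left hy' (show 0 ≤ q by positivity)]
  refine (hv _ _ (by positivity) fun n y hy => ?_).trans_eq
    (b := C * (Real.exp (s * (1 / (h / 2)) ^ (1 / s) * ‖ξ‖ ^ (1 / s)) *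
      (D * Real.exp (q * |R| ^ (1 / t)) * Real.exp (-(r * ‖x‖ ^ (1 / t)))))) (by ring)
  have hmul := gevrey_mul_le hs.le (half_pos hh).le (contDiff_char ξ)
    (Sig.translate ht f x).2.1 y
    (fun n => norm_iteratedFDeriv_char_le_exp hs (half_pos hh) ξ y n) (htrans y hy) n
  rwa [mul_div_cancel₀ h two_ne_zero] at hmul

lemma Sig.exists_norm_integral_mul_translate_le (hs : 0 < s) (ht : 0 < t) (w f : Sig d t s)
    {r : ℝ} (hr : 0 < r) :
    ∃ C : ℝ, 0 ≤ C ∧ ∀ x ξ : Rd d,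
      ‖∫ y, w.1 y * (Sig.mulChar hs (Sig.translate ht f x) ξ).1 y‖ ≤
        C * Real.exp (-(r * ‖x‖ ^ (1 / t))) := by
  set q : ℝ := r * 2 ^ (1 / t)
  have hq : 0 < q := by positivity
  obtain ⟨A, hA, hw⟩ :=
    Sig.exists_norm_iteratedFDeriv_le ht w (show 0 < q + 1 by positivity) one_pos
  obtain ⟨D, hD, hf⟩ := Sig.exists_norm_iteratedFDeriv_le ht f hq one_pos
  refine ⟨A * D * ∫ y : Rd d, Real.exp (-(1 * ‖y‖ ^ (1 / t))), by positivity, fun x ξ => ?_⟩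
  have hpoint : ∀ y, ‖w.1 y * (Sig.mulChar hs (Sig.translate ht f x) ξ).1 y‖ ≤
      A * D * (Real.exp (-(1 * ‖y‖ ^ (1 / t))) * Real.exp (-(r * ‖x‖ ^ (1 / t)))) := fun y => by
    have hwy : ‖w.1 y‖ ≤ A * Real.exp (-((q + 1) * ‖y‖ ^ (1 / t))) := by simpa using hw 0 y
    have hfy : ‖f.1 (y - x)‖ ≤ D * Real.exp (-(q * ‖y - x‖ ^ (1 / t))) := by
      simpa using hf 0 (y - x)
    change ‖w.1 y * (char ξ y * f.1 (y - x))‖ ≤ _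
    rw [norm_mul, norm_mul, norm_char, one_mul]
    calc ‖w.1 y‖ * ‖f.1 (y - x)‖
        ≤ A * Real.exp (-((q + 1) * ‖y‖ ^ (1 / t))) *
            (D * Real.exp (-(q * ‖y - x‖ ^ (1 / t)))) := by gcongr
      _ = A * D * Real.exp (-((q + 1) * ‖y‖ ^ (1 / t)) + -(q * ‖y - x‖ ^ (1 / t))) := by
          rw [Real.exp_add, mul_mul_mul_comm]
      _ ≤ A * D * Real.exp (-(1 * ‖y‖ ^ (1 / t)) + -(r * ‖x‖ ^ (1 / t))) := by
          gcongr A * D * Real.exp ?_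
          linarith [mul_norm_rpow_le ht hr x y]
      _ = _ := by rw [Real.exp_add]
  refine (norm_integral_le_of_norm_le (((integrable_exp_neg_norm_rpow ht one_pos).mul_const
    _).const_mul _) (.of_forall hpoint)).trans_eq ?_
  rw [integral_const_mul, integral_mul_const, mul_assoc (A * D)]

namespace SigDual.HasDecomposition

variable {u : SigDual d t s} {v : GevDual d s} {w ψ : Sig d t s}

lemma exists_norm_stft_le (hu : u.HasDecomposition v w) (hs : 0 < s) (ht : 0 < t)
    (ψ : Sig d t s) :
    ∃ r₀ : ℝ, 0 < r₀ ∧ ∀ r : ℝ, 0 < r → ∃ C : ℝ, 0 ≤ C ∧ ∀ x ξ : Rd d,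
      ‖u.stft ht hs ψ x ξ‖ ≤
        C * Real.exp (r₀ * ‖ξ‖ ^ (1 / s)) * Real.exp (-(r * ‖x‖ ^ (1 / t))) := by
  obtain ⟨r₀, hr₀, hv⟩ := v.exists_norm_apply_mulChar_translate_le hs ht (Sig.conj ψ)
  refine ⟨r₀, hr₀, fun r hr => ?_⟩
  obtain ⟨A, hA, hvA⟩ := hv r hr
  obtain ⟨B, hB, hwB⟩ := Sig.exists_norm_integral_mul_translate_le hs ht w (Sig.conj ψ) hr
  refine ⟨‖fourierConst d‖ * (A + B), by positivity, fun x ξ => ?_⟩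
  set E := Real.exp (r₀ * ‖ξ‖ ^ (1 / s))
  set X := Real.exp (-(r * ‖x‖ ^ (1 / t)))
  have hE : 1 ≤ E := Real.one_le_exp (by positivity)
  rw [SigDual.stft, hu, norm_mul]
  calc _ ≤ ‖fourierConst d‖ * (A * E * X + B * X) := by
        gcongr
        exact (norm_add_le _ _).trans (add_le_add (hvA x ξ) (hwB x ξ))
    _ ≤ ‖fourierConst d‖ * (A * E * X + B * X * E) := by
        gcongr _ * (_ + ?_)
        exact le_mul_of_one_le_right (by positivity) hE
    _ = _ := by ring

lemma integrable_stft (hu : u.HasDecomposition v w) (hs : 0 < s) (ht : 0 < t) (ψ : Sig d t s)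
    (ξ : Rd d) : Integrable fun x => u.stft ht hs ψ x ξ := by
  obtain ⟨r₀, -, hdecay⟩ := hu.exists_norm_stft_le hs ht ψ
  obtain ⟨C, -, hC⟩ := hdecay 1 one_pos
  have hF := hu.hasFourierTransform hs ht
  have hcont : Continuous fun x => u.stft ht hs ψ x ξ := by
    simp only [hF.stft_eq hs ht]
    exact (continuous_char ξ).mul (continuous_fourierInv (hF.integrable_mul_window hs ht ψ ξ))
  exact ((integrable_exp_neg_norm_rpow ht one_pos).const_mul
    (C * Real.exp (r₀ * ‖ξ‖ ^ (1 / s)))).mono' hcont.aestronglyMeasurable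
      (.of_forall fun x => hC x ξ)

end SigDual.HasDecomposition

end Stft

/-! ### Decay on cones -/

section Cones

open scoped Pointwise

variable {d : ℕ} {s : ℝ} {ι : Type*}

/-- The open cone generated by the ball of radius `δ` around `η`. -/
def coneAt (η : Rd d) (δ : ℝ) : Set (Rd d) := Set.Ioi (0 : ℝ) • Metric.ball η δ

lemma isOpenConic_coneAt {η : Rd d} {δ : ℝ} (hδ : δ ≤ ‖η‖) : IsOpenConic (coneAt η δ) := by
  refine ⟨?_, ?_, ?_⟩
  · rw [coneAt, ← Set.iUnion_smul_set]
    exact isOpen_biUnion fun ν hν => Metric.isOpen_ball.smul₀ (ne_of_gt hν)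
  · rintro ⟨ν, hν, z, hz, hνz⟩
    obtain rfl : z = 0 := (smul_eq_zero.mp hνz).resolve_left (ne_of_gt hν)
    rw [Metric.mem_ball, dist_zero_left] at hz
    exact hz.not_ge hδ
  · rintro _ ⟨ν, hν, z, hz, rfl⟩ a ha
    exact ⟨a * ν, mul_pos ha hν, z, hz, mul_smul a ν z⟩

lemma mem_coneAt_self {η : Rd d} {δ : ℝ} (hδ : 0 < δ) : η ∈ coneAt η δ :=
  ⟨1, Set.mem_Ioi.mpr one_pos, η, Metric.mem_ball_self hδ, one_smul ℝ η⟩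

lemma IsOpenConic.exists_subcone {Γ : Set (Rd d)} (hΓ : IsOpenConic Γ) {η₀ : Rd d}
    (hη₀ : η₀ ∈ Γ) :
    ∃ Γ' : Set (Rd d), IsOpenConic Γ' ∧ η₀ ∈ Γ' ∧ ∃ δ : ℝ, 0 < δ ∧ ∀ ξ ∈ Γ', ∀ η : Rd d,
      (η ∈ Γ ∧ δ * ‖ξ‖ ≤ ‖η‖) ∨ δ * ‖ξ‖ ≤ ‖η - ξ‖ := by
  obtain ⟨hopen, h0, hcone⟩ := hΓ
  have hη₀_pos : 0 < ‖η₀‖ := norm_pos_iff.mpr fun h => h0 (h ▸ hη₀)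
  obtain ⟨ρ, hρ, hball⟩ := Metric.isOpen_iff.mp hopen η₀ hη₀
  set ε : ℝ := min (ρ / 2) (‖η₀‖ / 4)
  have hε : 0 < ε := by positivity
  have hερ : 2 * ε ≤ ρ := by linarith [min_le_left (ρ / 2) (‖η₀‖ / 4)]
  have hεη₀ : 4 * ε ≤ ‖η₀‖ := by linarith [min_le_right (ρ / 2) (‖η₀‖ / 4)]
  refine ⟨coneAt η₀ ε, isOpenConic_coneAt (by linarith), mem_coneAt_self hε,
    ε / (‖η₀‖ + ε), by positivity, ?_⟩
  have near_or_far : ∀ z ∈ Metric.ball η₀ ε, ∀ y : Rd d,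
      (y ∈ Γ ∧ ε / (‖η₀‖ + ε) * ‖z‖ ≤ ‖y‖) ∨ ε / (‖η₀‖ + ε) * ‖z‖ ≤ ‖y - z‖ := by
    intro z hz y
    rw [mem_ball_iff_norm] at hz
    have hzε : ε / (‖η₀‖ + ε) * ‖z‖ ≤ ε := by
      rw [div_mul_eq_mul_div, div_le_iff₀ (by positivity)]
      exact mul_le_mul_of_nonneg_left (by linarith [norm_sub_norm_le z η₀]) hε.le
    rcases lt_or_ge ‖y - z‖ ε with hyz | hyz
    · have hy : ‖y - η₀‖ < 2 * ε := by linarith [norm_sub_le_norm_sub_add_norm_sub y z η₀]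
      refine .inl ⟨hball (mem_ball_iff_norm.mpr (hy.trans_le hερ)), hzε.trans ?_⟩
      linarith [norm_sub_norm_le η₀ y, norm_sub_rev η₀ y]
    · exact .inr (hzε.trans hyz)
  rintro _ ⟨ν, hν : 0 < ν, z, hz, rfl⟩ η
  beta_reduce
  obtain ⟨y, rfl⟩ : ∃ y, η = ν • y := ⟨ν⁻¹ • η, (smul_inv_smul₀ hν.ne' η).symm⟩
  have hν' : 0 < ‖ν‖ := norm_pos_iff.mpr hν.ne'
  rw [← smul_sub, norm_smul, norm_smul, norm_smul, mul_left_comm, mul_le_mul_iff_of_pos_left hν',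
    mul_le_mul_iff_of_pos_left hν']
  exact (near_or_far z hz y).imp_left (.imp_left fun hy => hcone y hy ν hν)

lemma exists_isOpenConic_biInter (T : Finset ι) {Γ : ι → Set (Rd d)}
    (hΓ : ∀ i, IsOpenConic (Γ i)) {η : Rd d} (hη : ∀ i, η ∈ Γ i) (hη_ne : η ≠ 0) :
    ∃ Γ' : Set (Rd d), IsOpenConic Γ' ∧ η ∈ Γ' ∧ ∀ i ∈ T, Γ' ⊆ Γ i := by
  have hcone : IsOpenConic (coneAt η ‖η‖) := isOpenConic_coneAt le_rfl
  refine ⟨coneAt η ‖η‖ ∩ ⋂ i ∈ T, Γ i, ⟨?_, fun h => hcone.2.1 h.1, fun ξ hξ a ha => ?_⟩, ?_, ?_⟩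
  · exact hcone.1.inter (isOpen_biInter_finset fun i _ => (hΓ i).1)
  · simp only [Set.mem_inter_iff, Set.mem_iInter] at hξ ⊢
    exact ⟨hcone.2.2 ξ hξ.1 a ha, fun i hi => (hΓ i).2.2 ξ (hξ.2 i hi) a ha⟩
  · exact ⟨mem_coneAt_self (norm_pos_iff.mpr hη_ne), Set.mem_iInter₂.mpr fun i _ => hη i⟩
  · exact fun i hi => Set.inter_subset_right.trans (Set.biInter_subset_of_mem hi)

lemma exp_mul_le_iff {a b c : ℝ} : Real.exp a * b ≤ c ↔ b ≤ c * Real.exp (-a) := by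
  rw [Real.exp_neg, ← div_eq_mul_inv, le_div_iff₀' (Real.exp_pos _)]

lemma decaysOn_iff {g : Rd d → ℂ} {Γ : Set (Rd d)} : DecaysOn s g Γ ↔
    ∀ r : ℝ, 0 < r → ∃ C : ℝ, 0 ≤ C ∧ ∀ ξ ∈ Γ, ‖g ξ‖ ≤ C * Real.exp (-(r * ‖ξ‖ ^ (1 / s))) := by
  refine forall₂_congr fun r _ => ⟨?_, ?_⟩
  · rintro ⟨C, hC⟩
    exact ⟨max C 0, le_max_right _ _, fun ξ hξ =>
      exp_mul_le_iff.mp ((hC ξ hξ).trans (le_max_left _ _))⟩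
  · rintro ⟨C, -, hC⟩
    exact ⟨C, fun ξ hξ => exp_mul_le_iff.mpr (hC ξ hξ)⟩

lemma RapidDecay.decaysOn {g : Rd d → ℂ} (hg : RapidDecay s g) (Γ : Set (Rd d)) :
    DecaysOn s g Γ :=
  decaysOn_iff.mpr fun r hr => (hg r hr).imp fun _ hC => hC.imp_right fun hC ξ _ => hC ξ

lemma DecaysOn.mono {g : Rd d → ℂ} {Γ Γ' : Set (Rd d)} (hg : DecaysOn s g Γ) (h : Γ' ⊆ Γ) :
    DecaysOn s g Γ' :=
  fun r hr => (hg r hr).imp fun _ hC ξ hξ => hC ξ (h hξ)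

lemma DecaysOn.add {f g : Rd d → ℂ} {Γ : Set (Rd d)} (hf : DecaysOn s f Γ)
    (hg : DecaysOn s g Γ) : DecaysOn s (fun ξ => f ξ + g ξ) Γ := fun r hr => by
  obtain ⟨A, hA⟩ := hf r hr
  obtain ⟨B, hB⟩ := hg r hr
  refine ⟨A + B, fun ξ hξ => ?_⟩
  calc Real.exp (r * ‖ξ‖ ^ (1 / s)) * ‖f ξ + g ξ‖
      ≤ Real.exp (r * ‖ξ‖ ^ (1 / s)) * (‖f ξ‖ + ‖g ξ‖) := by gcongr; exact norm_add_le _ _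
    _ ≤ A + B := by rw [mul_add]; exact add_le_add (hA ξ hξ) (hB ξ hξ)

lemma DecaysOn.const_mul {f : Rd d → ℂ} {Γ : Set (Rd d)} (c : ℂ) (hf : DecaysOn s f Γ) :
    DecaysOn s (fun ξ => c * f ξ) Γ := fun r hr => by
  obtain ⟨A, hA⟩ := hf r hr
  refine ⟨‖c‖ * A, fun ξ hξ => ?_⟩
  rw [norm_mul, mul_left_comm]
  exact mul_le_mul_of_nonneg_left (hA ξ hξ) (norm_nonneg c)

lemma DecaysOn.sum (T : Finset ι) {f : ι → Rd d → ℂ} {Γ : Set (Rd d)}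
    (hf : ∀ i ∈ T, DecaysOn s (f i) Γ) : DecaysOn s (fun ξ => ∑ i ∈ T, f i ξ) Γ := by
  classical
  induction T using Finset.induction_on with
  | empty => exact fun r _ => ⟨0, fun ξ _ => by simp⟩
  | insert i T hi ih =>
    simp only [Finset.sum_insert hi]
    exact (hf i (Finset.mem_insert_self i T)).add
      (ih fun j hj => hf j (Finset.mem_insert_of_mem hj))

lemma mul_rpow_le_div_rpow_mul {a b δ r p : ℝ} (ha : 0 ≤ a) (hδ : 0 < δ) (hr : 0 ≤ r)
    (hp : 0 ≤ p) (h : δ * a ≤ b) : r * a ^ p ≤ r / δ ^ p * b ^ p := by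
  rw [div_mul_eq_mul_div, le_div_iff₀ (by positivity), mul_assoc, mul_comm (a ^ p),
    ← Real.mul_rpow hδ.le ha]
  gcongr

lemma exists_norm_mul_le_of_decaysOn (hs : 0 < s) {B Ψ : Rd d → ℂ} {Γ : Set (Rd d)}
    (hB : DecaysOn s B Γ) (hΨ : RapidDecay s Ψ) {δ r : ℝ} (hδ : 0 < δ) (hr : 0 < r) :
    ∃ C : ℝ, 0 ≤ C ∧ ∀ ξ : Rd d, ∀ η ∈ Γ, δ * ‖ξ‖ ≤ ‖η‖ → ‖B η‖ * ‖Ψ (η - ξ)‖ ≤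
      C * (Real.exp (-(r * ‖ξ‖ ^ (1 / s))) * Real.exp (-(1 * ‖η - ξ‖ ^ (1 / s)))) := by
  obtain ⟨C, hC0, hC⟩ := decaysOn_iff.mp hB (r / δ ^ (1 / s)) (by positivity)
  obtain ⟨D, hD0, hD⟩ := hΨ 1 one_pos
  refine ⟨C * D, by positivity, fun ξ η hη hle => ?_⟩
  have hpow := mul_rpow_le_div_rpow_mul (norm_nonneg ξ) hδ hr.le (p := 1 / s) (by positivity) hle
  calc ‖B η‖ * ‖Ψ (η - ξ)‖
      ≤ (C * Real.exp (-(r * ‖ξ‖ ^ (1 / s)))) * (D * Real.exp (-(1 * ‖η - ξ‖ ^ (1 / s)))) := by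
        refine mul_le_mul ((hC η hη).trans ?_) (hD _) (norm_nonneg _) (by positivity)
        gcongr
    _ = _ := by ring

lemma exists_norm_mul_le_of_moderateGrowth (hs : 0 < s) {B Ψ : Rd d → ℂ}
    (hB : ModerateGrowth s B) (hΨ : RapidDecay s Ψ) {δ r : ℝ} (hδ : 0 < δ) (hr : 0 < r) :
    ∃ C : ℝ, 0 ≤ C ∧ ∀ ξ η : Rd d, δ * ‖ξ‖ ≤ ‖η - ξ‖ → ‖B η‖ * ‖Ψ (η - ξ)‖ ≤
      C * (Real.exp (-(r * ‖ξ‖ ^ (1 / s))) * Real.exp (-(1 * ‖η - ξ‖ ^ (1 / s)))) := by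
  obtain ⟨r₀, hr₀, A, hA0, hA⟩ := hB
  set q : ℝ := r₀ / (δ / (1 + δ)) ^ (1 / s) + r / δ ^ (1 / s) + 1 with hq
  obtain ⟨D, hD0, hD⟩ := hΨ q (by positivity)
  refine ⟨A * D, by positivity, fun ξ η hle => ?_⟩
  have hηle : δ / (1 + δ) * ‖η‖ ≤ ‖η - ξ‖ := by
    rw [div_mul_eq_mul_div, div_le_iff₀ (by positivity)]
    nlinarith [norm_sub_norm_le η ξ]
  have hη := mul_rpow_le_div_rpow_mul (norm_nonneg η) (by positivity) hr₀.le (p := 1 / s)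
    (by positivity) hηle
  have hξ := mul_rpow_le_div_rpow_mul (norm_nonneg ξ) hδ hr.le (p := 1 / s) (by positivity) hle
  calc ‖B η‖ * ‖Ψ (η - ξ)‖
      ≤ (A * Real.exp (r₀ * ‖η‖ ^ (1 / s))) * (D * Real.exp (-(q * ‖η - ξ‖ ^ (1 / s)))) :=
        mul_le_mul (hA η) (hD _) (norm_nonneg _) (by positivity)
    _ = A * D * Real.exp (r₀ * ‖η‖ ^ (1 / s) + -(q * ‖η - ξ‖ ^ (1 / s))) := by
        rw [Real.exp_add]
        ring
    _ ≤ A * D * Real.exp (-(r * ‖ξ‖ ^ (1 / s)) + -(1 * ‖η - ξ‖ ^ (1 / s))) := by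
        gcongr A * D * Real.exp ?_
        rw [hq, add_mul, add_mul]
        linarith
    _ = _ := by rw [Real.exp_add]

lemma IsOpenConic.exists_convolution_bound (hs : 0 < s) {Γ : Set (Rd d)} (hΓ : IsOpenConic Γ)
    {η₀ : Rd d} (hη₀ : η₀ ∈ Γ) :
    ∃ Γ' : Set (Rd d), IsOpenConic Γ' ∧ η₀ ∈ Γ' ∧ ∀ B Ψ : Rd d → ℂ, ModerateGrowth s B →
      DecaysOn s B Γ → RapidDecay s Ψ → ∀ r : ℝ, 0 < r → ∃ C : ℝ, 0 ≤ C ∧ ∀ ξ ∈ Γ', ∀ η : Rd d,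
        ‖B η‖ * ‖Ψ (η - ξ)‖ ≤
          C * (Real.exp (-(r * ‖ξ‖ ^ (1 / s))) * Real.exp (-(1 * ‖η - ξ‖ ^ (1 / s)))) := by
  obtain ⟨Γ', hΓ', hη₀', δ, hδ, hsep⟩ := hΓ.exists_subcone hη₀
  refine ⟨Γ', hΓ', hη₀', fun B Ψ hB hBΓ hΨ r hr => ?_⟩
  obtain ⟨C, hC0, hC⟩ := exists_norm_mul_le_of_decaysOn hs hBΓ hΨ hδ hr
  obtain ⟨D, -, hD⟩ := exists_norm_mul_le_of_moderateGrowth hs hB hΨ hδ hr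
  refine ⟨max C D, hC0.trans (le_max_left _ _), fun ξ hξ η => ?_⟩
  rcases hsep ξ hξ η with ⟨hη, hle⟩ | hle
  · refine (hC ξ η hη hle).trans ?_
    gcongr
    exact le_max_left _ _
  · refine (hD ξ η hle).trans ?_
    gcongr
    exact le_max_right _ _

end Cones

/-! ### From the Gevrey wave front set to directions of decay -/

section LocalDecay

variable {d : ℕ} {s t : ℝ} {ι : Type*}

/-- The product `a v` of a compactly supported ultradistribution with a Gevrey function. -/
def GevDual.mul (hs : 0 ≤ s) (v : GevDual d s) (a : Gev d s) : GevDual d s where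
  toLin := v.toLin ∘ₗ
    { toFun := fun f => ⟨fun x => f.1 x * a.1 x, mul_mem_gev hs f.2 a.2⟩
      map_add' := fun f g => Subtype.ext (funext fun x => add_mul (f.1 x) (g.1 x) (a.1 x))
      map_smul' := fun c f => Subtype.ext (funext fun x => mul_assoc c (f.1 x) (a.1 x)) }
  bounded := by
    obtain ⟨K, hK, h, hh, C, hC0, hC⟩ := v.bounded
    obtain ⟨N, hN⟩ := a.2.2 (h / 2) (by positivity)
    have hN0 := hN.nonneg
    refine ⟨K, hK, h / 2, by positivity, C * N, by positivity, fun f M hM0 hM => ?_⟩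
    refine (hC ⟨fun x => f.1 x * a.1 x, mul_mem_gev hs f.2 a.2⟩ (M * N) (by positivity)
      fun n x hx => ?_).trans_eq (by ring)
    simpa only [mul_div_cancel₀ h two_ne_zero] using
      gevrey_mul_le hs (by positivity) f.2.1 a.2.1 x (fun n => hM n x hx) (fun n => hN n x) n

lemma GevDual.exists_apply_eq_of_eqOn (v : GevDual d s) : ∃ R : ℝ, 1 ≤ R ∧
    ∀ f g : Gev d s, Set.EqOn f.1 g.1 (Metric.ball 0 R) → v.toLin f = v.toLin g := by
  obtain ⟨K, hK, h, -, C, -, hC⟩ := v.bounded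
  obtain ⟨R, hR⟩ := hK.isBounded.subset_ball 0
  refine ⟨max 1 R, le_max_left _ _, fun f g hfg => ?_⟩
  rw [← sub_eq_zero, ← map_sub, ← norm_le_zero_iff, ← mul_zero C]
  refine hC _ 0 le_rfl fun n x hx => ?_
  have hzero : (f - g).1 =ᶠ[nhds x] fun _ => 0 := by
    have hxR : x ∈ Metric.ball 0 (max 1 R) := Metric.ball_subset_ball (le_max_right 1 R) (hR hx)
    filter_upwards [Metric.isOpen_ball.mem_nhds hxR] with y hy
    exact sub_eq_zero.mpr (hfg hy)
  rw [(hzero.iteratedFDeriv ℝ n).eq_of_nhds, iteratedFDeriv_fun_zero, Pi.zero_apply, norm_zero,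
    zero_mul]

lemma exists_pos_forall_le_of_isCompact {X : Type*} [TopologicalSpace X] {F : X → ℝ}
    (hF : Continuous F) (hpos : ∀ x, 0 < F x) {K : Set X} (hK : IsCompact K)
    (hK' : ∀ x ∉ K, 1 ≤ F x) : ∃ c : ℝ, 0 < c ∧ ∀ x, c ≤ F x := by
  obtain ⟨c, hc, hcK⟩ := hK.exists_forall_le' hF.continuousOn (a := 0) fun x _ => hpos x
  refine ⟨min c 1, by positivity, fun x => ?_⟩
  by_cases hx : x ∈ K
  · exact (min_le_left _ _).trans (hcK x hx)
  · exact (min_le_right _ _).trans (hK' x hx)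

lemma norm_sq_mem_gev (hs : 0 ≤ s) {f : Rd d → ℂ} (hf : f ∈ Gev d s) :
    (fun y => (‖f y‖ : ℂ) ^ 2) ∈ Gev d s := by
  simpa only [Complex.mul_conj'] using mul_mem_gev hs hf (conj_mem_gev hf)

/-- The functions `ϕ i` may be divided by `∑ |ϕ i|² + |1 - χ|²`, which is bounded below. -/
lemma exists_sum_mul_eq_one (hs : 1 < s) (χ : GevreyC d s) (T : Finset ι) (ϕ : ι → GevreyC d s)
    (hcover : ∀ y ∈ tsupport χ.1, ∃ i ∈ T, (ϕ i).1 y ≠ 0) :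
    ∃ θ : ι → GevreyC d s, ∀ y, χ.1 y = 1 → ∑ i ∈ T, (θ i).1 y * (ϕ i).1 y = 1 := by
  have hs0 : 0 ≤ s := by linarith
  set F : Rd d → ℝ := fun y => ∑ i ∈ T, ‖(ϕ i).1 y‖ ^ 2 + ‖1 - χ.1 y‖ ^ 2 with hF
  have hFoff : ∀ y ∉ tsupport χ.1, 1 ≤ F y := fun y hy => by
    simp only [hF, image_eq_zero_of_notMem_tsupport hy, sub_zero, norm_one, one_pow]
    exact le_add_of_nonneg_left (by positivity)
  have hFpos : ∀ y, 0 < F y := fun y => by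
    by_cases hy : y ∈ tsupport χ.1
    · obtain ⟨i, hi, hne⟩ := hcover y hy
      have hi_pos : 0 < ‖(ϕ i).1 y‖ ^ 2 := by positivity
      exact add_pos_of_pos_of_nonneg
        (Finset.sum_pos' (fun _ _ => by positivity) ⟨i, hi, hi_pos⟩) (by positivity)
    · exact zero_lt_one.trans_le (hFoff y hy)
  have hFcont : Continuous F :=
    (continuous_finsetSum _ fun i _ => (ϕ i).2.1.continuous.norm.pow 2).add
      ((continuous_const.sub χ.2.1.continuous).norm.pow 2)
  obtain ⟨c, hc, hcF⟩ := exists_pos_forall_le_of_isCompact hFcont hFpos χ.2.2.1 hFoff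
  have hFmem : (fun y => (F y : ℂ)) ∈ Gev d s := by
    have hsum := (Gev d s).sum_mem (t := T) fun i _ =>
      norm_sq_mem_gev hs0 (GevreyC.mem_gev (ϕ i))
    have hχ : (fun y => 1 - χ.1 y) ∈ Gev d s :=
      (Gev d s).sub_mem (const_mem_gev 1) (GevreyC.mem_gev χ)
    convert (Gev d s).add_mem hsum (norm_sq_mem_gev hs0 hχ) using 1
    funext y
    simp [hF]
  have hFinv : (fun y => (F y : ℂ)⁻¹) ∈ Gev d s := inv_mem_gev hs hc hFmem fun y => by
    rw [Complex.norm_real, Real.norm_of_nonneg (hFpos y).le]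
    exact hcF y
  have hconj : ∀ i, (fun y => conj ((ϕ i).1 y)) ∈ GevreyC d s := fun i =>
    ⟨contDiff_conj (ϕ i).2.1, (ϕ i).2.2.1.comp_left (map_zero _),
      (conj_mem_gev (GevreyC.mem_gev (ϕ i))).2⟩
  refine ⟨fun i => ⟨_, mul_mem_gevreyC hs0 hFinv ⟨_, hconj i⟩⟩, fun y hy => ?_⟩
  have hFy : (F y : ℂ) = ∑ i ∈ T, conj ((ϕ i).1 y) * (ϕ i).1 y := by
    simp [hF, hy, Complex.conj_mul']
  change ∑ i ∈ T, (F y : ℂ)⁻¹ * conj ((ϕ i).1 y) * (ϕ i).1 y = 1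
  simp only [mul_assoc]
  rw [← Finset.mul_sum, ← hFy, inv_mul_cancel₀ (Complex.ofReal_ne_zero.mpr (hFpos y).ne')]

lemma GevDual.exists_apply_eq_sum (hs : 1 < s) (v : GevDual d s) {ϕ : Rd d → GevreyC d s}
    (hϕ : ∀ x, (ϕ x).1 x ≠ 0) : ∃ (T : Finset (Rd d)) (θ : Rd d → GevreyC d s), ∀ f : Gev d s,
      v.toLin f = ∑ x ∈ T, (v.mul (zero_lt_one.trans hs).le ⟨_, GevreyC.mem_gev (ϕ x)⟩).toLin
        ⟨_, mul_mem_gev (zero_lt_one.trans hs).le f.2 (GevreyC.mem_gev (θ x))⟩ := by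
  obtain ⟨R, hR, hvR⟩ := v.exists_apply_eq_of_eqOn
  obtain ⟨χ, hχ⟩ := exists_eq_one_on_unit_ball d hs
  set ρ : GevreyC d s := GevreyC.dilate χ hR
  have hρ : IsCompact (tsupport ρ.1) := ρ.2.2.1
  obtain ⟨T, hT⟩ := hρ.elim_finite_subcover (fun x => {y | (ϕ x).1 y ≠ 0})
    (fun x => isOpen_ne_fun (ϕ x).2.1.continuous continuous_const)
    fun x _ => Set.mem_iUnion.mpr ⟨x, hϕ x⟩
  obtain ⟨θ, hθ⟩ := exists_sum_mul_eq_one hs ρ T ϕ fun y hy => by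
    simpa only [Set.mem_iUnion, exists_prop, Set.mem_ofPred_eq] using hT hy
  refine ⟨T, θ, fun f => ?_⟩
  change v.toLin f = ∑ x ∈ T, v.toLin _
  rw [← map_sum]
  refine hvR _ _ fun y hy => ?_
  rw [mem_ball_zero_iff] at hy
  rw [Submodule.coe_sum, Finset.sum_apply]
  change f.1 y = ∑ x ∈ T, f.1 y * (θ x).1 y * (ϕ x).1 y
  simp only [mul_assoc]
  rw [← Finset.mul_sum, hθ y (GevreyC.dilate_eq_one hχ hR hy.le), mul_one]

lemma integral_exp_mul_exp_comp_sub (c r : ℝ) (ξ : Rd d) :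
    ∫ η : Rd d, c * Real.exp (-(r * ‖η - ξ‖ ^ (1 / s))) =
      c * ∫ η : Rd d, Real.exp (-(r * ‖η‖ ^ (1 / s))) := by
  rw [integral_const_mul,
    integral_sub_right_eq_self (fun η : Rd d => Real.exp (-(r * ‖η‖ ^ (1 / s)))) ξ]

/-- Multiplication by a test function is a convolution on the Fourier side. -/
lemma IsOpenConic.exists_decaysOn_apply_charGev_mul (hs : 0 < s) {Γ : Set (Rd d)}
    (hΓ : IsOpenConic Γ) {η₀ : Rd d} (hη₀ : η₀ ∈ Γ) :
    ∃ Γ' : Set (Rd d), IsOpenConic Γ' ∧ η₀ ∈ Γ' ∧ ∀ (v : GevDual d s) (θ : GevreyC d s),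
      DecaysOn s (fun η => v.toLin (charGev hs η)) Γ →
        DecaysOn s (fun ξ => v.toLin
          ⟨_, mul_mem_gev hs.le (charGev hs ξ).2 (GevreyC.mem_gev θ)⟩) Γ' := by
  obtain ⟨Γ', hΓ', hη₀', hconv⟩ := hΓ.exists_convolution_bound hs hη₀
  refine ⟨Γ', hΓ', hη₀', fun v θ hv => decaysOn_iff.mpr fun r hr => ?_⟩
  set θ' : Sig d 1 s := Submodule.inclusion (gevreyC_le_sig one_pos) θ
  obtain ⟨C, hC0, hC⟩ := hconv _ _ (v.moderateGrowth_apply_charGev hs) hv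
    (Sig.rapidDecay_fourierInv hs one_pos θ') r hr
  refine ⟨‖fourierConst d‖ * C * ∫ η : Rd d, Real.exp (-(1 * ‖η‖ ^ (1 / s))), by positivity,
    fun ξ hξ => ?_⟩
  have hrepr : v.toLin ⟨_, mul_mem_gev hs.le (charGev hs ξ).2 (GevreyC.mem_gev θ)⟩ =
      ∫ η, fourierConst d * v.toLin (charGev hs η) * fourierInv θ.1 (η - ξ) := by
    simp only [← fourierInv_char_mul]
    exact v.apply_eq_integral_mul_fourierInv hs one_pos (Sig.mulChar hs θ' ξ)
  rw [hrepr, mul_right_comm, ← integral_exp_mul_exp_comp_sub _ 1 ξ]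
  refine norm_integral_le_of_norm_le
    (((integrable_exp_neg_norm_rpow hs one_pos).comp_sub_right ξ).const_mul _)
    (.of_forall fun η => ?_)
  rw [norm_mul, norm_mul]
  simp only [mul_assoc]
  exact mul_le_mul_of_nonneg_left (hC ξ hξ η) (norm_nonneg _)

lemma SigDual.HasDecomposition.decaysOn_mul_apply_charGev {u : SigDual d t s} {v : GevDual d s}
    {w : Sig d t s} (hu : u.HasDecomposition v w) (hs : 0 < s) (ht : 0 < t) {ϕ : GevreyC d s}
    {Γ : Set (Rd d)} (hΓ : DecaysOn s ((u.toGevreyDual ht).localFourier hs ϕ) Γ) :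
    DecaysOn s (fun η => (v.mul hs.le ⟨_, GevreyC.mem_gev ϕ⟩).toLin (charGev hs η)) Γ := by
  set p : Sig d t s := Submodule.inclusion (gevreyC_le_sig ht)
    ⟨_, mul_mem_gevreyC hs.le (Sig.mem_gev w) ϕ⟩
  have hlocal : ∀ η, (u.toGevreyDual ht).localFourier hs ϕ η = fourierConst d *
      (v.mul hs.le ⟨_, GevreyC.mem_gev ϕ⟩).toLin (charGev hs η) + fourierInv p.1 (-η) := fun η => by
    have hw : ∫ x, w.1 x * (char η x * ϕ.1 x) = (fourierConst d)⁻¹ * fourierInv p.1 (-η) := by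
      rw [← integral_mul_char_eq_fourierInv]
      refine integral_congr_ae (.of_forall fun x => ?_)
      change w.1 x * (char η x * ϕ.1 x) = w.1 x * ϕ.1 x * char η x
      ring
    change fourierConst d * u.toLin (Sig.mulChar hs (Submodule.inclusion (gevreyC_le_sig ht) ϕ) η)
      = _
    rw [hu, mul_add]
    congr 1
    change fourierConst d * ∫ x, w.1 x * (char η x * ϕ.1 x) = _
    rw [hw, mul_inv_cancel_left₀ (fourierConst_ne_zero d)]
  have hsub : (fun η => (v.mul hs.le ⟨_, GevreyC.mem_gev ϕ⟩).toLin (charGev hs η)) = fun η =>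
      (fourierConst d)⁻¹ * (u.toGevreyDual ht).localFourier hs ϕ η +
        -(fourierConst d)⁻¹ * fourierInv p.1 (-η) := by
    funext η
    rw [hlocal, mul_add, inv_mul_cancel_left₀ (fourierConst_ne_zero d)]
    ring
  rw [hsub]
  exact (hΓ.const_mul _).add
    (((Sig.rapidDecay_fourierInv hs ht p).comp_neg.decaysOn Γ).const_mul _)

theorem exists_decaysOn_of_forall_notMem_waveFront (hs : 1 < s) (ht : 0 < t) {u : SigDual d t s}
    {v : GevDual d s} {w : Sig d t s} (hu : u.HasDecomposition v w) {η₀ : Rd d} (hη₀ : η₀ ≠ 0)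
    (hwf : ∀ x, (x, η₀) ∉ (u.toGevreyDual ht).waveFront (zero_lt_one.trans hs)) :
    ∃ Γ : Set (Rd d), IsOpenConic Γ ∧ η₀ ∈ Γ ∧
      DecaysOn s (fourierSum (zero_lt_one.trans hs) v w) Γ := by
  have hs0 : 0 < s := zero_lt_one.trans hs
  have hlocal : ∀ x : Rd d, ∃ ϕ : GevreyC d s, ϕ.1 x = 1 ∧ ∃ Γ : Set (Rd d), IsOpenConic Γ ∧
      η₀ ∈ Γ ∧ DecaysOn s ((u.toGevreyDual ht).localFourier hs0 ϕ) Γ := fun x =>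
    not_not.mp fun hno => hwf x ⟨hη₀, hno⟩
  choose ϕ hϕ Γ hΓ hη₀Γ hdec using hlocal
  obtain ⟨T, θ, hv⟩ := v.exists_apply_eq_sum hs (ϕ := ϕ) fun x => by simp [hϕ x]
  obtain ⟨Γ₁, hΓ₁, hη₀₁, hsub⟩ := exists_isOpenConic_biInter T hΓ hη₀Γ hη₀
  obtain ⟨Γ₂, hΓ₂, hη₀₂, hmul⟩ := hΓ₁.exists_decaysOn_apply_charGev_mul hs0 hη₀₁
  have hdecay : DecaysOn s (fun ξ => v.toLin (charGev hs0 ξ)) Γ₂ := by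
    simp only [hv]
    exact DecaysOn.sum T fun x hx =>
      hmul _ (θ x) ((hu.decaysOn_mul_apply_charGev hs0 ht (hdec x)).mono (hsub x hx))
  exact ⟨Γ₂, hΓ₂, hη₀₂, (hdecay.const_mul _).add
    ((Sig.rapidDecay_fourierInv hs0 ht w).comp_neg.decaysOn Γ₂)⟩

end LocalDecay

/-! ### The anisotropic wave front set of a decomposable functional -/

section WaveFront

variable {d : ℕ} {s t : ℝ} {u : SigDual d t s} {v : GevDual d s} {w ψ : Sig d t s}
  {g : Rd d → ℂ} {η₀ : Rd d}

lemma norm_smul_rpow {E : Type*} [NormedAddCommGroup E] [NormedSpace ℝ E] (hs : s ≠ 0) {l : ℝ}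
    (hl : 0 < l) (x : E) : ‖l ^ s • x‖ ^ (1 / s) = l * ‖x‖ ^ (1 / s) := by
  rw [norm_smul, Real.norm_of_nonneg (by positivity), Real.mul_rpow (by positivity) (norm_nonneg x),
    ← Real.rpow_mul hl.le, mul_one_div_cancel hs, Real.rpow_one]

/-- In `(l ^ t • x, l ^ s • ξ)` the growth in `l ^ s • ξ` and the decay in `l ^ t • x` both have
exponents linear in `l`, and the rate of the decay is arbitrary. -/
lemma SigDual.HasDecomposition.exists_norm_stft_smul_le (hu : u.HasDecomposition v w)
    (hs : 0 < s) (ht : 0 < t) (ψ : Sig d t s) {ε R r : ℝ} (hε : 0 < ε) (hR : 0 ≤ R)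
    (hr : 0 ≤ r) :
    ∃ C : ℝ, 0 ≤ C ∧ ∀ l : ℝ, 0 < l → ∀ x ξ : Rd d, ε ≤ ‖x‖ → ‖ξ‖ ≤ R →
      ‖u.stft ht hs ψ (l ^ t • x) (l ^ s • ξ)‖ ≤
        C * (Real.exp (-(r * l)) * Real.exp (-(1 * ‖l ^ t • x‖ ^ (1 / t)))) := by
  obtain ⟨r₀, hr₀, hdecay⟩ := hu.exists_norm_stft_le hs ht ψ
  set q : ℝ := r + r₀ * R ^ (1 / s) with hq
  obtain ⟨C, hC0, hC⟩ := hdecay (q / ε ^ (1 / t) + 1) (by positivity)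
  refine ⟨C, hC0, fun l hl x ξ hx hξ => (hC _ _).trans ?_⟩
  have hgrowth : ‖l ^ s • ξ‖ ^ (1 / s) ≤ l * R ^ (1 / s) := by
    rw [norm_smul_rpow hs.ne' hl]
    gcongr
  have hdecay : q * l ≤ q / ε ^ (1 / t) * ‖l ^ t • x‖ ^ (1 / t) := by
    rw [norm_smul_rpow ht.ne' hl, div_mul_eq_mul_div, le_div_iff₀ (by positivity), mul_assoc]
    gcongr
  rw [mul_assoc, ← Real.exp_add, ← Real.exp_add]
  gcongr C * Real.exp ?_
  have := mul_le_mul_of_nonneg_left hgrowth hr₀.le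
  rw [hq, add_mul] at hdecay
  linarith

lemma SigDual.HasDecomposition.notMem_waveFront_of_fst_ne_zero (hu : u.HasDecomposition v w)
    (hs : 0 < s) (ht : 0 < t) {p : Rd d × Rd d} (hp : p.1 ≠ 0) : p ∉ u.waveFront ht hs ψ := by
  rintro ⟨-, hno⟩
  have hp0 : 0 < ‖p.1‖ := norm_pos_iff.mpr hp
  refine hno ⟨{z | ‖p.1‖ / 2 < ‖z.1‖ ∧ ‖z.2‖ < ‖p.2‖ + 1},
    (isOpen_lt continuous_const continuous_fst.norm).inter
      (isOpen_lt continuous_snd.norm continuous_const), fun h => ?_,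
    ⟨half_lt_self hp0, lt_add_one _⟩, fun r hr => ?_⟩
  · have hzero : ‖p.1‖ / 2 < ‖(0 : Rd d)‖ := h.1
    rw [norm_zero] at hzero
    linarith
  · obtain ⟨C, hC0, hC⟩ := hu.exists_norm_stft_smul_le hs ht ψ (half_pos hp0)
      (R := ‖p.2‖ + 1) (by positivity) hr.le
    refine ⟨C, fun l hl z hz => exp_mul_le_iff.mpr ((hC l hl z.1 z.2 hz.1.le hz.2.le).trans ?_)⟩
    gcongr
    refine mul_le_of_le_one_right (Real.exp_pos _).le (Real.exp_le_one_iff.mpr ?_)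
    exact neg_nonpos.mpr (by positivity)

lemma notMem_waveFront_of_decaysOn (hs : 0 < s) (ht : 0 < t) (hg : u.HasFourierTransform g)
    (hgm : ModerateGrowth s g) {Γ : Set (Rd d)} (hΓ : IsOpenConic Γ) (hη₀ : η₀ ∈ Γ)
    (hdec : DecaysOn s g Γ) (x₀ : Rd d) : (x₀, η₀) ∉ u.waveFront ht hs ψ := by
  rintro ⟨-, hno⟩
  have hη₀_pos : 0 < ‖η₀‖ := norm_pos_iff.mpr fun h => hΓ.2.1 (h ▸ hη₀)
  obtain ⟨Γ', hΓ', hη₀', hconv⟩ := hΓ.exists_convolution_bound hs hη₀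
  refine hno ⟨{z | z.2 ∈ Γ' ∧ ‖η₀‖ / 2 < ‖z.2‖}, (hΓ'.1.preimage continuous_snd).inter
    (isOpen_lt continuous_const continuous_snd.norm), fun h => hΓ'.2.1 h.1,
    ⟨hη₀', half_lt_self hη₀_pos⟩, fun r hr => ?_⟩
  set a : ℝ := (‖η₀‖ / 2) ^ (1 / s)
  obtain ⟨C, hC0, hC⟩ := hconv g _ hgm hdec
    (Sig.rapidDecay_fourierInv hs ht (Sig.conj ψ)) (r / a) (by positivity)
  set I : ℝ := ∫ η : Rd d, Real.exp (-(1 * ‖η‖ ^ (1 / s)))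
  refine ⟨‖fourierConst d‖ * (C * I), fun l hl z hz => exp_mul_le_iff.mpr ?_⟩
  have ha : a ≤ ‖z.2‖ ^ (1 / s) := Real.rpow_le_rpow (by positivity) hz.2.le (by positivity)
  have hdecay : r * l ≤ r / a * ‖l ^ s • z.2‖ ^ (1 / s) := by
    rw [norm_smul_rpow hs.ne' hl, div_mul_eq_mul_div, le_div_iff₀ (by positivity), mul_assoc]
    gcongr
  have hstft := hg.norm_stft_le hs ht (((integrable_exp_neg_norm_rpow hs
    one_pos).comp_sub_right (l ^ s • z.2)).const_mul _) (l ^ t • z.1) (l ^ s • z.2) fun η =>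
      (hC _ (hΓ'.2.2 z.2 hz.1 (l ^ s) (by positivity)) η).trans_eq (mul_assoc _ _ _).symm
  calc ‖u.stft ht hs ψ (l ^ t • z.1) (l ^ s • z.2)‖
      ≤ ‖fourierConst d‖ * (C * Real.exp (-(r / a * ‖l ^ s • z.2‖ ^ (1 / s))) * I) := by
        rwa [integral_exp_mul_exp_comp_sub] at hstft
    _ ≤ ‖fourierConst d‖ * (C * Real.exp (-(r * l)) * I) := by gcongr
    _ = ‖fourierConst d‖ * (C * I) * Real.exp (-(r * l)) := by ring

lemma SigDual.HasDecomposition.exists_norm_stft_le_of_forall_near (hu : u.HasDecomposition v w)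
    (hs : 0 < s) (ht : 0 < t) {ε : ℝ} (hε : 0 < ε)
    (hnear : ∀ r : ℝ, 0 < r → ∃ C : ℝ, ∀ l : ℝ, 0 < l → ∀ x ξ : Rd d, ‖x‖ < ε → ‖ξ - η₀‖ < ε →
      Real.exp (r * l) * ‖u.stft ht hs ψ (l ^ t • x) (l ^ s • ξ)‖ ≤ C) {r : ℝ} (hr : 0 ≤ r) :
    ∃ C : ℝ, 0 ≤ C ∧ ∀ l : ℝ, 0 < l → ∀ ξ : Rd d, ‖ξ - η₀‖ < ε → ∀ x : Rd d,
      ‖u.stft ht hs ψ x (l ^ s • ξ)‖ ≤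
        C * (Real.exp (-(r * l)) * Real.exp (-(1 * ‖x‖ ^ (1 / t)))) := by
  obtain ⟨A, hA⟩ := hnear (r + ε ^ (1 / t)) (by positivity)
  obtain ⟨B, hB0, hB⟩ := hu.exists_norm_stft_smul_le hs ht ψ hε (R := ‖η₀‖ + ε) (by positivity) hr
  refine ⟨max A B, hB0.trans (le_max_right _ _), fun l hl ξ hξ x => ?_⟩
  obtain ⟨y, rfl⟩ : ∃ y, x = l ^ t • y :=
    ⟨(l ^ t)⁻¹ • x, (smul_inv_smul₀ (Real.rpow_pos_of_pos hl t).ne' x).symm⟩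
  rcases lt_or_ge ‖y‖ ε with hy | hy
  · have hyl : ‖l ^ t • y‖ ^ (1 / t) ≤ l * ε ^ (1 / t) := by
      rw [norm_smul_rpow ht.ne' hl]
      gcongr
    calc ‖u.stft ht hs ψ (l ^ t • y) (l ^ s • ξ)‖
        ≤ A * Real.exp (-((r + ε ^ (1 / t)) * l)) := exp_mul_le_iff.mp (hA l hl y ξ hy hξ)
      _ ≤ max A B * Real.exp (-(r * l) + -(1 * ‖l ^ t • y‖ ^ (1 / t))) := by
        refine mul_le_mul (le_max_left A B) (Real.exp_le_exp.mpr ?_) (Real.exp_pos _).le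
          (hB0.trans (le_max_right _ _))
        linarith
      _ = _ := by rw [Real.exp_add]
  · refine (hB l hl y ξ hy ?_).trans ?_
    · linarith [norm_sub_norm_le ξ η₀]
    · gcongr
      exact le_max_right _ _

lemma SigDual.HasFourierTransform.norm_mul_norm_window_le (hs : 0 < s) (ht : 0 < t)
    (hg : u.HasFourierTransform g) {G : Rd d → ℝ} (hG : Integrable G) {ξ : Rd d}
    (hint : Integrable fun x => u.stft ht hs ψ x ξ) (hle : ∀ x, ‖u.stft ht hs ψ x ξ‖ ≤ G x)
    (η : Rd d) :
    ‖g η‖ * ‖fourierInv (Sig.conj ψ).1 (η - ξ)‖ ≤ ‖fourierConst d‖ * ∫ x, G x := by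
  rw [← norm_mul, hg.mul_window_eq hs ht hint, norm_mul]
  gcongr
  refine norm_integral_le_of_norm_le hG (.of_forall fun x => ?_)
  rw [norm_mul, norm_mul, norm_char, norm_char, one_mul, mul_one]
  exact hle x

lemma exists_norm_le_mul_exp_of_norm_le (hs : 0 < s) (hg : Continuous g) (R : ℝ) {r : ℝ}
    (hr : 0 ≤ r) : ∃ C : ℝ, 0 ≤ C ∧ ∀ η : Rd d, ‖η‖ ≤ R →
      ‖g η‖ ≤ C * Real.exp (-(r * ‖η‖ ^ (1 / s))) := by
  obtain ⟨M, hM⟩ := (isCompact_closedBall (0 : Rd d) R).exists_bound_of_continuousOn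
    hg.continuousOn
  refine ⟨max M 0 * Real.exp (r * R ^ (1 / s)), by positivity, fun η hη => ?_⟩
  rw [← exp_mul_le_iff, mul_comm]
  gcongr
  exact (hM η (mem_closedBall_zero_iff.mpr hη)).trans (le_max_left _ _)

lemma decaysOn_coneAt (hs : 0 < s) (hg : Continuous g) {δ : ℝ} (hδ : 0 < δ)
    (hlarge : ∀ r : ℝ, 0 < r → ∃ N C : ℝ, 0 ≤ C ∧ ∀ ν : ℝ, 0 < ν → N < ν →
      ∀ z ∈ Metric.ball η₀ δ, ‖g (ν • z)‖ ≤ C * Real.exp (-(r * ν ^ (1 / s)))) :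
    DecaysOn s g (coneAt η₀ δ) := by
  refine decaysOn_iff.mpr fun r hr => ?_
  set T : ℝ := ‖η₀‖ + δ
  obtain ⟨N, C, hC0, hC⟩ := hlarge (r * T ^ (1 / s)) (by positivity)
  obtain ⟨D, -, hD⟩ := exists_norm_le_mul_exp_of_norm_le hs hg (N * T) hr.le
  refine ⟨max C D, hC0.trans (le_max_left _ _), ?_⟩
  rintro _ ⟨ν, hν : 0 < ν, z, hz, rfl⟩
  beta_reduce
  have hzT : ‖z‖ ≤ T := by
    linarith [norm_sub_norm_le z η₀, mem_ball_iff_norm.mp hz]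
  have hνz : ‖ν • z‖ ≤ ν * T := by
    rw [norm_smul, Real.norm_of_nonneg hν.le]
    gcongr
  rcases lt_or_ge N ν with hN | hN
  · have hpow : ‖ν • z‖ ^ (1 / s) ≤ T ^ (1 / s) * ν ^ (1 / s) := by
      rw [← Real.mul_rpow (by positivity) hν.le, mul_comm T]
      gcongr
    refine (hC ν hν hN z hz).trans ?_
    rw [mul_assoc]
    gcongr
    exact le_max_left _ _
  · refine (hD _ (hνz.trans (by gcongr))).trans ?_
    gcongr
    exact le_max_right _ _

lemma SigDual.exists_forall_near_of_notMem_waveFront (hs : 0 < s) (ht : 0 < t) (hη₀ : η₀ ≠ 0)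
    (hwf : ((0 : Rd d), η₀) ∉ u.waveFront ht hs ψ) :
    ∃ ε : ℝ, 0 < ε ∧ ε ≤ ‖η₀‖ ∧ ∀ r : ℝ, 0 < r → ∃ C : ℝ, ∀ l : ℝ, 0 < l → ∀ x ξ : Rd d,
      ‖x‖ < ε → ‖ξ - η₀‖ < ε →
        Real.exp (r * l) * ‖u.stft ht hs ψ (l ^ t • x) (l ^ s • ξ)‖ ≤ C := by
  obtain ⟨U, hU, -, hηU, hdec⟩ : ∃ U : Set (Rd d × Rd d), IsOpen U ∧ 0 ∉ U ∧ (0, η₀) ∈ U ∧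
      ∀ r : ℝ, 0 < r → ∃ C : ℝ, ∀ l : ℝ, 0 < l → ∀ z ∈ U,
        Real.exp (r * l) * ‖u.stft ht hs ψ (l ^ t • z.1) (l ^ s • z.2)‖ ≤ C :=
    not_not.mp fun hno => hwf ⟨fun h => hη₀ (congrArg Prod.snd h), hno⟩
  obtain ⟨ρ, hρ, hball⟩ := Metric.isOpen_iff.mp hU _ hηU
  refine ⟨min ρ ‖η₀‖, lt_min hρ (norm_pos_iff.mpr hη₀), min_le_right _ _, fun r hr => ?_⟩
  refine (hdec r hr).imp fun C hC l hl x ξ hx hξ => hC l hl (x, ξ) (hball ?_)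
  rw [Metric.mem_ball, Prod.dist_eq, max_lt_iff, dist_zero_right, dist_eq_norm]
  exact ⟨hx.trans_le (min_le_left _ _), hξ.trans_le (min_le_left _ _)⟩

lemma norm_sub_inv_smul_sub_lt {E : Type*} [NormedAddCommGroup E] [NormedSpace ℝ E] {z ζ η : E}
    {ε ν : ℝ} (hε : 0 < ε) (hν : 0 < ν) (hζ : 2 * ‖ζ‖ / ε < ν) (hz : ‖z - η‖ < ε / 2) :
    ‖z - ν⁻¹ • ζ - η‖ < ε := by
  have hsmall : ‖ν⁻¹ • ζ‖ ≤ ε / 2 := by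
    rw [norm_smul, norm_inv, Real.norm_of_nonneg hν.le, inv_mul_le_iff₀ hν]
    rw [div_lt_iff₀ hε] at hζ
    linarith
  rw [sub_right_comm]
  linarith [norm_sub_le (z - η) (ν⁻¹ • ζ)]

theorem exists_decaysOn_of_notMem_waveFront (hs : 0 < s) (ht : 0 < t)
    (hu : u.HasDecomposition v w) (hg : u.HasFourierTransform g) (hψ : ψ ≠ 0) (hη₀ : η₀ ≠ 0)
    (hwf : ((0 : Rd d), η₀) ∉ u.waveFront ht hs ψ) :
    ∃ Γ : Set (Rd d), IsOpenConic Γ ∧ η₀ ∈ Γ ∧ DecaysOn s g Γ := by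
  obtain ⟨ε, hε, hεη₀, hnear⟩ := SigDual.exists_forall_near_of_notMem_waveFront hs ht hη₀ hwf
  obtain ⟨ζ, hζ⟩ := exists_fourierInv_conj_ne_zero hs ht hψ
  refine ⟨coneAt η₀ (ε / 2), isOpenConic_coneAt (by linarith), mem_coneAt_self (half_pos hε),
    decaysOn_coneAt hs hg.1 (half_pos hε) fun r hr => ?_⟩
  obtain ⟨C, hC0, hC⟩ := hu.exists_norm_stft_le_of_forall_near hs ht hε hnear hr.le
  set I : ℝ := ∫ x : Rd d, Real.exp (-(1 * ‖x‖ ^ (1 / t)))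
  set c : ℝ := ‖fourierInv (Sig.conj ψ).1 ζ‖
  have hc : 0 < c := norm_pos_iff.mpr hζ
  refine ⟨2 * ‖ζ‖ / ε, ‖fourierConst d‖ * (C * I) / c, by positivity, fun ν hν hνζ z hz => ?_⟩
  have hscale : (ν ^ (1 / s)) ^ s • (z - ν⁻¹ • ζ) = ν • z - ζ := by
    rw [← Real.rpow_mul hν.le, one_div_mul_cancel hs.ne', Real.rpow_one, smul_sub,
      smul_inv_smul₀ hν.ne']
  have hstft := hC (ν ^ (1 / s)) (by positivity) (z - ν⁻¹ • ζ)
    (norm_sub_inv_smul_sub_lt hε hν hνζ (mem_ball_iff_norm.mp hz))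
  simp only [hscale, ← mul_assoc] at hstft
  have hwindow := hg.norm_mul_norm_window_le hs ht
    ((integrable_exp_neg_norm_rpow ht one_pos).const_mul _)
    (hu.integrable_stft hs ht ψ _) hstft (ν • z)
  rw [sub_sub_cancel, integral_const_mul, ← le_div_iff₀ hc] at hwindow
  exact hwindow.trans_eq (by ring)

end WaveFront

end GelfandShilov

end

open GelfandShilov

theorem proposition5p2_general {d : ℕ} {t s : ℝ} (ht : 0 < t) (hs : 1 < s)
    (u : SigDual d t s) (hu : u.MemCompactAddSig ht) (ψ : Sig d t s) (hψ : ψ ≠ 0) :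
    u.waveFront ht (zero_lt_one.trans hs) ψ ⊆
        {0} ×ˢ (Prod.snd '' (u.toGevreyDual ht).waveFront (zero_lt_one.trans hs)) ∧
      u.waveFront ht (zero_lt_one.trans hs) ψ = {0} ×ˢ u.singularDirections := by
  have hs0 := zero_lt_one.trans hs
  obtain ⟨v, w, huvw⟩ := hu.exists_hasDecomposition hs
  have hg := huvw.hasFourierTransform hs0 ht
  have hgm := moderateGrowth_fourierSum hs0 ht v w
  have hfst : ∀ p ∈ u.waveFront ht hs0 ψ, p.1 = 0 ∧ p.2 ≠ 0 := fun p hp =>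
    have hp1 : p.1 = 0 := by_contra fun h => huvw.notMem_waveFront_of_fst_ne_zero hs0 ht h hp
    ⟨hp1, fun hp2 => hp.1 (Prod.ext hp1 hp2)⟩
  refine ⟨?_, Set.Subset.antisymm ?_ ?_⟩
  · rintro ⟨x, η⟩ hp
    obtain ⟨rfl, hη⟩ := hfst _ hp
    refine ⟨rfl, by_contra fun hno => ?_⟩
    obtain ⟨Γ, hΓ, hηΓ, hdec⟩ := exists_decaysOn_of_forall_notMem_waveFront hs ht huvw hη
      fun x hx => hno ⟨(x, η), hx, rfl⟩
    exact notMem_waveFront_of_decaysOn hs0 ht hg hgm hΓ hηΓ hdec 0 hp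
  · rintro ⟨x, η⟩ hp
    obtain ⟨rfl, hη⟩ := hfst _ hp
    refine ⟨rfl, hη, ?_⟩
    rintro ⟨g, hg', Γ, hΓ, hηΓ, hdec⟩
    rw [hg'.unique hs0 ht hψ hg] at hdec
    exact notMem_waveFront_of_decaysOn hs0 ht hg hgm hΓ hηΓ hdec 0 hp
  · rintro ⟨x, η⟩ ⟨hx, hη, hsing⟩
    obtain rfl : x = 0 := hx
    exact by_contra fun hwf =>
      hsing ⟨_, hg, exists_decaysOn_of_notMem_waveFront hs0 ht huvw hg hψ hη hwf⟩

theorem proposition5p2 {d : ℕ} {t s : ℝ} (ht : 0 < t) (hs : 1 < s)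
    (u : GelfandShilov.SigDual d t s) (hu : u.MemCompactAddSig ht)
    (ψ : GelfandShilov.Sig d t s) (hψ : ψ ≠ 0) :
    u.waveFront ht (zero_lt_one.trans hs) ψ ⊆
        {0} ×ˢ (Prod.snd '' (u.toGevreyDual ht).waveFront (zero_lt_one.trans hs)) ∧
      (s ≤ t → u.waveFront ht (zero_lt_one.trans hs) ψ = {0} ×ˢ u.singularDirections) :=
  (proposition5p2_general ht hs u hu ψ hψ).imp_right fun h _ => h
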